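/- **Setting.** Let $\mathcal H$ be a complex separable Hilbert space with inner product $\langle\cdot,\cdot\rangle$ (linear in the first argument), $(f\otimes g)v=\langle v,g\rangle f$, and let $\langle A,B\rangle_{S_2}=\sum_i\langle A\chi_i,B\chi_i\rangle$ ($(\chi_i)$ an orthonormal basis) be the Hilbert–Schmidt inner product with norm $\|\cdot\|_2$. A process $(V_t)_{t\in\mathbb Z}$ in $\mathcal H$ has physical dependence structure of order $p$ if $V_t=g(\epsilon_t,\epsilon_{t-1},\dots)$ a.s. for a measurable $g$ and i.i.d. innovations $\epsilon_t$ in a measurable space, and $\sum_{j\ge0}\nu_p(V_j)<\infty$, where $\nu_p(V_t)=\big(\mathbb E\|V_t-\mathbb E[V_t\mid\mathcal G_{t,\{0\}}]\|^p\big)^{1/p}$ and $\mathcal G_{t,\{0\}}$ is the $\sigma$-algebra generated by $(\epsilon_s)_{s\le t}$ with $\epsilon_0$ replaced by an independent copy $\epsilon_0'$. **Assumptions.** 1. $(X_t,Y_t)_{t\in\mathbb Z}$ is centered and weakly stationary in $\mathcal L^{p}_{\mathcal H\oplus\mathcal H}$, and both component processes have physical dependence structure of order $p$, where $p=4+\varepsilon$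 for some $\varepsilon>0$. 2. $w:\mathbb R\to\mathbb R$ is even, bounded, continuous except at finitely many points, with $w(x)\to1$ and $w(x)-1=O(x)$ as $x\to0$ (including $w(0)=1$), $\kappa=\int w^2<\infty$, $b\sum_{h\in\mathbb Z}w^2(bh)\to\kappa$ as $b\downarrow0$, and $\sup_{0<b\le1}b\sum_{|h|\ge L/b}w^2(bh)\to0$ as $L\to\infty$. 3. For $(V,i)\in\{(X,1),(Y,2)\}$ there is a real $\ell_i\ge1$ with $\sum_{h\ge0}h^{\ell_i}\nu_2(V_h)<\infty$ and $w(x)-1=O(|x|^{\ell_i})$ as $x\to0$, and the bandwidths $b_i=b_i(T)$ satisfy $b_i(T)\to0$, $b_i(T)T\to\infty$ and $b_i(T)^{1+2\ell_i}T\to0$ as $T\to\infty$. 4. The sample sizes $T_1,T_2$ tend to infinity along a sequence; write $b_i=b_i(T_i)$. If the processes $X$ and $Y$ are independent, then $b_1T_1/(b_1T_1+b_2T_2)\to\theta$ for some $\theta\in(0,1)$; if they are dependent, then $T_1=T_2$ and $b_1(T)/b_2(T)\to1$. 5. Let $0\le a\le b\le\pi$, and let $\mathcal F_V^{(\omega)}=\frac1{2\pi}\sum_{h\in\mathbb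 Z}\mathbb E(V_h\otimes V_0)e^{-\mathrm i\omega h}$, $V\in\{X,Y\}$. For every $\omega\in[a,b]$ the $k_0$ largest eigenvalues satisfy $\lambda^{(\omega)}_{V,1}>\dots>\lambda^{(\omega)}_{V,k_0}>0$. **Objects.** For $V\in\{X,Y\}$ let $(\lambda_{V,j}^{(\omega)},\phi_{V,j}^{(\omega)})_j$ be any complete orthonormal eigensystem of $\mathcal F_V^{(\omega)}$ which depends measurably on $\omega$ and starts with the $k_0$ largest eigenvalues in decreasing order, and put $\Pi_{V,jj'}^{(\omega)}=\phi_{V,j}^{(\omega)}\otimes\phi_{V,j'}^{(\omega)}$, $\Pi_{V,j}^{(\omega)}=\Pi_{V,jj}^{(\omega)}$. With $i=1$ for $V=X$ and $i=2$ for $V=Y$, $\tilde w^{(\omega)}_{b,s,t}=(2\pi)^{-1}w(b(t-s))e^{\mathrm i\omega(t-s)}$ and $\eta\in[0,1]$, let $$\hat{\mathcal F}_V^{(\omega)}(\eta)=\frac1{\lfloor\eta T_i\rfloor}\sum_{s,t=1}^{\lfloor\eta T_i\rfloor}\tilde w^{(\omega)}_{b_i,s,t}\,(V_s\otimes V_t)$$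 (zero if $\lfloor\eta T_i\rfloor=0$), $$\mathcal Z^{V,\omega}_{T,\eta}=\frac{\sqrt{b_i}}{\sqrt{T_i}}\sum_{s=1}^{\lfloor\eta T_i\rfloor}\Big(\sum_{t=1}^{\lfloor\eta T_i\rfloor}\tilde w^{(\omega)}_{b_i,s,t}\,(V_s\otimes V_t)-\mathcal F_V^{(\omega)}\Big),$$ and let $\hat\Pi^{(\omega)}_{V,j}(\eta)$ be the eigenprojectors of any complete orthonormal eigensystem of $\hat{\mathcal F}_V^{(\omega)}(\eta)$ which depends measurably on $\omega$ and starts with the $k_0$ largest eigenvalues in decreasing order. For $1\le k\le k_0-1$ put $$\hat{\mathcal Z}^{[a,b],(k)}_{\Pi,T_1,T_2}(\eta)=\int_a^b\Big(\big\|\eta\big(\hat\Pi^{(\omega)}_{X,k}(\eta)-\hat\Pi^{(\omega)}_{Y,k}(\eta)\big)\big\|_2^2-\eta^2\big\|\Pi^{(\omega)}_{X,k}-\Pi^{(\omega)}_{Y,k}\big\|_2^2\Big)d\omega,$$ $$\widetilde\Pi^{(\omega)}_{X,Y,k}=4\sum_{j\ne k}\frac{\lambda^{(\omega)}_{X,k}\,\Re\langle\Pi^{(\omega)}_{X,kj},\Pi^{(\omega)}_{Y,k}\rangle_{S_2}}{\lambda^{(\omega)}_{X,k}\lambda^{(\omega)}_{X,j}-(\lambda^{(\omega)}_{X,k})^2}\,\Pi^{(\omega)}_{X,jk},\qquad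 \widetilde\Pi^{(\omega)}_{Y,X,k}=4\sum_{j\ne k}\frac{\lambda^{(\omega)}_{Y,k}\,\Re\langle\Pi^{(\omega)}_{Y,kj},\Pi^{(\omega)}_{X,k}\rangle_{S_2}}{\lambda^{(\omega)}_{Y,k}\lambda^{(\omega)}_{Y,j}-(\lambda^{(\omega)}_{Y,k})^2}\,\Pi^{(\omega)}_{Y,jk}.$$ **Theorem 3.5.** Under these assumptions, for every $1\le k\le k_0-1$, $$\hat{\mathcal Z}^{[a,b],(k)}_{\Pi,T_1,T_2}(\eta)=\eta\int_a^b\Big(\frac{1}{\sqrt{b_2T_2}}\Re\big\langle\mathcal Z^{Y,\omega}_{T,\eta},\widetilde\Pi^{(\omega)}_{Y,X,k}\big\rangle_{S_2}+\frac1{\sqrt{b_1T_1}}\Re\big\langle\mathcal Z^{X,\omega}_{T,\eta},\widetilde\Pi^{(\omega)}_{X,Y,k}\big\rangle_{S_2}\Big)d\omega+o_P\Big(\frac1{\sqrt{b_1T_1+b_2T_2}}\Big)$$ as $T_1,T_2\to\infty$, uniformly in $\eta\in[0,1]$: the supremum over $\eta\in[0,1]$ of the absolute value of the remainder, multiplied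 by $\sqrt{b_1T_1+b_2T_2}$, tends to $0$ in (outer) probability. -/

import Mathlib

open MeasureTheory ProbabilityTheory Filter Topology Asymptotics
open scoped ENNReal

noncomputable section

section HilbertSchmidt

variable (H : Type*) [NormedAddCommGroup H] [InnerProductSpace ℂ H] [CompleteSpace H]

/-- The index set of a fixed orthonormal basis of `H`. -/
def HSIndex : Set H := Classical.choose (exists_hilbertBasis ℂ H)

/-- A fixed orthonormal basis `(χ_i)` of `H`, used to compute Hilbert-Schmidt quantities
(which do not depend on the choice of the basis). -/
def hsBasis : HilbertBasis (HSIndex H) ℂ H :=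
  Classical.choose (Classical.choose_spec (exists_hilbertBasis ℂ H))

variable {H}

/-- The tensor product `f ⊗ g`, i.e. the rank-one operator `v ↦ ⟨v, g⟩ f` (with an inner product
linear in its first slot; Mathlib's `inner ℂ g v` is linear in `v`). -/
def tensorOp (f g : H) : H →L[ℂ] H := InnerProductSpace.rankOne ℂ f g

/-- The Hilbert-Schmidt inner product `⟨A, B⟩_{S₂} = ∑ ⟨A χ_i, B χ_i⟩`, linear in `A`. -/
def hsInner (A B : H →L[ℂ] H) : ℂ :=
  ∑' i, inner ℂ (B (hsBasis H i)) (A (hsBasis H i))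

/-- The squared Hilbert-Schmidt norm `∑ ‖A χ_i‖²`. -/
def hsNormSq (A : H →L[ℂ] H) : ℝ :=
  ∑' i, ‖A (hsBasis H i)‖ ^ 2

end HilbertSchmidt

section Eigen

variable {H : Type*} [NormedAddCommGroup H] [InnerProductSpace ℂ H]

/-- `(lam j, φ j)` is a complete orthonormal system of eigenpairs of `A`, in which the positions
`e 0, e 1, …, e (m - 1)` carry the `m` largest eigenvalues (counted with multiplicity) in
decreasing order. The remaining eigenpairs may be listed in any order; this allows for
a finite-dimensional `H` and for operators with a kernel or with negative eigenvalues. -/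
structure IsEigensystem {ι : Type*} {m : ℕ} (e : Fin m ↪ ι) (A : H →L[ℂ] H)
    (lam : ι → ℝ) (φ : ι → H) : Prop where
  orthonormal : Orthonormal ℂ φ
  complete : (Submodule.span ℂ (Set.range φ)).topologicalClosure = ⊤
  eigen : ∀ j, A (φ j) = (lam j : ℂ) • φ j
  ordered : Antitone (fun i => lam (e i))
  top : ∀ j, j ∉ Set.range e → ∀ i, lam j ≤ lam (e i)

variable [CompleteSpace H]

/-- The weight operator
`Π̃_{X,Y,k} = 4 ∑_{j ≠ k} λ_k Re⟨φ_k ⊗ φ_j, ψ_k ⊗ ψ_k⟩ / (λ_k λ_j - λ_k²) • (φ_j ⊗ φ_k)`,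
where `(λ_j, φ_j)` is the eigensystem of the first operator and `ψ_k` is the `k`-th eigenvector
of the second one. -/
def weightOp {ι : Type*} (lam : ι → ℝ) (φ ψ : ι → H) (k : ι) : H →L[ℂ] H :=
  (4 : ℂ) • ∑' j : {j : ι // j ≠ k},
    (((lam k * (hsInner (tensorOp (φ k) (φ j)) (tensorOp (ψ k) (ψ k))).re)
      / (lam k * lam j - lam k ^ 2) : ℝ) : ℂ) • tensorOp (φ j) (φ k)

end Eigen

section TimeSeries

variable {Ω S H : Type*} [MeasurableSpace Ω] [MeasurableSpace S]
  [NormedAddCommGroup H] [InnerProductSpace ℂ H] [CompleteSpace H]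
  [MeasurableSpace H]

/-- `σ(ε_t, ε_{t-1}, …)` with the innovation at time `0` replaced by `ε₀`. -/
@[reducible] def coupledPast (ε : ℤ → Ω → S) (ε₀ : Ω → S) (t : ℤ) : MeasurableSpace Ω :=
  ⨆ s : {s : ℤ // s ≤ t},
    MeasurableSpace.comap (if (s : ℤ) = 0 then ε₀ else ε s) inferInstance

/-- The dependence measure `ν_p(V_t) = ‖V_t - E[V_t | coupled past]‖_p`. -/
def depMeasure (μ : Measure Ω) (ε : ℤ → Ω → S) (ε₀ : Ω → S) (V : ℤ → Ω → H)
    (p : ℝ≥0∞) (t : ℤ) : ℝ≥0∞ :=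
  eLpNorm (V t - μ[V t | coupledPast ε ε₀ t]) p μ

/-- Physical dependence structure of order `p`: the process is a causal functional
`V_t = g(ε_t, ε_{t-1}, …)` of i.i.d. innovations, `ε₀` is an independent copy of `ε 0`, and
`∑_j ν_p(V_j) < ∞`. -/
structure PhysicalDependence (μ : Measure Ω) (ε : ℤ → Ω → S) (ε₀ : Ω → S)
    (V : ℤ → Ω → H) (p : ℝ≥0∞) : Prop where
  measurable_process : ∀ t, Measurable (V t)
  measurable_innov : ∀ t, Measurable (ε t)
  measurable_copy : Measurable ε₀
  indep : iIndepFun ε μ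
  ident : ∀ t, IdentDistrib (ε t) (ε 0) μ μ
  copy_ident : IdentDistrib ε₀ (ε 0) μ μ
  copy_indep : IndepFun ε₀ (fun x t => ε t x) μ
  causal : ∃ g : (ℕ → S) → H, Measurable g ∧
    ∀ t, V t =ᵐ[μ] fun x => g (fun i => ε (t - (i : ℤ)) x)
  summable : ∑' j : ℕ, depMeasure μ ε ε₀ V p (j : ℤ) ≠ ∞

/-- The cross-covariance operator `E(U ⊗ V)` of centered random elements (Bochner integral). -/
def crossCov (μ : Measure Ω) (U V : Ω → H) : H →L[ℂ] H :=
  ∫ x, tensorOp (U x) (V x) ∂μ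

/-- `(X_t, Y_t)` is a centered weakly stationary bivariate process in `L^p`. -/
structure CenteredStationaryPair (μ : Measure Ω) (X Y : ℤ → Ω → H) (p : ℝ≥0∞) : Prop where
  memLp_fst : ∀ t, MemLp (X t) p μ
  memLp_snd : ∀ t, MemLp (Y t) p μ
  mean_fst : ∀ t, ∫ x, X t x ∂μ = 0
  mean_snd : ∀ t, ∫ x, Y t x ∂μ = 0
  cov_fst : ∀ t h : ℤ, crossCov μ (X (t + h)) (X t) = crossCov μ (X h) (X 0)
  cov_fst_snd : ∀ t h : ℤ, crossCov μ (X (t + h)) (Y t) = crossCov μ (X h) (Y 0)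
  cov_snd_fst : ∀ t h : ℤ, crossCov μ (Y (t + h)) (X t) = crossCov μ (Y h) (X 0)
  cov_snd : ∀ t h : ℤ, crossCov μ (Y (t + h)) (Y t) = crossCov μ (Y h) (Y 0)

/-- The spectral density operator `(2π)⁻¹ ∑_{h ∈ ℤ} E(V_h ⊗ V_0) e^{-iωh}`. -/
def spectralDensity (μ : Measure Ω) (V : ℤ → Ω → H) (ω : ℝ) : H →L[ℂ] H :=
  ((2 * Real.pi : ℝ) : ℂ)⁻¹ •
    ∑' h : ℤ, Complex.exp (-(Complex.I * ω * h)) • crossCov μ (V h) (V 0)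

end TimeSeries

/-- Conditions on the lag window function. -/
structure LagWindow (w : ℝ → ℝ) : Prop where
  even : ∀ x, w (-x) = w x
  bounded : ∃ C, ∀ x, |w x| ≤ C
  tendsto_one : Tendsto w (𝓝[≠] 0) (𝓝 1)
  continuous_off_finite : ∃ D : Set ℝ, D.Finite ∧ ∀ x, x ∉ D → ContinuousAt w x
  sq_integrable : ∫⁻ x, ENNReal.ofReal (w x ^ 2) ≠ ∞
  riemann_sum : Tendsto
    (fun b : ℝ => ENNReal.ofReal b * ∑' h : ℤ, ENNReal.ofReal (w (b * h) ^ 2))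
    (𝓝[>] 0) (𝓝 (∫⁻ x, ENNReal.ofReal (w x ^ 2)))
  tail : Tendsto
    (fun L : ℝ => ⨆ b ∈ Set.Ioc (0 : ℝ) 1, ENNReal.ofReal b *
      ∑' h : {h : ℤ // L / b ≤ |(h : ℝ)|}, ENNReal.ofReal (w (b * (h : ℤ)) ^ 2))
    atTop (𝓝 0)
  near_zero : (fun x => w x - 1) =O[𝓝 0] (fun x => x)

/-- Conditions on the bandwidth `b_T`, for a process with innovations `ε` and a window `w`:
`∑_h h^ℓ ν_2(V_h) < ∞`, the window has order `ℓ` at the origin, and `b_T → 0`, `b_T T → ∞`,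
`b_T^{1+2ℓ} T → 0`. The dependence measure vanishes at negative times, so the sum
runs over `h ≥ 0`. -/
structure BandwidthCondition {Ω S H : Type*} [MeasurableSpace Ω] [MeasurableSpace S]
    [NormedAddCommGroup H] [InnerProductSpace ℂ H] [CompleteSpace H]
    (μ : Measure Ω) (ε : ℤ → Ω → S) (ε₀ : Ω → S) (V : ℤ → Ω → H)
    (w : ℝ → ℝ) (b : ℕ → ℝ) (ℓ : ℝ) : Prop where
  one_le : 1 ≤ ℓ
  summable : ∑' h : ℕ, ENNReal.ofReal ((h : ℝ) ^ ℓ) * depMeasure μ ε ε₀ V 2 (h : ℤ) ≠ ∞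
  window_order : (fun x => w x - 1) =O[𝓝 0] (fun x => |x| ^ ℓ)
  tendsto_zero : Tendsto b atTop (𝓝 0)
  tendsto_mul : Tendsto (fun T : ℕ => b T * T) atTop atTop
  tendsto_bias : Tendsto (fun T : ℕ => b T ^ (1 + 2 * ℓ) * T) atTop (𝓝 0)

section Estimators

variable {H : Type*} [NormedAddCommGroup H] [InnerProductSpace ℂ H]

/-- The weights `(2π)⁻¹ w(b (t - s)) e^{iω(t - s)}`. -/
def lagWeight (w : ℝ → ℝ) (b ω : ℝ) (s t : ℕ) : ℂ :=
  ((2 * Real.pi : ℝ) : ℂ)⁻¹ * (w (b * ((t : ℝ) - s)) : ℂ) *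
    Complex.exp (Complex.I * ω * ((t : ℂ) - s))

variable [CompleteSpace H]

/-- The sequential lag window estimator `F̂(η)`, for a sample path `v` of length `T`
(it is the zero operator if `⌊ηT⌋ = 0`). -/
def seqEstimator (w : ℝ → ℝ) (b : ℝ) (T : ℕ) (v : ℤ → H) (η ω : ℝ) : H →L[ℂ] H :=
  ((⌊η * T⌋₊ : ℂ))⁻¹ • ∑ s ∈ Finset.Icc 1 ⌊η * T⌋₊, ∑ t ∈ Finset.Icc 1 ⌊η * T⌋₊,
    lagWeight w b ω s t • tensorOp (v s) (v t)

/-- The partial sum process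
`Z_{T,η}^ω = √b / √T ∑_{s ≤ ⌊ηT⌋} (∑_{t ≤ ⌊ηT⌋} w̃_{s,t} (v_s ⊗ v_t) - F)`. -/
def partialSumProcess (w : ℝ → ℝ) (b : ℝ) (T : ℕ) (v : ℤ → H) (F : H →L[ℂ] H)
    (η ω : ℝ) : H →L[ℂ] H :=
  ((Real.sqrt b / Real.sqrt T : ℝ) : ℂ) • ∑ s ∈ Finset.Icc 1 ⌊η * T⌋₊,
    (∑ t ∈ Finset.Icc 1 ⌊η * T⌋₊, lagWeight w b ω s t • tensorOp (v s) (v t) - F)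

/-- The centered empirical distance
`∫_a^b ‖η (Π̂_X - Π̂_Y)‖₂² - η² ‖Π_X - Π_Y‖₂² dω` of the projectors onto the lines spanned by the
unit vectors `φ̂_X(ω), φ̂_Y(ω)` and `φ_X(ω), φ_Y(ω)`. -/
def centeredDistance (a b η : ℝ) (fX fY gX gY : ℝ → H) : ℝ :=
  ∫ ω in a..b,
    (hsNormSq ((η : ℂ) • (tensorOp (fX ω) (fX ω) - tensorOp (fY ω) (fY ω)))
      - η ^ 2 * hsNormSq (tensorOp (gX ω) (gX ω) - tensorOp (gY ω) (gY ω)))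

end Estimators

/-- `R_n(η) = o_P(1 / r_n)` uniformly in `η ∈ [0, 1]`, i.e. `r_n sup_η |R_n(η)| → 0` in
probability. -/
def UniformLittleOP {Ω : Type*} [MeasurableSpace Ω] (μ : Measure Ω)
    (R : ℕ → ℝ → Ω → ℝ) (r : ℕ → ℝ) : Prop :=
  ∀ δ : ℝ, 0 < δ →
    Tendsto (fun n => μ {x | ∃ η ∈ Set.Icc (0 : ℝ) 1, δ < r n * |R n η x|}) atTop (𝓝 0)

end

noncomputable section

set_option linter.unusedSectionVars false
set_option linter.style.haveILetI false

section CondExpIndep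

variable {Ω E : Type*} [NormedAddCommGroup E] [NormedSpace ℝ E] [CompleteSpace E]
  {m m₁ N mΩ : MeasurableSpace Ω} {μ : Measure Ω}

theorem setIntegral_inter_of_indep [IsProbabilityMeasure μ] (hm : m ≤ mΩ) (hN : N ≤ mΩ)
    (hind : Indep m N μ) {f : Ω → E} (hf : Integrable f μ) (hfm : AEStronglyMeasurable[m] f μ)
    {A B : Set Ω} (hA : MeasurableSet[m] A) (hB : MeasurableSet[N] B) :
    ∫ x in A ∩ B, f x ∂μ = μ.real B • ∫ x in A, f x ∂μ := by
  obtain ⟨f', hf', hff'⟩ := hfm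
  have h1 : Integrable (A.indicator f') μ := (hf.congr hff').indicator (hm _ hA)
  have h2 := condExp_indep_eq hm hN (hf'.indicator hA) hind
  have h3 := setIntegral_condExp hN h1 hB
  rw [setIntegral_congr_ae (hN _ hB) (g := fun _ => ∫ x, A.indicator f' x ∂μ)
    (h2.mono fun x hx _ => hx), setIntegral_const, integral_indicator (hm _ hA),
    setIntegral_indicator (hm _ hA)] at h3
  have e : ∀ C : Set Ω, ∫ x in C, f x ∂μ = ∫ x in C, f' x ∂μ := fun C =>
    integral_congr_ae (ae_restrict_of_ae hff')
  rw [e, e, Set.inter_comm, ← h3]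

theorem generateFrom_inter_eq_sup (m N : MeasurableSpace Ω) :
    m ⊔ N = MeasurableSpace.generateFrom
      {s | ∃ A B, MeasurableSet[m] A ∧ MeasurableSet[N] B ∧ s = A ∩ B} := by
  apply le_antisymm
  · refine sup_le (fun s hs => ?_) (fun s hs => ?_)
    · exact MeasurableSpace.measurableSet_generateFrom ⟨s, Set.univ, hs, MeasurableSet.univ, by simp⟩
    · exact MeasurableSpace.measurableSet_generateFrom ⟨Set.univ, s, MeasurableSet.univ, hs, by simp⟩
  · refine MeasurableSpace.generateFrom_le ?_
    rintro s ⟨A, B, hA, hB, rfl⟩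
    exact MeasurableSet.inter ((le_sup_left : m ≤ m ⊔ N) _ hA) ((le_sup_right : N ≤ m ⊔ N) _ hB)

/-- Adding an independent σ-algebra does not change a conditional expectation. -/
theorem condExp_sup_of_indep [IsProbabilityMeasure μ] (hm : m ≤ mΩ) (hN : N ≤ mΩ)
    (hind : Indep m N μ) (hm₁ : m₁ ≤ m) {f : Ω → E}
    (hfm : AEStronglyMeasurable[m] f μ) : μ[f | m₁ ⊔ N] =ᵐ[μ] μ[f | m₁] := by
  by_cases hf : Integrable f μ
  swap
  · rw [condExp_of_not_integrable hf, condExp_of_not_integrable hf]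
  have hle : m₁ ⊔ N ≤ mΩ := sup_le (hm₁.trans hm) hN
  symm
  refine ae_eq_condExp_of_forall_setIntegral_eq hle hf
    (fun s _ _ => integrable_condExp.integrableOn) ?_
    ((stronglyMeasurable_condExp.mono (le_sup_left : m₁ ≤ m₁ ⊔ N)).aestronglyMeasurable)
  intro s hs _
  have hg : Integrable (μ[f | m₁]) μ := integrable_condExp
  have htot : ∫ x, (μ[f | m₁]) x ∂μ = ∫ x, f x ∂μ := integral_condExp (hm₁.trans hm)
  have hpi : IsPiSystem {s | ∃ A B, MeasurableSet[m₁] A ∧ MeasurableSet[N] B ∧ s = A ∩ B} := by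
    rintro _ ⟨A, B, hA, hB, rfl⟩ _ ⟨A', B', hA', hB', rfl⟩ _
    exact ⟨A ∩ A', B ∩ B', hA.inter hA', hB.inter hB', by
      ext; simp only [Set.mem_inter_iff]; tauto⟩
  induction s, hs using MeasurableSpace.induction_on_inter (generateFrom_inter_eq_sup m₁ N) hpi with
  | empty => simp
  | basic s hs =>
    obtain ⟨A, B, hA, hB, rfl⟩ := hs
    rw [setIntegral_inter_of_indep hm hN hind hf hfm (hm₁ _ hA) hB,
      setIntegral_inter_of_indep hm hN hind hg
        ((stronglyMeasurable_condExp.mono hm₁).aestronglyMeasurable) (hm₁ _ hA) hB,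
      setIntegral_condExp (hm₁.trans hm) hf hA]
  | compl t ht ih =>
    rw [setIntegral_compl (hle _ ht) hg, setIntegral_compl (hle _ ht) hf, ih (measure_lt_top _ _), htot]
  | iUnion t htd htm ih =>
    rw [integral_iUnion (fun n => hle _ (htm n)) htd hg.integrableOn,
      integral_iUnion (fun n => hle _ (htm n)) htd hf.integrableOn]
    exact tsum_congr fun n => ih n (measure_lt_top _ _)

/-- If `f` is independent of the past except through `σ(m i, i ∈ S)`. -/
theorem condExp_iSup_mem_inter {ι : Type*} [IsProbabilityMeasure μ] {M : ι → MeasurableSpace Ω}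
    (hM : ∀ i, M i ≤ mΩ) (hind : iIndep M μ) {f : Ω → E} {S R : Set ι}
    (hfm : AEStronglyMeasurable[⨆ i ∈ S, M i] f μ) :
    μ[f | ⨆ i ∈ R, M i] =ᵐ[μ] μ[f | ⨆ i ∈ R ∩ S, M i] := by
  have h : (⨆ i ∈ R, M i) = (⨆ i ∈ R ∩ S, M i) ⊔ ⨆ i ∈ R \ S, M i := by
    rw [← iSup_union, Set.inter_union_sdiff]
  rw [h]
  exact condExp_sup_of_indep (iSup₂_le fun i _ => hM i) (iSup₂_le fun i _ => hM i)
    (indep_iSup_of_disjoint hM hind Set.disjoint_sdiff_right)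
    (biSup_mono fun i hi => hi.2) hfm

theorem condExp_condExp_iSup {ι : Type*} [IsProbabilityMeasure μ] {M : ι → MeasurableSpace Ω}
    (hM : ∀ i, M i ≤ mΩ) (hind : iIndep M μ) (f : Ω → E) (S R : Set ι) :
    μ[μ[f | ⨆ i ∈ S, M i] | ⨆ i ∈ R, M i] =ᵐ[μ] μ[f | ⨆ i ∈ R ∩ S, M i] :=
  (condExp_iSup_mem_inter hM hind stronglyMeasurable_condExp.aestronglyMeasurable).trans
    (condExp_condExp_of_le (biSup_mono fun _ hi => hi.2) (iSup₂_le fun i _ => hM i))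

end CondExpIndep

section Levy

variable {Ω E : Type*} [NormedAddCommGroup E] [NormedSpace ℝ E] [CompleteSpace E]
  {mΩ : MeasurableSpace Ω} {μ : Measure Ω}

theorem eLpNorm_condExp_sub_le [IsFiniteMeasure μ] {m : MeasurableSpace Ω} {q : ℝ≥0∞}
    [hq : Fact (1 ≤ q)] {f g : Ω → E} (hf : MemLp f q μ) (hg : MemLp g q μ) :
    eLpNorm (μ[f | m] - f) q μ ≤
      eLpNorm (f - g) q μ + eLpNorm (μ[g | m] - g) q μ + eLpNorm (f - g) q μ := by
  have e1 : (μ[f | m] - f : Ω → E) =ᵐ[μ] (μ[f - g | m] + (μ[g | m] - g)) - (f - g) := by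
    filter_upwards [condExp_sub (hf.integrable hq.out) (hg.integrable hq.out) m] with x hx
    simp only [Pi.sub_apply, hx, Pi.add_apply]; abel
  rw [eLpNorm_congr_ae e1]
  refine (eLpNorm_sub_le (integrable_condExp.1.add (integrable_condExp.1.sub hg.1))
    (hf.1.sub hg.1) hq.out).trans (add_le_add_left ((eLpNorm_add_le integrable_condExp.1
      (integrable_condExp.1.sub hg.1) hq.out).trans (add_le_add_left ?_ _)) _)
  exact eLpNorm_condExp_le_eLpNorm _ hq.out

/-- Lévy's upward theorem in `L^q`, for Banach space valued functions. -/
theorem tendsto_eLpNorm_condExp_iSup [IsProbabilityMeasure μ] (ℱ : Filtration ℕ mΩ) {q : ℝ≥0∞}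
    [hq : Fact (1 ≤ q)] (hqt : q ≠ ∞) {f : Ω → E} (hf : MemLp f q μ)
    (hfm : AEStronglyMeasurable[⨆ n, ℱ n] f μ) :
    Tendsto (fun n => eLpNorm (μ[f | ℱ n] - f) q μ) atTop (𝓝 0) := by
  have hle : ⨆ n, ℱ n ≤ mΩ := iSup_le ℱ.le
  refine MemLp.induction_stronglyMeasurable hle hqt
    (fun f => Tendsto (fun n => eLpNorm (μ[f | ℱ n] - f) q μ) atTop (𝓝 0)) ?_ ?_ ?_ ?_ hf hfm
  · intro c s hs _
    set u : Ω → ℝ := s.indicator fun _ => (1 : ℝ) with hu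
    have hui : Integrable u μ := (integrable_const 1).indicator (hle _ hs)
    have hum : StronglyMeasurable[⨆ n, ℱ n] u := stronglyMeasurable_const.indicator hs
    have heq : (s.indicator fun _ => c) = fun x => u x • c := by
      ext x; by_cases hx : x ∈ s <;> simp [hu, hx]
    have h1 : ∀ n, μ[(s.indicator fun _ => c) | ℱ n] - (s.indicator fun _ => c)
        =ᵐ[μ] fun x => (μ[u | ℱ n] x - u x) • c := by
      intro n
      have h := condExp_bilin_of_stronglyMeasurable_right (m := ℱ n) (μ := μ)
        (B := ContinuousLinearMap.lsmul ℝ ℝ) (f := u) (g := fun _ => c)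
        stronglyMeasurable_const (by simpa using hui.smul_const c) hui
      rw [heq]
      filter_upwards [h] with x hx
      simp only [ContinuousLinearMap.lsmul_apply] at hx
      simp [hx, sub_smul]
    have h2 : ∀ᵐ x ∂μ, ∀ n, |μ[u | ℱ n] x - u x| ≤ 2 := by
      rw [ae_all_iff]; intro n
      have hb : ∀ᵐ x ∂μ, |u x| ≤ (1 : ℝ) := ae_of_all _ fun x => by
        by_cases hx : x ∈ s <;> simp [hu, hx]
      filter_upwards [ae_bdd_abs_condExp_of_ae_bdd_abs (m := ℱ n) hb, hb] with x hx hx'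
      have := abs_sub (μ[u | ℱ n] x) (u x)
      linarith
    have h3 := hui.tendsto_ae_condExp (ℱ := ℱ) hum
    have hr : 0 < q.toReal := ENNReal.toReal_pos (zero_lt_one.trans_le hq.out).ne' hqt
    have h4 : Tendsto (fun n => ∫⁻ x, ‖(μ[u | ℱ n] x - u x) • c‖ₑ ^ q.toReal ∂μ) atTop
        (𝓝 (∫⁻ _, 0 ∂μ)) := by
      refine tendsto_lintegral_of_dominated_convergence' (fun _ => ENNReal.ofReal (2 * ‖c‖) ^ q.toReal)
        (fun n => ?_) (fun n => ?_) ?_ ?_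
      · exact (((integrable_condExp.1.sub hui.1).smul_const c).enorm).pow_const _
      · filter_upwards [h2] with x hx
        gcongr
        rw [← ofReal_norm, norm_smul]
        gcongr
        exact hx n
      · rw [lintegral_const]
        rw [measure_univ, mul_one]
        exact (ENNReal.rpow_lt_top_of_nonneg hr.le ENNReal.ofReal_ne_top).ne
      · filter_upwards [h3] with x hx
        have h5 : Tendsto (fun n => ‖(μ[u | ℱ n] x - u x) • c‖ₑ) atTop (𝓝 0) := by
          have := ((hx.sub_const (u x)).smul_const c).enorm
          simpa using this
        have := h5.ennrpow_const q.toReal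
        rwa [ENNReal.zero_rpow_of_pos hr] at this
    have h5 := h4.ennrpow_const (1 / q.toReal)
    rw [lintegral_zero, ENNReal.zero_rpow_of_pos (by positivity)] at h5
    refine h5.congr fun n => ?_
    rw [eLpNorm_congr_ae (h1 n), eLpNorm_eq_lintegral_rpow_enorm_toReal
      (zero_lt_one.trans_le hq.out).ne' hqt]
  · intro f g _ hf hg _ _ hPf hPg
    have h1 : ∀ n, eLpNorm (μ[f + g | ℱ n] - (f + g)) q μ ≤
        eLpNorm (μ[f | ℱ n] - f) q μ + eLpNorm (μ[g | ℱ n] - g) q μ := by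
      intro n
      refine le_trans (le_of_eq (eLpNorm_congr_ae ?_)) (eLpNorm_add_le
        (integrable_condExp.1.sub hf.1) (integrable_condExp.1.sub hg.1) hq.out)
      filter_upwards [condExp_add (hf.integrable hq.out) (hg.integrable hq.out) (ℱ n)] with x hx
      simp only [Pi.sub_apply, hx, Pi.add_apply]; abel
    exact tendsto_of_tendsto_of_tendsto_of_le_of_le tendsto_const_nhds
      (by simpa using hPf.add hPg) (fun _ => zero_le) h1
  · refine isClosed_of_closure_subset fun f hfc => ?_
    change Tendsto _ _ _
    rw [ENNReal.tendsto_atTop_zero]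
    intro ε hε
    obtain ⟨δ, hδ0, hδ⟩ : ∃ δ : ℝ, 0 < δ ∧ ENNReal.ofReal δ ≤ ε / 3 := by
      rcases eq_or_ne ε ∞ with rfl | hεt
      · exact ⟨1, one_pos, by simp [ENNReal.top_div]⟩
      · exact ⟨(ε / 3).toReal, ENNReal.toReal_pos (by simp [hε.ne']) (by finiteness),
          (ENNReal.ofReal_toReal (by finiteness)).le⟩
    obtain ⟨g, hg, hfg⟩ := Metric.mem_closure_iff.1 hfc δ hδ0
    have hg' : Tendsto (fun n => eLpNorm (μ[⇑(g : Lp E q μ) | ℱ n] - ⇑(g : Lp E q μ)) q μ)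
        atTop (𝓝 0) := hg
    rw [ENNReal.tendsto_atTop_zero] at hg'
    obtain ⟨n₀, hn₀⟩ := hg' (ε / 3) (by simp [hε.ne'])
    have hfL := Lp.memLp (f : Lp E q μ)
    have hgL := Lp.memLp (g : Lp E q μ)
    have hd : edist (f : Lp E q μ) (g : Lp E q μ) ≤ ε / 3 := by
      refine le_trans ?_ hδ
      rw [edist_dist]; exact ENNReal.ofReal_le_ofReal hfg.le
    rw [Lp.edist_def] at hd
    refine ⟨n₀, fun n hn => ?_⟩
    calc _ ≤ (ε / 3 + ε / 3) + ε / 3 := by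
          refine (eLpNorm_condExp_sub_le hfL hgL).trans ?_
          gcongr
          exact hn₀ n hn
      _ = ε := ENNReal.add_thirds ε
  · intro f g hfg _ hP
    refine hP.congr fun n => eLpNorm_congr_ae ?_
    filter_upwards [hfg, condExp_congr_ae (m := ℱ n) hfg] with x hx hx'
    simp [hx, hx']

end Levy

section TypeTwo

/-- Constant of the second order expansion of `‖x + y‖ ^ q`. -/
def expansionConst (q : ℝ) : ℝ := (4 * q + 1) ^ q + q * (4 * q) + q / 2 + 9 * (q / 2) ^ 2

theorem one_le_expansionConst {q : ℝ} (hq : 2 ≤ q) : 1 ≤ expansionConst q := by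
  have : (1 : ℝ) ≤ (4 * q + 1) ^ q := Real.one_le_rpow (by linarith) (by linarith)
  unfold expansionConst; nlinarith

variable {K : Type*} [NormedAddCommGroup K] [InnerProductSpace ℝ K]

theorem norm_add_rpow_le {q : ℝ} (hq : 2 ≤ q) (x y : K) :
    ‖x + y‖ ^ q ≤ ‖x‖ ^ q + q * (‖x‖ ^ (q - 2) * inner ℝ x y)
      + expansionConst q * (‖x‖ ^ (q - 2) * ‖y‖ ^ 2 + ‖y‖ ^ q) := by
  have hC1 : 0 ≤ (4 * q + 1) ^ q := by positivity
  have hin := abs_real_inner_le_norm x y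
  have hin' := abs_le.1 hin
  have hp : 0 ≤ ‖x‖ ^ (q - 2) := by positivity
  have hyq : 0 ≤ ‖y‖ ^ q := by positivity
  have hxq : 0 ≤ ‖x‖ ^ q := by positivity
  rcases le_or_gt ‖x‖ (4 * q * ‖y‖) with h | h
  · have h1 : ‖x + y‖ ^ q ≤ (4 * q + 1) ^ q * ‖y‖ ^ q := by
      rw [← Real.mul_rpow (by positivity) (norm_nonneg _)]
      refine Real.rpow_le_rpow (norm_nonneg _) ?_ (by linarith)
      linarith [norm_add_le x y]
    have h2 : -(‖x‖ ^ (q - 2) * inner ℝ x y) ≤ (4 * q) * (‖x‖ ^ (q - 2) * ‖y‖ ^ 2) := by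
      have : -(inner ℝ x y) ≤ 4 * q * ‖y‖ ^ 2 := by
        nlinarith [mul_le_mul_of_nonneg_right h (norm_nonneg y)]
      nlinarith
    have h3 : 0 ≤ ‖x‖ ^ (q - 2) * ‖y‖ ^ 2 := by positivity
    unfold expansionConst
    have h4 := mul_le_mul_of_nonneg_left h2 (by linarith : 0 ≤ q)
    have h5 : 0 ≤ (4 * q + 1) ^ q * (‖x‖ ^ (q - 2) * ‖y‖ ^ 2) := by positivity
    have h6 : 0 ≤ (q * (4 * q)) * ‖y‖ ^ q := by positivity
    have h7 : 0 ≤ (q / 2 + 9 * (q / 2) ^ 2) * (‖x‖ ^ (q - 2) * ‖y‖ ^ 2 + ‖y‖ ^ q) := by positivity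
    nlinarith
  · have hx : 0 < ‖x‖ := lt_of_le_of_lt (by positivity) h
    set u : ℝ := (2 * inner ℝ x y + ‖y‖ ^ 2) / ‖x‖ ^ 2 with hu
    set t : ℝ := ‖y‖ / ‖x‖ with ht
    have ht0 : 0 ≤ t := by positivity
    have ht1 : 4 * q * t ≤ 1 := by
      rw [ht, ← mul_div_assoc, div_le_one hx]; exact h.le
    have hut : |u| ≤ 3 * t := by
      rw [hu, abs_div, abs_of_pos (by positivity : 0 < ‖x‖ ^ 2), div_le_iff₀ (by positivity), ht,
        show 3 * (‖y‖ / ‖x‖) * ‖x‖ ^ 2 = 3 * ‖x‖ * ‖y‖ by field_simp]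
      have : ‖y‖ ≤ ‖x‖ := by nlinarith [norm_nonneg y]
      rw [abs_le]
      constructor <;> nlinarith [norm_nonneg y]
    have hsq : ‖x + y‖ ^ 2 = ‖x‖ ^ 2 * (1 + u) := by
      rw [norm_add_sq_real, hu]; field_simp; ring
    have hu1 : 0 ≤ 1 + u := by
      have := sq_nonneg ‖x + y‖
      rw [hsq] at this
      exact nonneg_of_mul_nonneg_right this (by positivity)
    have hru : |q / 2 * u| ≤ 1 := by
      rw [abs_mul, abs_of_nonneg (by linarith : 0 ≤ q / 2)]
      nlinarith
    have hexp := Real.abs_exp_sub_one_sub_id_le hru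
    have h1 : (1 + u) ^ (q / 2) ≤ 1 + q / 2 * u + (q / 2 * u) ^ 2 := by
      calc (1 + u) ^ (q / 2) ≤ (Real.exp u) ^ (q / 2) :=
            Real.rpow_le_rpow hu1 (by linarith [Real.add_one_le_exp u]) (by linarith)
        _ = Real.exp (q / 2 * u) := by rw [← Real.exp_mul, mul_comm]
        _ ≤ _ := by linarith [(abs_le.1 hexp).2]
    have h2 : ‖x + y‖ ^ q = ‖x‖ ^ q * (1 + u) ^ (q / 2) := by
      have e : ∀ z : ℝ, 0 ≤ z → z ^ q = (z ^ 2) ^ (q / 2) := fun z hz => by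
        rw [← Real.rpow_natCast, ← Real.rpow_mul hz]; congr 1; push_cast; ring
      rw [e _ (norm_nonneg _), e _ (norm_nonneg x), hsq, Real.mul_rpow (by positivity) hu1]
    have h3 : ‖x‖ ^ q = ‖x‖ ^ (q - 2) * ‖x‖ ^ 2 := by
      rw [← Real.rpow_natCast, ← Real.rpow_add hx]; congr 1; push_cast; ring
    have h4 : (q / 2 * u) ^ 2 ≤ 9 * (q / 2) ^ 2 * t ^ 2 := by
      have : u ^ 2 ≤ (3 * t) ^ 2 := sq_le_sq' (by linarith [(abs_le.1 hut).1]) (abs_le.1 hut).2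
      rw [mul_pow]; nlinarith [sq_nonneg (q / 2)]
    have h5 : ‖x‖ ^ q * (1 + u) ^ (q / 2) ≤
        ‖x‖ ^ q * (1 + q / 2 * u + 9 * (q / 2) ^ 2 * t ^ 2) :=
      mul_le_mul_of_nonneg_left (by linarith) hxq
    have h6 : ‖x‖ ^ q * (1 + q / 2 * u + 9 * (q / 2) ^ 2 * t ^ 2) = ‖x‖ ^ q
        + q * (‖x‖ ^ (q - 2) * inner ℝ x y)
        + (q / 2 + 9 * (q / 2) ^ 2) * (‖x‖ ^ (q - 2) * ‖y‖ ^ 2) := by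
      have e1 : ‖x‖ ^ 2 * u = 2 * inner ℝ x y + ‖y‖ ^ 2 := by rw [hu]; field_simp
      have e2 : ‖x‖ ^ 2 * t ^ 2 = ‖y‖ ^ 2 := by rw [ht]; field_simp
      rw [h3]
      linear_combination (‖x‖ ^ (q - 2) * (q / 2)) * e1 + (‖x‖ ^ (q - 2) * (9 * (q / 2) ^ 2)) * e2
    rw [h2]
    refine h5.trans (h6.le.trans ?_)
    unfold expansionConst
    have h7 : 0 ≤ ((4 * q + 1) ^ q + q * (4 * q)) * (‖x‖ ^ (q - 2) * ‖y‖ ^ 2 + ‖y‖ ^ q) := by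
      positivity
    have h8 : 0 ≤ (q / 2 + 9 * (q / 2) ^ 2) * ‖y‖ ^ q := by positivity
    nlinarith

theorem eLpNorm_le_ofReal_iff {Ω F : Type*} [NormedAddCommGroup F] {mΩ : MeasurableSpace Ω}
    {μ : Measure Ω} {q : ℝ} (hq : 0 < q) {f : Ω → F} (hf : MemLp f (ENNReal.ofReal q) μ) {c : ℝ}
    (hc : 0 ≤ c) : eLpNorm f (ENNReal.ofReal q) μ ≤ ENNReal.ofReal c ↔ ∫ x, ‖f x‖ ^ q ∂μ ≤ c ^ q := by
  have h0 : 0 ≤ ∫ x, ‖f x‖ ^ q ∂μ := integral_nonneg fun x => by positivity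
  rw [hf.eLpNorm_eq_integral_rpow_norm (by simpa using hq) ENNReal.ofReal_ne_top,
    ENNReal.toReal_ofReal hq.le, ENNReal.ofReal_le_ofReal_iff hc, Real.rpow_inv_le_iff_of_pos h0 hc hq]

theorem integrable_norm_rpow_of_memLp {Ω F : Type*} [NormedAddCommGroup F] {mΩ : MeasurableSpace Ω}
    {μ : Measure Ω} {q : ℝ} (hq : 0 < q) {f : Ω → F} (hf : MemLp f (ENNReal.ofReal q) μ) :
    Integrable (fun x => ‖f x‖ ^ q) μ := by
  have := hf.integrable_norm_rpow (by simpa using hq) ENNReal.ofReal_ne_top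
  rwa [ENNReal.toReal_ofReal hq.le] at this

theorem rpow_sub_two_mul_sq_le {q : ℝ} (hq : 2 ≤ q) {s t : ℝ} (hs : 0 ≤ s) (ht : 0 ≤ t) :
    s ^ (q - 2) * t ^ 2 ≤ s ^ q + t ^ q := by
  rcases eq_or_lt_of_le hs with rfl | hs'
  · rcases eq_or_lt_of_le hq with rfl | hq'
    · simp
    · rw [Real.zero_rpow (by linarith)]; simp; positivity
  have e : ∀ z : ℝ, 0 < z → z ^ q = z ^ (q - 2) * z ^ 2 := fun z hz => by
    rw [← Real.rpow_natCast, ← Real.rpow_add hz]; congr 1; push_cast; ring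
  rcases le_total t s with h | h
  · have : s ^ (q - 2) * t ^ 2 ≤ s ^ q := by
      rw [e s hs']; gcongr
    linarith [Real.rpow_nonneg ht q]
  · have ht' := hs'.trans_le h
    have : s ^ (q - 2) * t ^ 2 ≤ t ^ q := by
      rw [e t ht']
      gcongr
    linarith [Real.rpow_nonneg hs q]

/-- Constant of the type two inequality for martingale differences in `L^q`. -/
def typeTwoConst (q : ℝ) : ℝ := Real.sqrt (4 * expansionConst q)

theorem typeTwoConst_rpow_le {q : ℝ} (hq : 2 ≤ q) {a d : ℝ} (ha : 0 ≤ a) (hd : 0 ≤ d) :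
    (typeTwoConst q * a) ^ q + expansionConst q * (2 * ((typeTwoConst q * a) ^ (q - 2) * d ^ 2) + d ^ q)
      ≤ (typeTwoConst q * Real.sqrt (a ^ 2 + d ^ 2)) ^ q := by
  have hC := one_le_expansionConst hq
  set C := expansionConst q
  have hk2 : typeTwoConst q ^ 2 = 4 * C := Real.sq_sqrt (by linarith)
  have hk0 : 0 ≤ typeTwoConst q := Real.sqrt_nonneg _
  set k := typeTwoConst q
  have hk1 : 1 ≤ k := by nlinarith
  have e : ∀ z : ℝ, 0 ≤ z → z ^ q = (z ^ 2) ^ (q / 2) := fun z hz => by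
    rw [← Real.rpow_natCast, ← Real.rpow_mul hz]; congr 1; push_cast; ring
  have e' : ∀ z : ℝ, 0 ≤ z → z ^ (q - 2) = (z ^ 2) ^ (q / 2 - 1) := fun z hz => by
    rw [← Real.rpow_natCast, ← Real.rpow_mul hz]; congr 1; push_cast; ring
  have hkq : k ^ q = k ^ (q - 2) * (4 * C) := by
    rw [← hk2, ← Real.rpow_natCast, ← Real.rpow_add (by linarith)]; congr 1; push_cast; ring
  have hkq1 : 1 ≤ k ^ (q - 2) := Real.one_le_rpow hk1 (by linarith)
  rw [Real.mul_rpow hk0 ha, Real.mul_rpow hk0 ha, Real.mul_rpow hk0 (Real.sqrt_nonneg _), hkq,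
    e _ (Real.sqrt_nonneg _), Real.sq_sqrt (by positivity), e a ha, e d hd, e' a ha]
  have h1 : (a ^ 2) ^ (q / 2) + (d ^ 2) ^ (q / 2) ≤ (a ^ 2 + d ^ 2) ^ (q / 2) :=
    Real.add_rpow_le_rpow_add (by positivity) (by positivity) (by linarith)
  have h2 : (a ^ 2) ^ (q / 2) + (a ^ 2) ^ (q / 2 - 1) * d ^ 2 ≤ (a ^ 2 + d ^ 2) ^ (q / 2) := by
    have hz : ∀ z : ℝ, 0 ≤ z → z ^ (q / 2) = z ^ (q / 2 - 1) * z := fun z hz => by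
      nth_rewrite 3 [← Real.rpow_one z]
      rw [← Real.rpow_add_of_nonneg hz (by linarith) zero_le_one]; congr 1; ring
    rw [hz _ (by positivity), hz (a ^ 2 + d ^ 2) (by positivity), ← mul_add]
    gcongr
    · linarith
    · nlinarith
  set x := (a ^ 2) ^ (q / 2)
  set y := (a ^ 2) ^ (q / 2 - 1)
  set z := (d ^ 2) ^ (q / 2)
  set l := k ^ (q - 2)
  have hz : 0 ≤ z := by positivity
  have h3 : x + (z + y * d ^ 2) / 2 ≤ (a ^ 2 + d ^ 2) ^ (q / 2) := by linarith
  have h4 := mul_le_mul_of_nonneg_left h3 (by positivity : 0 ≤ l * (4 * C))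
  have h5 : C * z ≤ 2 * C * (l * z) := by nlinarith [mul_le_mul_of_nonneg_right hkq1 hz]
  nlinarith

variable [CompleteSpace K] {Ω : Type*} {m mΩ : MeasurableSpace Ω} {μ : Measure Ω}

theorem integral_rpow_inner_eq_zero [IsProbabilityMeasure μ] (hm : m ≤ mΩ) {q : ℝ} (hq : 2 ≤ q)
    {S D : Ω → K} (hS : MemLp S (ENNReal.ofReal q) μ) (hD : MemLp D (ENNReal.ofReal q) μ)
    (hSm : AEStronglyMeasurable[m] S μ) (hD0 : μ[D | m] =ᵐ[μ] 0) :
    Integrable (fun x => ‖S x‖ ^ (q - 2) * inner ℝ (S x) (D x)) μ ∧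
      ∫ x, ‖S x‖ ^ (q - 2) * inner ℝ (S x) (D x) ∂μ = 0 := by
  have h1q : 1 ≤ ENNReal.ofReal q := by
    rw [← ENNReal.ofReal_one]; exact ENNReal.ofReal_le_ofReal (by linarith)
  set f : Ω → K := fun x => ‖S x‖ ^ (q - 2) • S x with hf
  have hcont : Continuous fun x : K => ‖x‖ ^ (q - 2) • x := by
    have : Continuous fun x : K => ‖x‖ ^ (q - 2) :=
      continuous_norm.rpow_const fun _ => Or.inr (by linarith)
    fun_prop
  have hfm : AEStronglyMeasurable[m] f μ := hcont.comp_aestronglyMeasurable hSm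
  have hfm' : AEStronglyMeasurable f μ := hcont.comp_aestronglyMeasurable hS.1
  have heq : ∀ x, innerSL ℝ (f x) (D x) = ‖S x‖ ^ (q - 2) * inner ℝ (S x) (D x) := fun x => by
    simp [hf]
  have hint : Integrable (fun x => innerSL ℝ (f x) (D x)) μ := by
    refine Integrable.mono' ((integrable_norm_rpow_of_memLp (by linarith) hS).add
      (integrable_norm_rpow_of_memLp (by linarith) hD)) ?_ (ae_of_all _ fun x => ?_)
    · exact hfm'.inner hD.1
    · rw [heq, norm_mul, Real.norm_of_nonneg (by positivity)]
      have h1 : ‖inner ℝ (S x) (D x)‖ ≤ ‖S x‖ * ‖D x‖ := norm_inner_le_norm _ _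
      have h2 : ‖S x‖ ^ (q - 2) * (‖S x‖ * ‖D x‖) ≤ ‖S x‖ ^ q + ‖D x‖ ^ q := by
        rcases eq_or_ne ‖S x‖ 0 with h0 | h0
        · rw [h0]; simp; positivity
        have hpos : 0 < ‖S x‖ := lt_of_le_of_ne (norm_nonneg _) (Ne.symm h0)
        have e : ∀ z : ℝ, 0 < z → z ^ q = z ^ (q - 2) * (z * z) := fun z hz => by
          rw [← sq, ← Real.rpow_natCast, ← Real.rpow_add hz]; congr 1; push_cast; ring
        rcases le_total ‖D x‖ ‖S x‖ with h | h
        · have : ‖S x‖ ^ (q - 2) * (‖S x‖ * ‖D x‖) ≤ ‖S x‖ ^ q := by rw [e _ hpos]; gcongr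
          linarith [Real.rpow_nonneg (norm_nonneg (D x)) q]
        · have : ‖S x‖ ^ (q - 2) * (‖S x‖ * ‖D x‖) ≤ ‖D x‖ ^ q := by
            rw [e _ (hpos.trans_le h)]; gcongr
          linarith [Real.rpow_nonneg (norm_nonneg (S x)) q]
      exact (mul_le_mul_of_nonneg_left h1 (by positivity)).trans h2
  have h := condExp_bilin_of_aestronglyMeasurable_left (B := innerSL ℝ) hfm hint
    (hD.integrable h1q)
  refine ⟨hint.congr (ae_of_all _ heq), ?_⟩
  rw [← integral_congr_ae (ae_of_all _ heq), ← integral_condExp hm]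
  refine (integral_congr_ae (g := fun _ => (0 : ℝ)) ?_).trans (integral_zero _ _)
  filter_upwards [h, hD0] with x hx hx'
  rw [hx, hx']; simp

theorem integral_rpow_add_le [IsProbabilityMeasure μ] (hm : m ≤ mΩ) {q : ℝ} (hq : 2 ≤ q)
    {S D : Ω → K} (hS : MemLp S (ENNReal.ofReal q) μ) (hD : MemLp D (ENNReal.ofReal q) μ)
    (hSm : AEStronglyMeasurable[m] S μ) (hD0 : μ[D | m] =ᵐ[μ] 0) {a d : ℝ} (ha : 0 < a) (hd : 0 < d)
    (hSa : ∫ x, ‖S x‖ ^ q ∂μ ≤ a ^ q) (hDd : ∫ x, ‖D x‖ ^ q ∂μ ≤ d ^ q) :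
    ∫ x, ‖S x + D x‖ ^ q ∂μ ≤
      a ^ q + expansionConst q * (2 * (a ^ (q - 2) * d ^ 2) + d ^ q) := by
  have hC := one_le_expansionConst hq
  obtain ⟨i1, h1⟩ := integral_rpow_inner_eq_zero hm hq hS hD hSm hD0
  have iS := integrable_norm_rpow_of_memLp (by linarith) hS
  have iD := integrable_norm_rpow_of_memLp (by linarith) hD
  have iSD := integrable_norm_rpow_of_memLp (by linarith) (hS.add hD)
  set C := expansionConst q
  set W := a ^ (q - 2) * d ^ 2 with hW
  have hW0 : 0 ≤ W := by positivity
  have hpt : ∀ x, ‖S x + D x‖ ^ q ≤ (1 + C * (W / a ^ q)) * ‖S x‖ ^ q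
      + q * (‖S x‖ ^ (q - 2) * inner ℝ (S x) (D x)) + C * (W / d ^ q + 1) * ‖D x‖ ^ q := fun x => by
    refine (norm_add_rpow_le hq (S x) (D x)).trans ?_
    have h2 := rpow_sub_two_mul_sq_le hq (div_nonneg (norm_nonneg (S x)) ha.le)
      (div_nonneg (norm_nonneg (D x)) hd.le)
    rw [Real.div_rpow (norm_nonneg _) ha.le, Real.div_rpow (norm_nonneg _) ha.le,
      Real.div_rpow (norm_nonneg _) hd.le, div_pow, div_mul_div_comm,
      div_le_iff₀ (by positivity), ← hW] at h2
    have h3 := mul_le_mul_of_nonneg_left h2 (by linarith : 0 ≤ C)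
    have h4 : C * ((‖S x‖ ^ q / a ^ q + ‖D x‖ ^ q / d ^ q) * W)
      = C * (W / a ^ q) * ‖S x‖ ^ q + C * (W / d ^ q) * ‖D x‖ ^ q := by ring
    linarith
  have j1 := iS.const_mul (1 + C * (W / a ^ q))
  have j2 := i1.const_mul q
  have j3 := iD.const_mul (C * (W / d ^ q + 1))
  refine (integral_mono iSD ((j1.add j2).add j3) hpt).trans ?_
  have e : ∫ x, ((((fun x => (1 + C * (W / a ^ q)) * ‖S x‖ ^ q) + fun x =>
      q * (‖S x‖ ^ (q - 2) * inner ℝ (S x) (D x))) +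
      fun x => C * (W / d ^ q + 1) * ‖D x‖ ^ q) : Ω → ℝ) x ∂μ =
      (1 + C * (W / a ^ q)) * ∫ x, ‖S x‖ ^ q ∂μ + C * (W / d ^ q + 1) * ∫ x, ‖D x‖ ^ q ∂μ := by
    rw [integral_add' (j1.add j2) j3, integral_add' j1 j2, integral_const_mul, integral_const_mul,
      integral_const_mul, h1]
    ring
  rw [e]
  have h3 := mul_le_mul_of_nonneg_left hSa (by positivity : 0 ≤ 1 + C * (W / a ^ q))
  have h4 := mul_le_mul_of_nonneg_left hDd (by positivity : 0 ≤ C * (W / d ^ q + 1))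
  have h5 : (1 + C * (W / a ^ q)) * a ^ q = a ^ q + C * W := by
    field_simp
  have h6 : C * (W / d ^ q + 1) * d ^ q = C * W + C * d ^ q := by
    field_simp
  linarith

theorem eLpNorm_add_le_typeTwo [IsProbabilityMeasure μ] (hm : m ≤ mΩ) {q : ℝ} (hq : 2 ≤ q)
    {S D : Ω → K} (hS : MemLp S (ENNReal.ofReal q) μ) (hD : MemLp D (ENNReal.ofReal q) μ)
    (hSm : AEStronglyMeasurable[m] S μ) (hD0 : μ[D | m] =ᵐ[μ] 0) {a d : ℝ} (ha : 0 ≤ a) (hd : 0 ≤ d)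
    (hSa : eLpNorm S (ENNReal.ofReal q) μ ≤ ENNReal.ofReal (typeTwoConst q * a))
    (hDd : eLpNorm D (ENNReal.ofReal q) μ ≤ ENNReal.ofReal d) :
    eLpNorm (S + D) (ENNReal.ofReal q) μ ≤
      ENNReal.ofReal (typeTwoConst q * Real.sqrt (a ^ 2 + d ^ 2)) := by
  have hq0 : 0 < q := by linarith
  have hk : 0 < typeTwoConst q := Real.sqrt_pos.2 (by linarith [one_le_expansionConst hq])
  have key : ∀ ε : ℝ, 0 < ε → eLpNorm (S + D) (ENNReal.ofReal q) μ ≤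
      ENNReal.ofReal (typeTwoConst q * Real.sqrt ((a + ε) ^ 2 + (d + ε) ^ 2)) := by
    intro ε hε
    rw [eLpNorm_le_ofReal_iff hq0 (hS.add hD) (by positivity)]
    refine le_trans ?_ (typeTwoConst_rpow_le hq (by positivity : 0 ≤ a + ε)
      (by positivity : 0 ≤ d + ε))
    refine integral_rpow_add_le hm hq hS hD hSm hD0 (by positivity) (by positivity) ?_ ?_
    · rw [← eLpNorm_le_ofReal_iff hq0 hS (by positivity)]
      exact hSa.trans (ENNReal.ofReal_le_ofReal (by gcongr; linarith))
    · rw [← eLpNorm_le_ofReal_iff hq0 hD (by positivity)]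
      exact hDd.trans (ENNReal.ofReal_le_ofReal (by linarith))
  have hlim : Tendsto (fun ε : ℝ =>
      ENNReal.ofReal (typeTwoConst q * Real.sqrt ((a + ε) ^ 2 + (d + ε) ^ 2))) (𝓝[>] 0)
      (𝓝 (ENNReal.ofReal (typeTwoConst q * Real.sqrt ((a + 0) ^ 2 + (d + 0) ^ 2)))) := by
    exact tendsto_nhdsWithin_of_tendsto_nhds (Continuous.tendsto
      (ENNReal.continuous_ofReal.comp (by fun_prop)) 0)
  rw [add_zero, add_zero] at hlim
  exact ge_of_tendsto hlim (eventually_nhdsWithin_of_forall fun ε hε => key ε hε)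

end TypeTwo

section EfronStein

variable {J Ω : Type*} {mΩ : MeasurableSpace Ω}

/-- The part of `f` which depends on the coordinate `k` of a family of σ-algebras. -/
def resid {E : Type*} [NormedAddCommGroup E] [NormedSpace ℝ E] (M : J → MeasurableSpace Ω)
    (μ : Measure Ω) (k : J) (f : Ω → E) : Ω → E :=
  f - μ[f | ⨆ j ∈ ({k}ᶜ : Set J), M j]

/-- The filtration which reveals the coordinates in the order of an enumeration. -/
def enumFiltration (M : J → MeasurableSpace Ω) (hM : ∀ j, M j ≤ mΩ) (σ : ℕ ≃ J) :
    Filtration ℕ mΩ where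
  seq n := ⨆ j ∈ σ '' Set.Iio n, M j
  mono' _ _ h := biSup_mono fun _ hj => Set.image_mono (Set.Iio_subset_Iio h) hj
  le' _ := iSup₂_le fun j _ => hM j

variable {M : J → MeasurableSpace Ω} {μ : Measure Ω} [IsProbabilityMeasure μ]

theorem iSup_enumFiltration (hM : ∀ j, M j ≤ mΩ) (σ : ℕ ≃ J) :
    ⨆ n, enumFiltration M hM σ n = ⨆ j, M j := by
  apply le_antisymm
  · exact iSup_le fun n => iSup₂_le fun j _ => le_iSup M j
  · refine iSup_le fun j => ?_
    have h : j ∈ σ '' Set.Iio (σ.symm j + 1) := ⟨σ.symm j, by simp, by simp⟩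
    have : M j ≤ enumFiltration M hM σ (σ.symm j + 1) := le_biSup M h
    exact this.trans (le_iSup (fun n => enumFiltration M hM σ n) _)

variable {E : Type*} [NormedAddCommGroup E] [NormedSpace ℝ E] [CompleteSpace E]

theorem memLp_resid {q : ℝ≥0∞} (hq : 1 ≤ q) {f : Ω → E} (hf : MemLp f q μ) (k : J) :
    MemLp (resid M μ k f) q μ := hf.sub (hf.condExp hq)

theorem condExp_enumFiltration_zero (hM : ∀ j, M j ≤ mΩ) (σ : ℕ ≃ J) (f : Ω → E) :
    μ[f | enumFiltration M hM σ 0] = fun _ => ∫ x, f x ∂μ := by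
  have : (enumFiltration M hM σ 0 : MeasurableSpace Ω) = ⊥ := by
    simp [enumFiltration]
  rw [this, condExp_bot]

/-- The martingale increments of an enumeration are projections of `resid`. -/
theorem condExp_enumFiltration_succ_sub (hM : ∀ j, M j ≤ mΩ) (hind : iIndep M μ) (σ : ℕ ≃ J)
    {f : Ω → E} (hf : Integrable f μ) (n : ℕ) :
    μ[f | enumFiltration M hM σ (n + 1)] - μ[f | enumFiltration M hM σ n]
      =ᵐ[μ] μ[resid M μ (σ n) f | enumFiltration M hM σ (n + 1)] := by
  have h1 := condExp_sub hf (integrable_condExp (f := f) (μ := μ)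
    (m := ⨆ j ∈ ({σ n}ᶜ : Set J), M j)) (enumFiltration M hM σ (n + 1))
  have h2 := condExp_condExp_iSup hM hind f ({σ n}ᶜ : Set J) (σ '' Set.Iio (n + 1))
  have h3 : σ '' Set.Iio (n + 1) ∩ ({σ n}ᶜ : Set J) = σ '' Set.Iio n := by
    ext j
    simp only [Set.mem_inter_iff, Set.mem_image, Set.mem_Iio, Set.mem_compl_iff,
      Set.mem_singleton_iff]
    constructor
    · rintro ⟨⟨i, hi, rfl⟩, h⟩
      exact ⟨i, lt_of_le_of_ne (Nat.lt_succ_iff.1 hi) fun h' => h (by rw [h']), rfl⟩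
    · rintro ⟨i, hi, rfl⟩
      exact ⟨⟨i, hi.trans (Nat.lt_succ_self n), rfl⟩, fun h => hi.ne (σ.injective h)⟩
  rw [h3] at h2
  change _ =ᵐ[μ] μ[f | enumFiltration M hM σ n] at h2
  change _ =ᵐ[μ] μ[f - _ | _]
  filter_upwards [h1, h2] with x hx hx'
  rw [hx, Pi.sub_apply, Pi.sub_apply]
  congr 1
  exact hx'.symm

theorem eLpNorm_condExp_succ_sub_le (hM : ∀ j, M j ≤ mΩ) (hind : iIndep M μ) (σ : ℕ ≃ J)
    {q : ℝ≥0∞} (hq : 1 ≤ q) {f : Ω → E} (hf : MemLp f q μ) (n : ℕ) :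
    eLpNorm (μ[f | enumFiltration M hM σ (n + 1)] - μ[f | enumFiltration M hM σ n]) q μ ≤
      eLpNorm (resid M μ (σ n) f) q μ := by
  rw [eLpNorm_congr_ae (condExp_enumFiltration_succ_sub hM hind σ (hf.integrable hq) n)]
  exact eLpNorm_condExp_le_eLpNorm _ hq

theorem condExp_succ_sub_eq_zero (hM : ∀ j, M j ≤ mΩ) (σ : ℕ ≃ J) {f : Ω → E} (n : ℕ) :
    μ[μ[f | enumFiltration M hM σ (n + 1)] - μ[f | enumFiltration M hM σ n] |
      enumFiltration M hM σ n] =ᵐ[μ] 0 := by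
  have h1 := condExp_sub (integrable_condExp (f := f) (μ := μ) (m := enumFiltration M hM σ (n + 1)))
    (integrable_condExp (f := f) (μ := μ) (m := enumFiltration M hM σ n)) (enumFiltration M hM σ n)
  have h2 := condExp_condExp_of_le (f := f) (μ := μ)
    ((enumFiltration M hM σ).mono (Nat.le_succ n)) ((enumFiltration M hM σ).le (n + 1))
  have h3 := condExp_condExp_of_le (f := f) (μ := μ) (le_refl (enumFiltration M hM σ n : MeasurableSpace Ω))
    ((enumFiltration M hM σ).le n)
  filter_upwards [h1, h2, h3] with x hx hx' hx''
  rw [hx, Pi.sub_apply, hx', hx'']; simp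

theorem tendsto_eLpNorm_condExp_enum (hM : ∀ j, M j ≤ mΩ) (σ : ℕ ≃ J) {q : ℝ≥0∞} (hq : 1 ≤ q)
    (hqt : q ≠ ∞) {f : Ω → E} (hf : MemLp f q μ) (hfm : AEStronglyMeasurable[⨆ j, M j] f μ) :
    Tendsto (fun n => eLpNorm (μ[f | enumFiltration M hM σ n] - f) q μ) atTop (𝓝 0) := by
  have : Fact (1 ≤ q) := ⟨hq⟩
  exact tendsto_eLpNorm_condExp_iSup _ hqt hf (by rwa [iSup_enumFiltration])

/-- Efron-Stein type inequality in `L^q`, `q ≥ 2`. -/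
theorem eLpNorm_sub_integral_le {K : Type*} [NormedAddCommGroup K] [InnerProductSpace ℝ K]
    [CompleteSpace K] [Denumerable J] (hM : ∀ j, M j ≤ mΩ) (hind : iIndep M μ) {q : ℝ} (hq : 2 ≤ q)
    {f : Ω → K} (hf : MemLp f (ENNReal.ofReal q) μ) (hfm : AEStronglyMeasurable[⨆ j, M j] f μ)
    {d : J → ℝ} (hd0 : ∀ k, 0 ≤ d k) (hds : Summable fun k => d k ^ 2)
    (hd : ∀ k, eLpNorm (resid M μ k f) (ENNReal.ofReal q) μ ≤ ENNReal.ofReal (d k)) :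
    eLpNorm (fun x => f x - ∫ y, f y ∂μ) (ENNReal.ofReal q) μ ≤
      ENNReal.ofReal (typeTwoConst q * Real.sqrt (∑' k, d k ^ 2)) := by
  have h1q : 1 ≤ ENNReal.ofReal q := by
    rw [← ENNReal.ofReal_one]; exact ENNReal.ofReal_le_ofReal (by linarith)
  set σ : ℕ ≃ J := (Denumerable.eqv J).symm
  set ℱ := enumFiltration M hM σ
  have hstep : ∀ n, eLpNorm (μ[f | ℱ n] - fun _ => ∫ y, f y ∂μ) (ENNReal.ofReal q) μ ≤
      ENNReal.ofReal (typeTwoConst q * Real.sqrt (∑ i ∈ Finset.range n, d (σ i) ^ 2)) := by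
    intro n
    induction n with
    | zero =>
      rw [condExp_enumFiltration_zero hM σ f]
      simp
    | succ n ih =>
      have e : (μ[f | ℱ (n + 1)] - fun _ => ∫ y, f y ∂μ) =
          (μ[f | ℱ n] - fun _ => ∫ y, f y ∂μ) + (μ[f | ℱ (n + 1)] - μ[f | ℱ n]) := by abel
      have hs : 0 ≤ ∑ i ∈ Finset.range n, d (σ i) ^ 2 := Finset.sum_nonneg fun i _ => sq_nonneg _
      rw [e, Finset.sum_range_succ, ← Real.sq_sqrt hs]
      exact eLpNorm_add_le_typeTwo (ℱ.le n) hq ((hf.condExp h1q).sub (memLp_const _))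
        ((hf.condExp h1q).sub (hf.condExp h1q))
        ((stronglyMeasurable_condExp.sub stronglyMeasurable_const).aestronglyMeasurable)
        (condExp_succ_sub_eq_zero hM σ n) (Real.sqrt_nonneg _) (hd0 _) ih
        ((eLpNorm_condExp_succ_sub_le hM hind σ h1q hf n).trans (hd _))
  have hle : ∀ n, eLpNorm (fun x => f x - ∫ y, f y ∂μ) (ENNReal.ofReal q) μ ≤
      eLpNorm (μ[f | ℱ n] - f) (ENNReal.ofReal q) μ +
        ENNReal.ofReal (typeTwoConst q * Real.sqrt (∑' k, d k ^ 2)) := by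
    intro n
    have e : (fun x => f x - ∫ y, f y ∂μ) =
        (μ[f | ℱ n] - fun _ => ∫ y, f y ∂μ) - (μ[f | ℱ n] - f) := by
      ext x; simp
    rw [e, add_comm]
    refine (eLpNorm_sub_le ((integrable_condExp.1).sub aestronglyMeasurable_const)
      (integrable_condExp.1.sub hf.1) h1q).trans (add_le_add_left ((hstep n).trans ?_) _)
    gcongr
    · exact Real.sqrt_nonneg _
    · rw [← σ.tsum_eq]
      exact ((σ.summable_iff (f := fun k => d k ^ 2)).2 hds).sum_le_tsum _ fun i _ => sq_nonneg _
  have hlim := (tendsto_eLpNorm_condExp_enum hM σ h1q ENNReal.ofReal_ne_top hf hfm).add_const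
    (ENNReal.ofReal (typeTwoConst q * Real.sqrt (∑' k, d k ^ 2)))
  rw [zero_add] at hlim
  exact ge_of_tendsto' hlim hle

section Bilinear

variable {F K : Type*} [NormedAddCommGroup F] [NormedSpace ℝ F] [CompleteSpace F]
  [NormedAddCommGroup K] [NormedSpace ℝ K] [CompleteSpace K]

theorem integrable_bilin (B : E →L[ℝ] F →L[ℝ] K) {f : Ω → E} {g : Ω → F}
    (hf : MemLp f 2 μ) (hg : MemLp g 2 μ) : Integrable (fun x => B (f x) (g x)) μ := by
  refine Integrable.mono' ((hf.norm.integrable_mul hg.norm).const_mul ‖B‖)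
    (B.aestronglyMeasurable_comp₂ hf.1 hg.1) (ae_of_all _ fun x => ?_)
  simpa [mul_assoc] using B.le_opNorm₂ (f x) (g x)

theorem norm_integral_bilin_le (B : E →L[ℝ] F →L[ℝ] K) {f : Ω → E} {g : Ω → F}
    (hf : MemLp f 2 μ) (hg : MemLp g 2 μ) :
    ‖∫ x, B (f x) (g x) ∂μ‖ ≤ ‖B‖ * ((eLpNorm f 2 μ).toReal * (eLpNorm g 2 μ).toReal) := by
  have h := eLpNorm_le_eLpNorm_mul_eLpNorm_of_nnnorm (p := 2) (q := 2) (r := 1) hf.1 hg.1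
    (fun a b => B a b) ‖B‖₊ (ae_of_all _ fun x => B.le_opNorm₂ (f x) (g x))
  have h' : (∫⁻ x, ‖B (f x) (g x)‖ₑ ∂μ).toReal ≤ _ := ENNReal.toReal_mono (by
    have := hf.2; have := hg.2; finiteness) (eLpNorm_one_eq_lintegral_enorm.symm.le.trans h)
  rw [ENNReal.toReal_mul, ENNReal.toReal_mul, ENNReal.coe_toReal, coe_nnnorm, mul_assoc] at h'
  refine le_trans ?_ h'
  rw [← integral_norm_eq_lintegral_enorm (integrable_bilin B hf hg).1]
  exact norm_integral_le_integral_norm _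

theorem integral_bilin_eq_zero_right (B : E →L[ℝ] F →L[ℝ] K) {m : MeasurableSpace Ω} (hm : m ≤ mΩ)
    {f : Ω → E} {g : Ω → F} (hf : MemLp f 2 μ) (hg : MemLp g 2 μ)
    (hfm : AEStronglyMeasurable[m] f μ) (hg0 : μ[g | m] =ᵐ[μ] 0) :
    ∫ x, B (f x) (g x) ∂μ = 0 := by
  have h := condExp_bilin_of_aestronglyMeasurable_left (B := B) hfm (integrable_bilin B hf hg)
    (hg.integrable one_le_two)
  rw [← integral_condExp hm]
  refine (integral_congr_ae (g := fun _ => (0 : K)) ?_).trans (integral_zero _ _)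
  filter_upwards [h, hg0] with x hx hx'
  rw [hx, hx']; simp

/-- Covariance bound by the products of the coordinatewise dependence. -/
theorem norm_integral_bilin_le_tsum [Denumerable J] (hM : ∀ j, M j ≤ mΩ) (hind : iIndep M μ)
    (B : E →L[ℝ] F →L[ℝ] K) {f : Ω → E} {g : Ω → F} (hf : MemLp f 2 μ) (hg : MemLp g 2 μ)
    (hfm : AEStronglyMeasurable[⨆ j, M j] f μ) (hgm : AEStronglyMeasurable[⨆ j, M j] g μ)
    (hf0 : ∫ x, f x ∂μ = 0) {d d' : J → ℝ} (hd0 : ∀ k, 0 ≤ d k) (hd0' : ∀ k, 0 ≤ d' k)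
    (hds : Summable fun k => d k * d' k)
    (hd : ∀ k, eLpNorm (resid M μ k f) 2 μ ≤ ENNReal.ofReal (d k))
    (hd' : ∀ k, eLpNorm (resid M μ k g) 2 μ ≤ ENNReal.ofReal (d' k)) :
    ‖∫ x, B (f x) (g x) ∂μ‖ ≤ ‖B‖ * ∑' k, d k * d' k := by
  set σ : ℕ ≃ J := (Denumerable.eqv J).symm
  set ℱ := enumFiltration M hM σ
  have hstep : ∀ n, ‖∫ x, B (μ[f | ℱ n] x) (μ[g | ℱ n] x) ∂μ‖ ≤
      ‖B‖ * ∑ i ∈ Finset.range n, d (σ i) * d' (σ i) := by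
    intro n
    induction n with
    | zero =>
      rw [condExp_enumFiltration_zero hM σ f, hf0]
      simp
    | succ n ih =>
      have mf := hf.condExp (m := ℱ n) one_le_two
      have mg := hg.condExp (m := ℱ n) one_le_two
      have mf' := hf.condExp (m := ℱ (n + 1)) one_le_two
      have mg' := hg.condExp (m := ℱ (n + 1)) one_le_two
      set Df := μ[f | ℱ (n + 1)] - μ[f | ℱ n] with hDf
      set Dg := μ[g | ℱ (n + 1)] - μ[g | ℱ n] with hDg
      have mDf : MemLp Df 2 μ := mf'.sub mf
      have mDg : MemLp Dg 2 μ := mg'.sub mg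
      have e : ∀ x, B (μ[f | ℱ (n + 1)] x) (μ[g | ℱ (n + 1)] x) =
          B (μ[f | ℱ n] x) (μ[g | ℱ n] x) + B (μ[f | ℱ n] x) (Dg x) +
          B (Df x) (μ[g | ℱ n] x) + B (Df x) (Dg x) := by
        intro x; simp only [hDf, hDg, Pi.sub_apply, map_sub, _root_.sub_apply]; abel
      have z1 : ∫ x, B (μ[f | ℱ n] x) (Dg x) ∂μ = 0 :=
        integral_bilin_eq_zero_right B (ℱ.le n) mf mDg
          stronglyMeasurable_condExp.aestronglyMeasurable (condExp_succ_sub_eq_zero hM σ n)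
      have z2 : ∫ x, B (Df x) (μ[g | ℱ n] x) ∂μ = 0 :=
        integral_bilin_eq_zero_right B.flip (ℱ.le n) mg mDf
          stronglyMeasurable_condExp.aestronglyMeasurable (condExp_succ_sub_eq_zero hM σ n)
      have i0 := integrable_bilin B mf mg
      have i1 := integrable_bilin B mf mDg
      have i2 := integrable_bilin B mDf mg
      have i3 := integrable_bilin B mDf mDg
      have e4 : ∫ x, B (μ[f | ℱ (n + 1)] x) (μ[g | ℱ (n + 1)] x) ∂μ =
          ∫ x, B (μ[f | ℱ n] x) (μ[g | ℱ n] x) ∂μ + ∫ x, B (Df x) (Dg x) ∂μ := by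
        have h1 := integral_add' ((i0.add i1).add i2) i3
        have h2 := integral_add' (i0.add i1) i2
        have h3 := integral_add' i0 i1
        rw [h2, h3, z1, z2, add_zero, add_zero] at h1
        rw [← h1]
        exact integral_congr_ae (ae_of_all _ e)
      rw [e4, Finset.sum_range_succ, mul_add]
      refine (norm_add_le _ _).trans (add_le_add ih ((norm_integral_bilin_le B mDf mDg).trans ?_))
      gcongr
      · exact hd0 _
      · exact ENNReal.toReal_le_of_le_ofReal (hd0 _)
          ((eLpNorm_condExp_succ_sub_le hM hind σ one_le_two hf n).trans (hd _))
      · exact ENNReal.toReal_le_of_le_ofReal (hd0' _)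
          ((eLpNorm_condExp_succ_sub_le hM hind σ one_le_two hg n).trans (hd' _))
  have hle : ∀ n, ‖∫ x, B (f x) (g x) ∂μ‖ ≤ ‖B‖ * ∑' k, d k * d' k +
      (‖B‖ * ((eLpNorm (μ[f | ℱ n] - f) 2 μ).toReal * (eLpNorm g 2 μ).toReal) +
        ‖B‖ * ((eLpNorm f 2 μ).toReal * (eLpNorm (μ[g | ℱ n] - g) 2 μ).toReal)) := by
    intro n
    have mf := hf.condExp (m := ℱ n) one_le_two
    have mg := hg.condExp (m := ℱ n) one_le_two
    have i0 := integrable_bilin B mf mg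
    have i1 := integrable_bilin B (mf.sub hf) hg
    have i2 := integrable_bilin B mf (mg.sub hg)
    have e : ∫ x, B (f x) (g x) ∂μ = ∫ x, B (μ[f | ℱ n] x) (μ[g | ℱ n] x) ∂μ -
        (∫ x, B ((μ[f | ℱ n] - f) x) (g x) ∂μ +
          ∫ x, B (μ[f | ℱ n] x) ((μ[g | ℱ n] - g) x) ∂μ) := by
      have h1 := integral_add' i1 i2
      have h2 := integral_sub' i0 (i1.add i2)
      rw [h1] at h2
      rw [← h2]
      refine integral_congr_ae (ae_of_all _ fun x => ?_)
      simp only [Pi.add_apply, Pi.sub_apply, map_sub, _root_.sub_apply]; abel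
    rw [e]
    refine (norm_sub_le _ _).trans (add_le_add ((hstep n).trans ?_) ((norm_add_le _ _).trans
      (add_le_add (norm_integral_bilin_le B (mf.sub hf) hg)
        ((norm_integral_bilin_le B mf (mg.sub hg)).trans ?_))))
    · gcongr
      rw [← σ.tsum_eq]
      exact ((σ.summable_iff (f := fun k => d k * d' k)).2 hds).sum_le_tsum _
        fun i _ => mul_nonneg (hd0 _) (hd0' _)
    · gcongr
      · exact hf.2.ne
      · exact eLpNorm_condExp_le_eLpNorm _ one_le_two
  have t1 := (ENNReal.tendsto_toReal ENNReal.zero_ne_top).comp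
    (tendsto_eLpNorm_condExp_enum hM σ one_le_two ENNReal.ofNat_ne_top hf hfm)
  have t2 := (ENNReal.tendsto_toReal ENNReal.zero_ne_top).comp
    (tendsto_eLpNorm_condExp_enum hM σ one_le_two ENNReal.ofNat_ne_top hg hgm)
  have hlim := (((t1.mul_const (eLpNorm g 2 μ).toReal).const_mul ‖B‖).add
    ((t2.const_mul (eLpNorm f 2 μ).toReal).const_mul ‖B‖)).const_add (‖B‖ * ∑' k, d k * d' k)
  simp only [ENNReal.toReal_zero, zero_mul, mul_zero, add_zero] at hlim
  exact ge_of_tendsto' hlim hle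

end Bilinear

end EfronStein

section ConditionalLaw

variable {Ω Ω' E : Type*} {m' : MeasurableSpace Ω'} {mΩ : MeasurableSpace Ω} {mΩ' : MeasurableSpace Ω'}
  [NormedAddCommGroup E] [NormedSpace ℝ E] [CompleteSpace E]

/-- Conditional expectation commutes with a change of variables. -/
theorem condExp_comp_comap {μ : Measure Ω} [IsProbabilityMeasure μ] {Φ : Ω → Ω'}
    (hΦ : Measurable Φ) (hm' : m' ≤ mΩ') {F : Ω' → E}
    (hF : Integrable F (μ.map Φ)) :
    μ[F ∘ Φ | m'.comap Φ] =ᵐ[μ] (μ.map Φ)[F | m'] ∘ Φ := by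
  have : IsProbabilityMeasure (μ.map Φ) := Measure.isProbabilityMeasure_map hΦ.aemeasurable
  have hle : m'.comap Φ ≤ mΩ := (MeasurableSpace.comap_mono hm').trans hΦ.comap_le
  have hG : Integrable ((μ.map Φ)[F | m']) (μ.map Φ) := integrable_condExp
  symm
  refine ae_eq_condExp_of_forall_setIntegral_eq hle (hF.comp_measurable hΦ)
    (fun s _ _ => (hG.comp_measurable hΦ).integrableOn) ?_ ?_
  · rintro _ ⟨t, ht, rfl⟩ _
    have h := setIntegral_condExp hm' hF ht
    rw [setIntegral_map (hm' _ ht) hG.1 hΦ.aemeasurable,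
      setIntegral_map (hm' _ ht) hF.1 hΦ.aemeasurable] at h
    exact h
  · exact ((stronglyMeasurable_condExp (f := F) (m := m') (μ := μ.map Φ)).comp_measurable
      (comap_measurable Φ)).aestronglyMeasurable

end ConditionalLaw

section Innovations

variable {Ω S H : Type*} [MeasurableSpace Ω] [MeasurableSpace S]
  [NormedAddCommGroup H] [InnerProductSpace ℂ H] [CompleteSpace H]
  [SecondCountableTopology H] [MeasurableSpace H] [BorelSpace H]
  {μ : Measure Ω} {ε : ℤ → Ω → S} {ε₀ : Ω → S} {V : ℤ → Ω → H} {p : ℝ≥0∞}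

/-- The σ-algebra generated by the innovation at time `s`. -/
@[reducible] def innov (ε : ℤ → Ω → S) (s : ℤ) : MeasurableSpace Ω :=
  MeasurableSpace.comap (ε s) inferInstance

theorem PhysicalDependence.innov_le (h : PhysicalDependence μ ε ε₀ V p) (s : ℤ) :
    innov ε s ≤ ‹MeasurableSpace Ω› := (h.measurable_innov s).comap_le

theorem PhysicalDependence.iIndep_innov (h : PhysicalDependence μ ε ε₀ V p) :
    iIndep (innov ε) μ := h.indep

theorem PhysicalDependence.aestronglyMeasurable_past (h : PhysicalDependence μ ε ε₀ V p) (t : ℤ) :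
    AEStronglyMeasurable[⨆ s ∈ Set.Iic t, innov ε s] (V t) μ := by
  obtain ⟨g, hg, hgV⟩ := h.causal
  refine ⟨fun x => g (fun i => ε (t - (i : ℤ)) x), ?_, hgV t⟩
  have hproj : Measurable[⨆ s ∈ Set.Iic t, innov ε s] fun x (i : ℕ) => ε (t - (i : ℤ)) x := by
    refine @measurable_pi_lambda Ω ℕ (fun _ => S) (⨆ s ∈ Set.Iic t, innov ε s) _ _ fun i => ?_
    have h1 : Measurable[innov ε (t - (i : ℤ))] (ε (t - (i : ℤ))) := comap_measurable _
    have h2 : t - (i : ℤ) ∈ Set.Iic t := by simp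
    exact h1.mono (le_biSup (innov ε) h2) le_rfl
  exact (hg.comp hproj).stronglyMeasurable

theorem PhysicalDependence.aestronglyMeasurable_innov (h : PhysicalDependence μ ε ε₀ V p) (t : ℤ) :
    AEStronglyMeasurable[⨆ s, innov ε s] (V t) μ := by
  obtain ⟨f, hf, hfe⟩ := h.aestronglyMeasurable_past t
  exact ⟨f, hf.mono (iSup₂_le fun s _ => le_iSup (innov ε) s), hfe⟩

theorem PhysicalDependence.resid_ae_eq_zero [IsProbabilityMeasure μ]
    (h : PhysicalDependence μ ε ε₀ V p) {t k : ℤ} (htk : t < k) (hi : Integrable (V t) μ) :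
    resid (innov ε) μ k (V t) =ᵐ[μ] 0 := by
  obtain ⟨f, hf, hfe⟩ := h.aestronglyMeasurable_past t
  have hle : ⨆ s ∈ ({k}ᶜ : Set ℤ), innov ε s ≤ ‹MeasurableSpace Ω› :=
    iSup₂_le fun s _ => h.innov_le s
  have hm : AEStronglyMeasurable[⨆ s ∈ ({k}ᶜ : Set ℤ), innov ε s] (V t) μ :=
    ⟨f, hf.mono (biSup_mono fun s (hs : s ≤ t) => by
      simp only [Set.mem_compl_iff, Set.mem_singleton_iff]; omega), hfe⟩
  filter_upwards [condExp_of_aestronglyMeasurable' hle hm hi] with x hx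
  exact sub_eq_zero.2 hx.symm

/-- Conditioning on all innovations except the one at time `0` amounts to conditioning on the
coupled past. -/
theorem PhysicalDependence.condExp_coupledPast [IsProbabilityMeasure μ]
    (h : PhysicalDependence μ ε ε₀ V p) {t : ℤ} (ht : 0 ≤ t) :
    μ[V t | coupledPast ε ε₀ t] =ᵐ[μ] μ[V t | ⨆ s ∈ ({0}ᶜ : Set ℤ), innov ε s] := by
  have hle : ⨆ s, innov ε s ≤ ‹MeasurableSpace Ω› := iSup_le fun s => h.innov_le s
  have h1 := condExp_iSup_mem_inter (R := ({0}ᶜ : Set ℤ)) h.innov_le h.iIndep_innov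
    (h.aestronglyMeasurable_past t)
  have hcomap : (⨆ s, innov ε s) =
      MeasurableSpace.comap (fun x t => ε t x) inferInstance := by
    rw [MeasurableSpace.pi, MeasurableSpace.comap_iSup]
    simp_rw [MeasurableSpace.comap_comp]
    rfl
  have hind : Indep (⨆ s, innov ε s) (MeasurableSpace.comap ε₀ inferInstance) μ := by
    rw [hcomap]
    exact h.copy_indep.symm
  have h2 := condExp_sup_of_indep (m₁ := ⨆ s ∈ ({0}ᶜ ∩ Set.Iic t : Set ℤ), innov ε s) hle
    h.measurable_copy.comap_le hind (iSup₂_le fun s _ => le_iSup (innov ε) s)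
    (h.aestronglyMeasurable_innov t)
  have h3 : coupledPast ε ε₀ t = (⨆ s ∈ ({0}ᶜ ∩ Set.Iic t : Set ℤ), innov ε s) ⊔
      MeasurableSpace.comap ε₀ inferInstance := by
    apply le_antisymm
    · refine iSup_le fun s => ?_
      by_cases hs : (s : ℤ) = 0
      · rw [if_pos hs]; exact le_sup_right
      · rw [if_neg hs]
        have h4 : (s : ℤ) ∈ ({0}ᶜ ∩ Set.Iic t : Set ℤ) := ⟨hs, s.2⟩
        exact le_sup_of_le_left (le_biSup (innov ε) h4)
    · refine sup_le (iSup₂_le fun s hs => ?_) ?_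
      · refine le_iSup_of_le (⟨s, hs.2⟩ : {s : ℤ // s ≤ t}) ?_
        have : s ≠ 0 := hs.1
        rw [if_neg this]
      · refine le_iSup_of_le (⟨0, ht⟩ : {s : ℤ // s ≤ t}) ?_
        rw [if_pos rfl]
  rw [h3]
  exact h2.trans h1.symm

theorem PhysicalDependence.map_shift [IsProbabilityMeasure μ]
    (h : PhysicalDependence μ ε ε₀ V p) (k : ℤ) :
    μ.map (fun x (s : ℤ) => ε (s + k) x) = μ.map (fun x (s : ℤ) => ε s x) := by
  have h1 : iIndepFun (fun s : ℤ => ε (s + k)) μ :=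
    h.indep.precomp (g := fun s : ℤ => s + k) (add_left_injective k)
  rw [h1.map_fun_eq_infinitePi_map (fun s => h.measurable_innov _),
    h.indep.map_fun_eq_infinitePi_map h.measurable_innov]
  congr 1
  ext1 s
  rw [(h.ident (s + k)).map_eq, (h.ident s).map_eq]

/-- The σ-algebra on sequences generated by the coordinates different from `0`. -/
@[reducible] def coordsNeZero (S : Type*) [MeasurableSpace S] : MeasurableSpace (ℤ → S) :=
  ⨆ s ∈ ({0}ᶜ : Set ℤ), MeasurableSpace.comap (fun y : ℤ → S => y s) inferInstance

theorem PhysicalDependence.eLpNorm_resid_shift [IsProbabilityMeasure μ]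
    (h : PhysicalDependence μ ε ε₀ V p) (hi : ∀ t, Integrable (V t) μ) (j k : ℤ) (r : ℝ≥0∞) :
    eLpNorm (resid (innov ε) μ k (V (j + k))) r μ = eLpNorm (resid (innov ε) μ 0 (V j)) r μ := by
  obtain ⟨g, hg, hgV⟩ := h.causal
  set P := μ.map (fun x (s : ℤ) => ε s x) with hP
  set G : (ℤ → S) → H := fun y => g fun i => y (j - (i : ℤ)) with hG
  have hGm : Measurable G := hg.comp (measurable_pi_iff.2 fun i => measurable_pi_apply _)
  have hm'le : coordsNeZero S ≤ MeasurableSpace.pi :=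
    iSup₂_le fun s _ => (measurable_pi_apply s).comap_le
  have key : ∀ k : ℤ, eLpNorm (resid (innov ε) μ k (V (j + k))) r μ = eLpNorm (G - P[G | coordsNeZero S]) r P := by
    intro k
    set Φ : Ω → (ℤ → S) := fun x s => ε (s + k) x with hΦ
    have hΦm : Measurable Φ := measurable_pi_iff.2 fun s => h.measurable_innov _
    have hmap : μ.map Φ = P := h.map_shift k
    have hVG : V (j + k) =ᵐ[μ] G ∘ Φ := by
      filter_upwards [hgV (j + k)] with x hx
      rw [hx]
      simp only [hG, hΦ, Function.comp]
      congr 1; ext i; congr 1; ring_nf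
    have hGi : Integrable G (μ.map Φ) := by
      rw [integrable_map_measure hGm.aestronglyMeasurable hΦm.aemeasurable]
      exact (hi _).congr hVG
    have hcomap : (⨆ s ∈ ({k}ᶜ : Set ℤ), innov ε s) = (coordsNeZero S).comap Φ := by
      simp_rw [coordsNeZero]
      simp_rw [MeasurableSpace.comap_iSup, MeasurableSpace.comap_comp]
      apply le_antisymm
      · refine iSup₂_le fun s hs => ?_
        refine le_iSup₂_of_le (s - k) (by simpa [sub_eq_zero] using hs) ?_
        have : (fun y : ℤ → S => y (s - k)) ∘ Φ = ε s := by
          ext x; simp [hΦ]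
        rw [this]
      · refine iSup₂_le fun s hs => ?_
        refine le_iSup₂_of_le (s + k) (by simpa using hs) ?_
        exact le_rfl
    have hce := condExp_comp_comap hΦm hm'le hGi
    rw [hmap] at hce
    have e : resid (innov ε) μ k (V (j + k)) =ᵐ[μ] (G - P[G | coordsNeZero S]) ∘ Φ := by
      unfold resid
      rw [hcomap]
      filter_upwards [hVG, condExp_congr_ae (m := (coordsNeZero S).comap Φ) hVG, hce] with x h1 h2 h3
      simp only [Pi.sub_apply, Function.comp] at *
      rw [h1, h2, h3]
    rw [eLpNorm_congr_ae e, ← hmap]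
    refine (eLpNorm_map_measure ?_ hΦm.aemeasurable).symm
    exact hGm.aestronglyMeasurable.sub integrable_condExp.1
  rw [key k, ← key 0, add_zero]

/-- The dependence measures control the influence of a single innovation. -/
theorem PhysicalDependence.eLpNorm_resid_le [IsProbabilityMeasure μ]
    (h : PhysicalDependence μ ε ε₀ V p) (hi : ∀ t, Integrable (V t) μ) (t k : ℤ) (r : ℝ≥0∞) :
    eLpNorm (resid (innov ε) μ k (V t)) r μ =
      if k ≤ t then depMeasure μ ε ε₀ V r (t - k) else 0 := by
  split_ifs with hkt
  · have h1 := h.eLpNorm_resid_shift hi (t - k) k r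
    rw [sub_add_cancel] at h1
    rw [h1]
    refine eLpNorm_congr_ae ?_
    filter_upwards [h.condExp_coupledPast (t := t - k) (by omega)] with x hx
    simp [resid, hx]
  · rw [eLpNorm_congr_ae (h.resid_ae_eq_zero (by omega) (hi t)), eLpNorm_zero]

end Innovations

section ShortMemory

/-- A centered process in `L^p` whose dependence on the coordinate `k` of an independent family of
σ-algebras is bounded by a summable function of the time lag. -/
structure ShortMemory {Ω H : Type*} {mΩ : MeasurableSpace Ω} [NormedAddCommGroup H]
    [NormedSpace ℝ H] (M : ℤ → MeasurableSpace Ω) (μ : Measure Ω)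
    (V : ℤ → Ω → H) (p : ℝ) (d : ℤ → ℝ) : Prop where
  le : ∀ k, M k ≤ mΩ
  indep : iIndep M μ
  memLp : ∀ t, MemLp (V t) (ENNReal.ofReal p) μ
  meas : ∀ t, AEStronglyMeasurable[⨆ k, M k] (V t) μ
  mean : ∀ t, ∫ x, V t x ∂μ = 0
  nonneg : ∀ h, 0 ≤ d h
  summable : Summable d
  resid_le : ∀ k t, eLpNorm (resid M μ k (V t)) (ENNReal.ofReal p) μ ≤ ENNReal.ofReal (d (t - k))

theorem summable_sq_sum_mul_and_tsum_le {d : ℤ → ℝ} (hd : ∀ h, 0 ≤ d h) (hds : Summable d)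
    (T : Finset ℕ) (a : ℕ → ℝ) :
    (Summable fun k : ℤ => (∑ t ∈ T, a t * d (t - k)) ^ 2) ∧
      ∑' k : ℤ, (∑ t ∈ T, a t * d (t - k)) ^ 2 ≤ (∑' h, d h) ^ 2 * ∑ t ∈ T, a t ^ 2 := by
  set D := ∑' h, d h
  have hD : 0 ≤ D := tsum_nonneg hd
  have hinj : ∀ k : ℤ, Function.Injective fun t : ℕ => (t : ℤ) - k := fun k s t h => by
    simpa using h
  have h1 : ∀ k : ℤ, (∑ t ∈ T, a t * d (t - k)) ^ 2 ≤ D * ∑ t ∈ T, a t ^ 2 * d (t - k) := by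
    intro k
    have h2 : (∑ t ∈ T, a t * d (t - k)) ^ 2 ≤
        (∑ t ∈ T, d (t - k)) * ∑ t ∈ T, a t ^ 2 * d (t - k) :=
      Finset.sum_sq_le_sum_mul_sum_of_sq_le_mul T (fun t _ => hd _)
        (fun t _ => mul_nonneg (sq_nonneg _) (hd _)) fun t _ => (by ring : _ = _).le
    refine h2.trans (mul_le_mul_of_nonneg_right ?_
      (Finset.sum_nonneg fun t _ => mul_nonneg (sq_nonneg _) (hd _)))
    have e := Finset.sum_map T ⟨fun t : ℕ => (t : ℤ) - k, hinj k⟩ d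
    simp only [Function.Embedding.coeFn_mk] at e
    rw [← e]
    exact hds.sum_le_tsum _ fun h _ => hd h
  have hsh : ∀ t : ℕ, HasSum (fun k : ℤ => d (t - k)) D := fun t =>
    (Equiv.subLeft (t : ℤ)).hasSum_iff.2 hds.hasSum
  have h3 : HasSum (fun k : ℤ => D * ∑ t ∈ T, a t ^ 2 * d (t - k)) (D * ∑ t ∈ T, a t ^ 2 * D) :=
    (hasSum_sum fun t _ => (hsh t).mul_left _).mul_left _
  have h4 := Summable.of_nonneg_of_le (fun k => sq_nonneg _) h1 h3.summable
  refine ⟨h4, (h4.tsum_le_tsum h1 h3.summable).trans (le_of_eq ?_)⟩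
  rw [h3.tsum_eq, ← Finset.sum_mul]; ring

variable {Ω H : Type*} {mΩ : MeasurableSpace Ω} {μ : Measure Ω} [IsProbabilityMeasure μ]
  {M : ℤ → MeasurableSpace Ω}

section Resid

theorem aestronglyMeasurable_finset_sum {E : Type*} [NormedAddCommGroup E] {m : MeasurableSpace Ω}
    (T : Finset ℕ) {f : ℕ → Ω → E} (hf : ∀ t, AEStronglyMeasurable[m] (f t) μ) :
    AEStronglyMeasurable[m] (∑ t ∈ T, f t) μ := by
  classical
  induction T using Finset.induction_on with
  | empty => exact (@stronglyMeasurable_zero Ω E m _ _).aestronglyMeasurable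
  | insert t T ht ih => rw [Finset.sum_insert ht]; exact (hf t).add ih

variable {E : Type*} [NormedAddCommGroup E] [NormedSpace ℝ E] [CompleteSpace E]

theorem eLpNorm_resid_le_two_mul {q : ℝ≥0∞} (hq : 1 ≤ q) {f : Ω → E} (hf : MemLp f q μ) (k : ℤ) :
    eLpNorm (resid M μ k f) q μ ≤ 2 * eLpNorm f q μ := by
  refine (eLpNorm_sub_le hf.1 integrable_condExp.1 hq).trans ?_
  rw [two_mul]
  gcongr
  exact eLpNorm_condExp_le_eLpNorm _ hq

theorem resid_add_of_measurable (hM : ∀ k, M k ≤ mΩ) {f g : Ω → E} {k : ℤ} (hf : Integrable f μ)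
    (hg : Integrable g μ) (hgm : AEStronglyMeasurable[⨆ j ∈ ({k}ᶜ : Set ℤ), M j] g μ) :
    resid M μ k (f + g) =ᵐ[μ] resid M μ k f := by
  have hle : ⨆ j ∈ ({k}ᶜ : Set ℤ), M j ≤ mΩ := iSup₂_le fun j _ => hM j
  filter_upwards [condExp_add hf hg (⨆ j ∈ ({k}ᶜ : Set ℤ), M j),
    condExp_of_aestronglyMeasurable' hle hgm hg] with x h1 h2
  simp only [resid, Pi.sub_apply, Pi.add_apply, h1, h2]
  abel

theorem condExp_finset_sum_smul {E : Type*} [NormedAddCommGroup E] [NormedSpace ℂ E]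
    [CompleteSpace E] (m : MeasurableSpace Ω)
    (T : Finset ℕ) (c : ℕ → ℂ) {f : ℕ → Ω → E} (hf : ∀ t ∈ T, Integrable (f t) μ) :
    μ[∑ t ∈ T, c t • f t | m] =ᵐ[μ] ∑ t ∈ T, c t • μ[f t | m] := by
  refine (condExp_finsetSum (fun t ht => (hf t ht).smul (c t)) m).trans ?_
  have h : ∀ᵐ x ∂μ, ∀ t ∈ T, μ[c t • f t | m] x = (c t • μ[f t | m]) x :=
    (ae_ball_iff (Finset.countable_toSet T)).2 fun t _ => condExp_smul (c t) (f t) m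
  filter_upwards [h] with x hx
  rw [Finset.sum_apply, Finset.sum_apply]
  exact Finset.sum_congr rfl hx

end Resid

variable [NormedAddCommGroup H] [InnerProductSpace ℂ H] [CompleteSpace H]
  {V : ℤ → Ω → H} {p q : ℝ} {d : ℤ → ℝ}

theorem ShortMemory.eLpNorm_sum_smul_le (h : ShortMemory M μ V p d) (hp : 2 ≤ p) (T : Finset ℕ)
    (c : ℕ → ℂ) :
    eLpNorm (∑ t ∈ T, c t • V t) (ENNReal.ofReal p) μ ≤ ENNReal.ofReal
      (typeTwoConst p * (∑' h, d h) * Real.sqrt (∑ t ∈ T, ‖c t‖ ^ 2)) := by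
  have h1p : 1 ≤ ENNReal.ofReal p := by
    rw [← ENNReal.ofReal_one]; exact ENNReal.ofReal_le_ofReal (by linarith)
  have hD : 0 ≤ ∑' h, d h := tsum_nonneg h.nonneg
  obtain ⟨hs, hle⟩ := summable_sq_sum_mul_and_tsum_le h.nonneg h.summable T
    fun t => ‖c t‖
  have hmem : MemLp (∑ t ∈ T, c t • V t) (ENNReal.ofReal p) μ :=
    memLp_finsetSum' _ fun t _ => (h.memLp t).const_smul _
  have hmean : ∫ x, (∑ t ∈ T, c t • V t) x ∂μ = 0 := by
    simp only [Finset.sum_apply, Pi.smul_apply]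
    rw [integral_finsetSum T (f := fun (t : ℕ) x => c t • V t x)
      fun (t : ℕ) _ => (((h.memLp t).integrable h1p).smul (c t))]
    exact Finset.sum_eq_zero fun t _ => by rw [integral_smul, h.mean, smul_zero]
  let : InnerProductSpace ℝ H := InnerProductSpace.rclikeToReal ℂ H
  have := eLpNorm_sub_integral_le (q := p) h.le h.indep hp hmem
    (aestronglyMeasurable_finset_sum T fun t => (h.meas t).const_smul (c t))
    (d := fun k => ∑ t ∈ T, ‖c t‖ * d (t - k))
    (fun k => Finset.sum_nonneg fun t _ => mul_nonneg (norm_nonneg _) (h.nonneg _)) hs ?_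
  · rw [hmean] at this
    simp only [sub_zero] at this
    refine this.trans (ENNReal.ofReal_le_ofReal ?_)
    rw [mul_assoc]
    refine mul_le_mul_of_nonneg_left ?_ (Real.sqrt_nonneg _)
    rw [← Real.sqrt_sq hD, ← Real.sqrt_mul (sq_nonneg _)]
    exact Real.sqrt_le_sqrt hle
  · intro k
    have e : resid M μ k (∑ t ∈ T, c t • V t) =ᵐ[μ] ∑ t ∈ T, c t • resid M μ k (V t) := by
      filter_upwards [condExp_finset_sum_smul (⨆ j ∈ ({k}ᶜ : Set ℤ), M j) T c
        (f := fun t => V t) fun t _ => (h.memLp t).integrable h1p] with x hx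
      simp only [resid, Pi.sub_apply, hx]
      simp [smul_sub]
    rw [eLpNorm_congr_ae e]
    refine (eLpNorm_sum_le (s := T) (f := fun t : ℕ => c t • resid M μ k (V t))
      (fun t _ => (memLp_resid h1p (h.memLp t) k).1.const_smul (c t)) h1p).trans ?_
    rw [ENNReal.ofReal_sum_of_nonneg fun t _ => mul_nonneg (norm_nonneg _) (h.nonneg _)]
    refine Finset.sum_le_sum fun t _ => ?_
    rw [eLpNorm_const_smul, ENNReal.ofReal_mul (norm_nonneg _), ofReal_norm]
    gcongr
    exact h.resid_le k t

variable {K : Type*} [NormedAddCommGroup K] [InnerProductSpace ℂ K] [CompleteSpace K]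

/-- A continuous real bilinear map of norm at most one which is linear in the first and conjugate
linear in the second argument. -/
structure IsTensor (B : H →L[ℝ] H →L[ℝ] K) : Prop where
  smul_left : ∀ (c : ℂ) f g, B (c • f) g = c • B f g
  smul_right : ∀ (c : ℂ) f g, B f (c • g) = starRingEnd ℂ c • B f g
  norm_le : ∀ f g, ‖B f g‖ ≤ ‖f‖ * ‖g‖

theorem IsTensor.eLpNorm_le {B : H →L[ℝ] H →L[ℝ] K} (hB : IsTensor B)
    {f g : Ω → H} (hf : MemLp f (ENNReal.ofReal (2 * q)) μ)
    (hg : MemLp g (ENNReal.ofReal (2 * q)) μ) :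
    eLpNorm (fun x => B (f x) (g x)) (ENNReal.ofReal q) μ ≤
      eLpNorm f (ENNReal.ofReal (2 * q)) μ * eLpNorm g (ENNReal.ofReal (2 * q)) μ := by
  have : ENNReal.HolderTriple (ENNReal.ofReal (2 * q)) (ENNReal.ofReal (2 * q))
      (ENNReal.ofReal q) := by
    constructor
    rw [← two_mul, ENNReal.ofReal_mul zero_le_two, ENNReal.ofReal_ofNat,
      ENNReal.mul_inv (by simp) (by simp), ← mul_assoc, ENNReal.mul_inv_cancel (by simp) (by simp),
      one_mul]
  have h := eLpNorm_le_eLpNorm_mul_eLpNorm_of_nnnorm (r := ENNReal.ofReal q)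
    (p := ENNReal.ofReal (2 * q)) (q := ENNReal.ofReal (2 * q)) hf.1 hg.1 (fun a b => B a b) 1 (ae_of_all _ fun x => by
      rw [one_mul]; exact_mod_cast hB.norm_le (f x) (g x))
  rwa [ENNReal.coe_one, one_mul] at h

theorem IsTensor.memLp {B : H →L[ℝ] H →L[ℝ] K} (hB : IsTensor B)
    {f g : Ω → H} (hf : MemLp f (ENNReal.ofReal (2 * q)) μ)
    (hg : MemLp g (ENNReal.ofReal (2 * q)) μ) :
    MemLp (fun x => B (f x) (g x)) (ENNReal.ofReal q) μ :=
  ⟨B.aestronglyMeasurable_comp₂ hf.1 hg.1,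
    (hB.eLpNorm_le hf hg).trans_lt (ENNReal.mul_lt_top hf.2 hg.2)⟩

theorem ShortMemory.eLpNorm_resid_quadratic_le (h : ShortMemory M μ V (2 * q) d) (hq : 2 ≤ q)
    {B : H →L[ℝ] H →L[ℝ] K} (hB : IsTensor B) (T : Finset ℕ) (a : ℕ → ℕ → ℂ) (k : ℤ) :
    eLpNorm (resid M μ k fun x => ∑ s ∈ T, ∑ t ∈ T, a s t • B (V s x) (V t x)) (ENNReal.ofReal q) μ
      ≤ ENNReal.ofReal (∑ s ∈ T, (2 * (typeTwoConst (2 * q) * (∑' h, d h)) *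
        (Real.sqrt (∑ t ∈ T, ‖a s t‖ ^ 2) + Real.sqrt (∑ t ∈ T, ‖a t s‖ ^ 2))) * d (s - k)) := by
  have hp : 2 ≤ 2 * q := by linarith
  have h1p : 1 ≤ ENNReal.ofReal (2 * q) := by
    rw [← ENNReal.ofReal_one]; exact ENNReal.ofReal_le_ofReal (by linarith)
  have h1q : 1 ≤ ENNReal.ofReal q := by
    rw [← ENNReal.ofReal_one]; exact ENNReal.ofReal_le_ofReal (by linarith)
  have hmk : ⨆ j ∈ ({k}ᶜ : Set ℤ), M j ≤ mΩ := iSup₂_le fun j _ => h.le j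
  set c := typeTwoConst (2 * q) * ∑' h, d h with hc
  have hc0 : 0 ≤ c := mul_nonneg (Real.sqrt_nonneg _) (tsum_nonneg h.nonneg)
  set R : ℕ → Ω → H := fun s => resid M μ k (V s) with hR
  set Vb : ℕ → Ω → H := fun s => μ[V s | ⨆ j ∈ ({k}ᶜ : Set ℤ), M j] with hVb
  set U : ℕ → Ω → H := fun s => ∑ t ∈ T, starRingEnd ℂ (a s t) • V t with hU
  set W : ℕ → Ω → H := fun t => ∑ s ∈ T, a s t • V s with hW
  set Wb : ℕ → Ω → H := fun t => ∑ s ∈ T, a s t • Vb s with hWb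
  have mR : ∀ s, MemLp (R s) (ENNReal.ofReal (2 * q)) μ := fun s => memLp_resid h1p (h.memLp s) k
  have mVb : ∀ s, MemLp (Vb s) (ENNReal.ofReal (2 * q)) μ := fun s => (h.memLp s).condExp h1p
  have mU : ∀ s, MemLp (U s) (ENNReal.ofReal (2 * q)) μ := fun s =>
    memLp_finsetSum' _ fun t _ => (h.memLp t).const_smul _
  have mWb : ∀ s, MemLp (Wb s) (ENNReal.ofReal (2 * q)) μ := fun s =>
    memLp_finsetSum' _ fun t _ => (mVb t).const_smul _
  have nR : ∀ s, eLpNorm (R s) (ENNReal.ofReal (2 * q)) μ ≤ ENNReal.ofReal (d (s - k)) := fun s =>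
    h.resid_le k s
  have nU : ∀ s, eLpNorm (U s) (ENNReal.ofReal (2 * q)) μ ≤
      ENNReal.ofReal (c * Real.sqrt (∑ t ∈ T, ‖a s t‖ ^ 2)) := fun s => by
    simpa using h.eLpNorm_sum_smul_le hp T fun t => starRingEnd ℂ (a s t)
  have nWb : ∀ t, eLpNorm (Wb t) (ENNReal.ofReal (2 * q)) μ ≤
      ENNReal.ofReal (c * Real.sqrt (∑ s ∈ T, ‖a s t‖ ^ 2)) := fun t => by
    have e := condExp_finset_sum_smul (⨆ j ∈ ({k}ᶜ : Set ℤ), M j) T (fun s => a s t)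
      (f := fun s => V s) fun s _ => (h.memLp s).integrable h1p
    rw [hWb, ← eLpNorm_congr_ae e]
    exact (eLpNorm_condExp_le_eLpNorm _ h1p).trans (h.eLpNorm_sum_smul_le hp T fun s => a s t)
  set A : Ω → K := ∑ s ∈ T, fun x => B (R s x) (U s x) with hA
  set A' : Ω → K := ∑ t ∈ T, fun x => B (Wb t x) (R t x) with hA'
  set C : Ω → K := ∑ t ∈ T, fun x => B (Wb t x) (Vb t x) with hC
  have mA : MemLp A (ENNReal.ofReal q) μ :=
    memLp_finsetSum' _ fun s _ => hB.memLp (mR s) (mU s)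
  have mA' : MemLp A' (ENNReal.ofReal q) μ :=
    memLp_finsetSum' _ fun s _ => hB.memLp (mWb s) (mR s)
  have mC : MemLp C (ENNReal.ofReal q) μ :=
    memLp_finsetSum' _ fun s _ => hB.memLp (mWb s) (mVb s)
  have hCm : AEStronglyMeasurable[⨆ j ∈ ({k}ᶜ : Set ℤ), M j] C μ := by
    have hVbm : ∀ s, StronglyMeasurable[⨆ j ∈ ({k}ᶜ : Set ℤ), M j] (Vb s) := fun s =>
      stronglyMeasurable_condExp
    have hWbm : ∀ t, StronglyMeasurable[⨆ j ∈ ({k}ᶜ : Set ℤ), M j] (Wb t) := fun t =>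
      Finset.stronglyMeasurable_sum T fun s _ => (hVbm s).const_smul (a s t)
    have hBm : ∀ t, StronglyMeasurable[⨆ j ∈ ({k}ᶜ : Set ℤ), M j]
        fun x => B (Wb t x) (Vb t x) := fun t =>
      (show Continuous fun z : H × H => B z.1 z.2 by fun_prop).comp_stronglyMeasurable
        ((hWbm t).prodMk (hVbm t))
    exact (Finset.stronglyMeasurable_sum T fun t _ => hBm t).aestronglyMeasurable
  have hsplit : (fun x => ∑ s ∈ T, ∑ t ∈ T, a s t • B (V s x) (V t x)) = (A + A') + C := by
    ext x
    have hV : ∀ s : ℕ, V s x = R s x + Vb s x := fun s => by simp [hR, hVb, resid]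
    have e1 : ∀ (s : ℕ) (f : H), B f (U s x) = ∑ t ∈ T, a s t • B f (V t x) := fun s f => by
      simp [hU, Finset.sum_apply, map_sum, hB.smul_right]
    have e2 : ∀ (t : ℕ) (f : H), B (Wb t x) f = ∑ s ∈ T, a s t • B (Vb s x) f := fun t f => by
      simp [hWb, Finset.sum_apply, map_sum, hB.smul_left]
    simp only [hA, hA', hC, Pi.add_apply, Finset.sum_apply]
    calc ∑ s ∈ T, ∑ t ∈ T, a s t • B (V s x) (V t x)
        = ∑ s ∈ T, (B (R s x) (U s x) + ∑ t ∈ T, a s t • B (Vb s x) (V t x)) := by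
          refine Finset.sum_congr rfl fun s _ => ?_
          rw [e1, ← Finset.sum_add_distrib]
          refine Finset.sum_congr rfl fun t _ => ?_
          rw [hV s, map_add, _root_.add_apply, smul_add]
      _ = ∑ s ∈ T, B (R s x) (U s x) + ∑ t ∈ T, B (Wb t x) (V t x) := by
          rw [Finset.sum_add_distrib, Finset.sum_comm]
          simp_rw [e2]
      _ = _ := by
          have e3 : ∑ t ∈ T, B (Wb t x) (V t x) =
              ∑ t ∈ T, B (Wb t x) (R t x) + ∑ t ∈ T, B (Wb t x) (Vb t x) := by
            rw [← Finset.sum_add_distrib]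
            refine Finset.sum_congr rfl fun t _ => ?_
            rw [hV t, (B (Wb t x)).map_add]
          rw [e3, add_assoc]
  rw [hsplit, eLpNorm_congr_ae (resid_add_of_measurable h.le ((mA.add mA').integrable h1q)
    (mC.integrable h1q) hCm)]
  refine (eLpNorm_resid_le_two_mul h1q (mA.add mA') k).trans ?_
  have hle : eLpNorm (A + A') (ENNReal.ofReal q) μ ≤ ENNReal.ofReal (∑ s ∈ T,
      (c * (Real.sqrt (∑ t ∈ T, ‖a s t‖ ^ 2) + Real.sqrt (∑ t ∈ T, ‖a t s‖ ^ 2))) * d (s - k)) := by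
    refine (eLpNorm_add_le mA.1 mA'.1 h1q).trans ?_
    have n1 : eLpNorm A (ENNReal.ofReal q) μ ≤
        ∑ s ∈ T, ENNReal.ofReal (d (s - k) * (c * Real.sqrt (∑ t ∈ T, ‖a s t‖ ^ 2))) := by
      refine (eLpNorm_sum_le (fun s _ => (hB.memLp (mR s) (mU s)).1) h1q).trans
        (Finset.sum_le_sum fun s _ => (hB.eLpNorm_le (mR s) (mU s)).trans ?_)
      rw [ENNReal.ofReal_mul (h.nonneg _)]
      gcongr
      exacts [nR s, nU s]
    have n2 : eLpNorm A' (ENNReal.ofReal q) μ ≤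
        ∑ t ∈ T, ENNReal.ofReal (d (t - k) * (c * Real.sqrt (∑ s ∈ T, ‖a s t‖ ^ 2))) := by
      refine (eLpNorm_sum_le (fun s _ => (hB.memLp (mWb s) (mR s)).1) h1q).trans
        (Finset.sum_le_sum fun s _ => (hB.eLpNorm_le (mWb s) (mR s)).trans ?_)
      rw [mul_comm, ENNReal.ofReal_mul (h.nonneg _)]
      gcongr
      exacts [nR s, nWb s]
    refine (add_le_add n1 n2).trans (le_of_eq ?_)
    have p0 : ∀ (s : ℕ) (z : ℝ), 0 ≤ d (s - k) * (c * Real.sqrt z) := fun s z =>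
      mul_nonneg (h.nonneg _) (mul_nonneg hc0 (Real.sqrt_nonneg _))
    rw [← ENNReal.ofReal_sum_of_nonneg fun s _ => p0 s _,
      ← ENNReal.ofReal_sum_of_nonneg fun s _ => p0 s _,
      ← ENNReal.ofReal_add (Finset.sum_nonneg fun s _ => p0 s _)
        (Finset.sum_nonneg fun s _ => p0 s _), ← Finset.sum_add_distrib]
    congr 1
    exact Finset.sum_congr rfl fun s _ => by ring
  refine (mul_le_mul_right hle 2).trans (le_of_eq ?_)
  rw [← ENNReal.ofReal_ofNat, ← ENNReal.ofReal_mul zero_le_two, Finset.mul_sum]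
  congr 1
  exact Finset.sum_congr rfl fun s _ => by ring

theorem ShortMemory.memLp_quadratic (h : ShortMemory M μ V (2 * q) d)
    {B : H →L[ℝ] H →L[ℝ] K} (hB : IsTensor B) (T : Finset ℕ) (a : ℕ → ℕ → ℂ) :
    MemLp (fun x => ∑ s ∈ T, ∑ t ∈ T, a s t • B (V s x) (V t x)) (ENNReal.ofReal q) μ :=
  memLp_finsetSum _ fun s _ => memLp_finsetSum _ fun t _ =>
    (hB.memLp (h.memLp s) (h.memLp t)).const_smul (a s t)

/-- Moment inequality for quadratic forms of a process with short memory. -/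
theorem ShortMemory.eLpNorm_quadratic_le (h : ShortMemory M μ V (2 * q) d) (hq : 2 ≤ q)
    {B : H →L[ℝ] H →L[ℝ] K} (hB : IsTensor B) (T : Finset ℕ) (a : ℕ → ℕ → ℂ) :
    eLpNorm (fun x => ∑ s ∈ T, ∑ t ∈ T, a s t • B (V s x) (V t x)
        - ∫ y, ∑ s ∈ T, ∑ t ∈ T, a s t • B (V s y) (V t y) ∂μ) (ENNReal.ofReal q) μ
      ≤ ENNReal.ofReal (4 * typeTwoConst q * typeTwoConst (2 * q) * (∑' h, d h) ^ 2 *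
        Real.sqrt (∑ s ∈ T, ∑ t ∈ T, ‖a s t‖ ^ 2)) := by
  set D := ∑' h, d h with hD
  have hD0 : 0 ≤ D := tsum_nonneg h.nonneg
  have hk0 : 0 ≤ typeTwoConst (2 * q) := Real.sqrt_nonneg _
  set α : ℕ → ℝ := fun s => 2 * (typeTwoConst (2 * q) * D) *
    (Real.sqrt (∑ t ∈ T, ‖a s t‖ ^ 2) + Real.sqrt (∑ t ∈ T, ‖a t s‖ ^ 2)) with hα
  have hα0 : ∀ s, 0 ≤ α s := fun s => by positivity
  obtain ⟨hs, hle⟩ := summable_sq_sum_mul_and_tsum_le h.nonneg h.summable T α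
  have hm : AEStronglyMeasurable[⨆ k, M k]
      (fun x => ∑ s ∈ T, ∑ t ∈ T, a s t • B (V s x) (V t x)) μ := by
    have h1 : AEStronglyMeasurable[⨆ k, M k]
        (∑ s ∈ T, ∑ t ∈ T, fun x => a s t • B (V s x) (V t x)) μ :=
      aestronglyMeasurable_finset_sum T fun s => aestronglyMeasurable_finset_sum T fun t => ((show Continuous fun z : H × H => B z.1 z.2 by fun_prop).comp_aestronglyMeasurable
      ((h.meas s).prodMk (h.meas t))).const_smul (a s t)
    convert h1 using 1
    ext x
    simp only [Finset.sum_apply]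
  let : InnerProductSpace ℝ K := InnerProductSpace.rclikeToReal ℂ K
  refine (eLpNorm_sub_integral_le h.le h.indep hq (h.memLp_quadratic hB T a) hm
    (d := fun k => ∑ s ∈ T, α s * d (s - k))
    (fun k => Finset.sum_nonneg fun s _ => mul_nonneg (hα0 s) (h.nonneg _)) hs
    (fun k => h.eLpNorm_resid_quadratic_le hq hB T a k)).trans (ENNReal.ofReal_le_ofReal ?_)
  have hsum : ∑ s ∈ T, α s ^ 2 ≤
      (4 * typeTwoConst (2 * q) * D) ^ 2 * ∑ s ∈ T, ∑ t ∈ T, ‖a s t‖ ^ 2 := by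
    have h1 : ∀ s, α s ^ 2 ≤ 8 * (typeTwoConst (2 * q) * D) ^ 2 *
        (∑ t ∈ T, ‖a s t‖ ^ 2 + ∑ t ∈ T, ‖a t s‖ ^ 2) := fun s => by
      have e1 := Real.sq_sqrt (Finset.sum_nonneg fun t (_ : t ∈ T) => sq_nonneg ‖a s t‖)
      have e2 := Real.sq_sqrt (Finset.sum_nonneg fun t (_ : t ∈ T) => sq_nonneg ‖a t s‖)
      simp only [hα]
      rw [mul_pow, mul_pow]
      set x := Real.sqrt (∑ t ∈ T, ‖a s t‖ ^ 2)
      set y := Real.sqrt (∑ t ∈ T, ‖a t s‖ ^ 2)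
      rw [← e1, ← e2]
      have : (x + y) ^ 2 ≤ 2 * (x ^ 2 + y ^ 2) := by nlinarith [sq_nonneg (x - y)]
      nlinarith [mul_le_mul_of_nonneg_left this (sq_nonneg (typeTwoConst (2 * q) * D))]
    refine (Finset.sum_le_sum fun s _ => h1 s).trans (le_of_eq ?_)
    rw [← Finset.mul_sum, Finset.sum_add_distrib, Finset.sum_comm (f := fun s t => ‖a t s‖ ^ 2)]
    ring
  calc typeTwoConst q * Real.sqrt (∑' k : ℤ, (∑ s ∈ T, α s * d (s - k)) ^ 2)
      ≤ typeTwoConst q * Real.sqrt ((D * (4 * typeTwoConst (2 * q) * D)) ^ 2 *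
          ∑ s ∈ T, ∑ t ∈ T, ‖a s t‖ ^ 2) := by
        refine mul_le_mul_of_nonneg_left (Real.sqrt_le_sqrt ?_) (Real.sqrt_nonneg _)
        refine hle.trans ?_
        rw [mul_pow, mul_assoc]
        exact mul_le_mul_of_nonneg_left hsum (sq_nonneg _)
    _ = _ := by
        rw [Real.sqrt_mul (sq_nonneg _), Real.sqrt_sq (by positivity)]
        ring

end ShortMemory

section MaximalInequality

variable {Ω E : Type*} {mΩ : MeasurableSpace Ω} {μ : Measure Ω} [NormedAddCommGroup E]

theorem two_rpow_inv_lt_sqrt_two {q : ℝ} (hq : 2 < q) : (2 : ℝ) ^ q⁻¹ < Real.sqrt 2 := by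
  rw [Real.sqrt_eq_rpow]
  exact Real.rpow_lt_rpow_of_exponent_lt one_lt_two (by
    rw [one_div]; exact inv_strictAnti₀ two_pos hq)

/-- Gap constant of the dyadic chaining argument. -/
def chainGap (q : ℝ) : ℝ := (Real.sqrt 2 - (2 : ℝ) ^ q⁻¹)⁻¹

theorem chainGap_pos {q : ℝ} (hq : 2 < q) : 0 < chainGap q :=
  inv_pos.2 (sub_pos.2 (two_rpow_inv_lt_sqrt_two hq))

theorem exists_dominating_sum {q : ℝ} (hq : 0 < q) {c : ℝ} (hc : 0 ≤ c) (N : ℕ) {D : ℕ → Ω → E}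
    (hD : ∀ i, MemLp (D i) (ENNReal.ofReal q) μ)
    (hle : ∀ i < N, eLpNorm (D i) (ENNReal.ofReal q) μ ≤ ENNReal.ofReal c) :
    ∃ Y : Ω → ℝ, AEStronglyMeasurable Y μ ∧ (∀ i < N, ∀ x, ‖D i x‖ ≤ Y x) ∧
      eLpNorm Y (ENNReal.ofReal q) μ ≤ ENNReal.ofReal (c * (N : ℝ) ^ q⁻¹) := by
  set Z : Ω → ℝ := fun x => ∑ i ∈ Finset.range N, ‖D i x‖ ^ q with hZ
  have hZ0 : ∀ x, 0 ≤ Z x := fun x => Finset.sum_nonneg fun i _ => by positivity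
  have hZi : Integrable Z μ := integrable_finsetSum _ fun i _ =>
    integrable_norm_rpow_of_memLp hq (hD i)
  have hYm : AEStronglyMeasurable (fun x => Z x ^ q⁻¹) μ :=
    (hZi.1.aemeasurable.pow_const _).aestronglyMeasurable
  have hpow : ∀ x, ‖Z x ^ q⁻¹‖ ^ q = Z x := fun x => by
    rw [Real.norm_of_nonneg (Real.rpow_nonneg (hZ0 x) _), Real.rpow_inv_rpow (hZ0 x) hq.ne']
  have hYL : MemLp (fun x => Z x ^ q⁻¹) (ENNReal.ofReal q) μ := by
    rw [← integrable_norm_rpow_iff hYm (by simpa using hq) ENNReal.ofReal_ne_top,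
      ENNReal.toReal_ofReal hq.le]
    simpa only [hpow] using hZi
  refine ⟨fun x => Z x ^ q⁻¹, hYm, fun i hi x => ?_, ?_⟩
  · rw [Real.le_rpow_inv_iff_of_pos (norm_nonneg _) (hZ0 x) hq]
    exact Finset.single_le_sum (f := fun i => ‖D i x‖ ^ q) (fun i _ => by positivity)
      (Finset.mem_range.2 hi)
  · rw [eLpNorm_le_ofReal_iff hq hYL (by positivity)]
    simp only [hpow]
    rw [show (∫ x, Z x ∂μ) = ∫ x, ∑ i ∈ Finset.range N, ‖D i x‖ ^ q ∂μ from rfl,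
      integral_finsetSum _ fun i _ => integrable_norm_rpow_of_memLp hq (hD i),
      Real.mul_rpow hc (by positivity), Real.rpow_inv_rpow (by positivity) hq.ne', mul_comm]
    refine (Finset.sum_le_sum fun i hi => (eLpNorm_le_ofReal_iff hq (hD i) hc).1
      (hle i (Finset.mem_range.1 hi))).trans (le_of_eq ?_)
    simp

theorem exists_dominating_dyadic {q : ℝ} (hq : 2 < q) (J : ℕ) : ∀ {c : ℝ}, 0 ≤ c →
    ∀ {S : ℕ → Ω → E}, (∀ m, MemLp (S m) (ENNReal.ofReal q) μ) → (∀ x, S 0 x = 0) →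
    (∀ n m, n ≤ m → m ≤ 2 ^ J → eLpNorm (S m - S n) (ENNReal.ofReal q) μ ≤
      ENNReal.ofReal (c * Real.sqrt ((m : ℝ) - n))) →
    ∃ Y : Ω → ℝ, AEStronglyMeasurable Y μ ∧ (∀ m ≤ 2 ^ J, ∀ x, ‖S m x‖ ≤ Y x) ∧
      eLpNorm Y (ENNReal.ofReal q) μ ≤ ENNReal.ofReal
        (c * ((1 + chainGap q) * Real.sqrt 2 ^ J - chainGap q * ((2 : ℝ) ^ q⁻¹) ^ J)) := by
  have h1q : 1 ≤ ENNReal.ofReal q := by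
    rw [← ENNReal.ofReal_one]; exact ENNReal.ofReal_le_ofReal (by linarith)
  have hg := chainGap_pos hq
  have hlt := two_rpow_inv_lt_sqrt_two hq
  induction J with
  | zero =>
    intro c hc S hS h0 hinc
    refine ⟨fun x => ‖S 1 x‖, (hS 1).1.norm, fun m hm x => ?_, ?_⟩
    · rcases Nat.le_one_iff_eq_zero_or_eq_one.1 (by simpa using hm) with rfl | rfl
      · simp [h0]
      · exact le_rfl
    · have h := hinc 0 1 zero_le_one (by simp)
      have e : S 1 - S 0 = S 1 := by ext x; simp [h0]
      rw [e] at h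
      rw [eLpNorm_norm]
      simpa using h
  | succ J ih =>
    intro c hc S hS h0 hinc
    obtain ⟨Y₁, hY₁m, hY₁, hY₁n⟩ := ih (c := c * Real.sqrt 2) (by positivity)
      (S := fun m => S (2 * m)) (fun m => hS _) (fun x => by simpa using h0 x) (by
        intro n m hnm hm
        refine (hinc (2 * n) (2 * m) (by omega) (by rw [pow_succ]; omega)).trans (le_of_eq ?_)
        congr 1
        push_cast
        rw [← mul_sub, Real.sqrt_mul zero_le_two, mul_assoc])
    obtain ⟨Y₂, hY₂m, hY₂, hY₂n⟩ := exists_dominating_sum (q := q) (by linarith) hc (2 ^ J)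
      (D := fun i => S (2 * i + 1) - S (2 * i)) (fun i => (hS _).sub (hS _)) (by
        intro i hi
        have h := hinc (2 * i) (2 * i + 1) (by omega) (by rw [pow_succ]; omega)
        push_cast at h
        simpa using h)
    refine ⟨Y₁ + Y₂, hY₁m.add hY₂m, fun m hm x => ?_, ?_⟩
    · have hY₂0 : 0 ≤ Y₂ x := (norm_nonneg _).trans (hY₂ 0 (by positivity) x)
      rcases Nat.even_or_odd' m with ⟨i, rfl | rfl⟩
      · have := hY₁ i (by rw [pow_succ] at hm; omega) x
        simp only [Pi.add_apply]
        linarith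
      · have h1 := hY₁ i (by rw [pow_succ] at hm; omega) x
        have h2 := hY₂ i (by rw [pow_succ] at hm; omega) x
        have h3 : S (2 * i + 1) x = S (2 * i) x + (S (2 * i + 1) - S (2 * i)) x := by simp
        rw [h3]
        exact (norm_add_le _ _).trans (add_le_add h1 h2)
    · refine (eLpNorm_add_le hY₁m hY₂m h1q).trans ((add_le_add hY₁n hY₂n).trans ?_)
      have hpow : ((2 ^ J : ℕ) : ℝ) ^ q⁻¹ = ((2 : ℝ) ^ q⁻¹) ^ J := by
        push_cast
        rw [← Real.rpow_natCast, ← Real.rpow_natCast, ← Real.rpow_mul zero_le_two,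
          ← Real.rpow_mul zero_le_two, mul_comm]
      have hpos : 0 ≤ (1 + chainGap q) * Real.sqrt 2 ^ J - chainGap q * ((2 : ℝ) ^ q⁻¹) ^ J := by
        have : ((2 : ℝ) ^ q⁻¹) ^ J ≤ Real.sqrt 2 ^ J := by gcongr
        have h2 : 0 ≤ Real.sqrt 2 ^ J := by positivity
        nlinarith
      rw [← ENNReal.ofReal_add (by positivity) (by positivity), hpow]
      refine ENNReal.ofReal_le_ofReal (le_of_eq ?_)
      have hgap : chainGap q * (Real.sqrt 2 - (2 : ℝ) ^ q⁻¹) = 1 :=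
        inv_mul_cancel₀ (sub_pos.2 hlt).ne'
      rw [pow_succ, pow_succ]
      linear_combination (-(c * ((2 : ℝ) ^ q⁻¹) ^ J)) * hgap

/-- Constant of the maximal inequality for partial sums. -/
def chainConst (q : ℝ) : ℝ := (1 + chainGap q) * Real.sqrt 2

theorem exists_dominating_of_increments [IsProbabilityMeasure μ] {q : ℝ} (hq : 2 < q) {T : ℕ}
    (hT : 0 < T) {c : ℝ} (hc : 0 ≤ c) {S : ℕ → Ω → E}
    (hS : ∀ m, MemLp (S m) (ENNReal.ofReal q) μ) (h0 : ∀ x, S 0 x = 0)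
    (hinc : ∀ n m, n ≤ m → m ≤ T → eLpNorm (S m - S n) (ENNReal.ofReal q) μ ≤
      ENNReal.ofReal (c * Real.sqrt ((m : ℝ) - n))) :
    ∃ Y : Ω → ℝ≥0∞, AEMeasurable Y μ ∧ (∀ m ≤ T, ∀ x, ‖S m x‖ₑ ≤ Y x) ∧
      ∫⁻ x, Y x ^ 2 ∂μ ≤ ENNReal.ofReal ((chainConst q * c) ^ 2 * T) := by
  have hg := chainGap_pos hq
  obtain ⟨J, hJ1, hJ2⟩ : ∃ J : ℕ, T ≤ 2 ^ J ∧ 2 ^ J ≤ 2 * T := by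
    refine ⟨Nat.clog 2 T, Nat.le_pow_clog one_lt_two T, ?_⟩
    rcases Nat.lt_or_ge 1 T with h | h
    · have h1 := Nat.pow_pred_clog_lt_self one_lt_two h
      have h2 : 0 < Nat.clog 2 T := Nat.clog_pos one_lt_two h
      obtain ⟨k, hk⟩ := Nat.exists_eq_succ_of_ne_zero h2.ne'
      rw [hk] at h1 ⊢
      rw [Nat.pred_succ] at h1
      rw [pow_succ]; omega
    · have : T = 1 := by omega
      subst this; simp
  obtain ⟨Y, hYm, hY, hYn⟩ := exists_dominating_dyadic hq J hc (S := fun m => S (min m T))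
    (fun m => hS _) (fun x => by simpa using h0 x) (by
      intro n m hnm _
      refine (hinc (min n T) (min m T) (by omega) (by omega)).trans (ENNReal.ofReal_le_ofReal ?_)
      refine mul_le_mul_of_nonneg_left (Real.sqrt_le_sqrt ?_) hc
      have : ((min m T + n : ℕ) : ℝ) ≤ ((m + min n T : ℕ) : ℝ) := by
        exact_mod_cast (by omega : min m T + n ≤ m + min n T)
      push_cast at this
      push_cast
      linarith)
  refine ⟨fun x => ‖Y x‖ₑ, hYm.enorm, fun m hm x => ?_, ?_⟩
  · have h := hY m (hm.trans hJ1) x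
    rw [min_eq_left hm] at h
    show ‖S m x‖ₑ ≤ ‖Y x‖ₑ
    rw [enorm_le_iff_norm_le]
    exact h.trans (le_abs_self _)
  · have h2q : eLpNorm Y 2 μ ≤ eLpNorm Y (ENNReal.ofReal q) μ :=
      eLpNorm_le_eLpNorm_of_exponent_le (by
        rw [← ENNReal.ofReal_ofNat]; exact ENNReal.ofReal_le_ofReal hq.le) hYm
    have hb : eLpNorm Y 2 μ ≤ ENNReal.ofReal (chainConst q * c * Real.sqrt T) := by
      refine h2q.trans (hYn.trans (ENNReal.ofReal_le_ofReal ?_))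
      have h1 : Real.sqrt 2 ^ J ≤ Real.sqrt 2 * Real.sqrt T := by
        rw [← Real.sqrt_mul zero_le_two]
        refine Real.le_sqrt_of_sq_le ?_
        rw [← pow_mul, mul_comm, pow_mul, Real.sq_sqrt zero_le_two]
        exact_mod_cast hJ2
      have h3 : 0 ≤ chainGap q * ((2 : ℝ) ^ q⁻¹) ^ J := by positivity
      calc c * ((1 + chainGap q) * Real.sqrt 2 ^ J - chainGap q * ((2 : ℝ) ^ q⁻¹) ^ J)
          ≤ c * ((1 + chainGap q) * (Real.sqrt 2 * Real.sqrt T)) := by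
            gcongr
            have := mul_le_mul_of_nonneg_left h1 (by positivity : 0 ≤ 1 + chainGap q)
            linarith
        _ = _ := by rw [chainConst]; ring
    have h2 : ∫⁻ x, ‖Y x‖ₑ ^ 2 ∂μ = eLpNorm Y 2 μ ^ 2 := by
      rw [eLpNorm_eq_lintegral_rpow_enorm_toReal two_ne_zero ENNReal.ofNat_ne_top]
      rw [← ENNReal.rpow_natCast, ← ENNReal.rpow_mul]
      simp
    rw [h2]
    refine (pow_le_pow_left' hb 2).trans (le_of_eq ?_)
    rw [← ENNReal.ofReal_pow (by unfold chainConst; positivity), mul_pow, Real.sq_sqrt (by positivity)]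

end MaximalInequality

section QuadraticMaximal

variable {Ω H K : Type*} {mΩ : MeasurableSpace Ω} {μ : Measure Ω} [IsProbabilityMeasure μ]
  {M : ℤ → MeasurableSpace Ω} [NormedAddCommGroup H] [InnerProductSpace ℂ H] [CompleteSpace H]
  {V : ℤ → Ω → H} {q : ℝ} {d : ℤ → ℝ}
  [NormedAddCommGroup K] [InnerProductSpace ℂ K] [CompleteSpace K]

/-- The quadratic form `∑_{s,t ≤ m} a_{st} B(V_s, V_t)`. -/
def quadForm (B : H →L[ℝ] H →L[ℝ] K) (a : ℕ → ℕ → ℂ) (V : ℤ → H) (m : ℕ) : K :=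
  ∑ s ∈ Finset.Icc 1 m, ∑ t ∈ Finset.Icc 1 m, a s t • B (V s) (V t)

/-- Constant of the maximal inequality for quadratic forms. -/
def quadConst (q : ℝ) (d : ℤ → ℝ) : ℝ :=
  (chainConst q * (4 * typeTwoConst q * typeTwoConst (2 * q) * (∑' h, d h) ^ 2 * Real.sqrt 2)) ^ 2

theorem ShortMemory.exists_dominating_quadForm (h : ShortMemory M μ V (2 * q) d) (hq : 2 < q)
    {B : H →L[ℝ] H →L[ℝ] K} (hB : IsTensor B) {T : ℕ} (hT : 0 < T) {a : ℕ → ℕ → ℂ} {A : ℝ}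
    (hA : 0 ≤ A) (hrow : ∀ s, ∑ t ∈ Finset.Icc 1 T, ‖a s t‖ ^ 2 ≤ A)
    (hcol : ∀ t, ∑ s ∈ Finset.Icc 1 T, ‖a s t‖ ^ 2 ≤ A) :
    ∃ Y : Ω → ℝ≥0∞, AEMeasurable Y μ ∧
      (∀ m ≤ T, ∀ x, ‖quadForm B a (fun t => V t x) m
        - ∫ y, quadForm B a (fun t => V t y) m ∂μ‖ₑ ≤ Y x) ∧
      ∫⁻ x, Y x ^ 2 ∂μ ≤ ENNReal.ofReal (quadConst q d * A * T) := by
  set C := 4 * typeTwoConst q * typeTwoConst (2 * q) * (∑' h, d h) ^ 2 with hC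
  have hC0 : 0 ≤ C := by
    have h1 : 0 ≤ typeTwoConst q := Real.sqrt_nonneg _
    have h2 : 0 ≤ typeTwoConst (2 * q) := Real.sqrt_nonneg _
    positivity
  have h1q : 1 ≤ ENNReal.ofReal q := by
    rw [← ENNReal.ofReal_one]; exact ENNReal.ofReal_le_ofReal (by linarith)
  have hmem : ∀ m, MemLp (fun x => quadForm B a (fun t => V t x) m) (ENNReal.ofReal q) μ :=
    fun m => h.memLp_quadratic hB _ a
  obtain ⟨Y, hYm, hY, hYn⟩ := exists_dominating_of_increments (μ := μ) hq hT
    (c := C * Real.sqrt 2 * Real.sqrt A) (by positivity)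
    (S := fun m x => quadForm B a (fun t => V t x) m - ∫ y, quadForm B a (fun t => V t y) m ∂μ)
    (fun m => (hmem m).sub (memLp_const _)) (fun x => by simp [quadForm]) (by
      intro n m hnm hm
      set a' : ℕ → ℕ → ℂ := fun s t => if s ≤ n ∧ t ≤ n then 0 else a s t with ha'
      have hdiff : ∀ x, quadForm B a' (fun t => V t x) m =
          quadForm B a (fun t => V t x) m - quadForm B a (fun t => V t x) n := by
        intro x
        have hI : Finset.Icc 1 n = (Finset.Icc 1 m).filter (· ≤ n) := by
          ext s; simp only [Finset.mem_Icc, Finset.mem_filter]; omega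
        simp only [quadForm]
        rw [eq_sub_iff_add_eq, hI, Finset.sum_filter, ← Finset.sum_add_distrib]
        refine Finset.sum_congr rfl fun s _ => ?_
        by_cases hs : s ≤ n
        · rw [if_pos hs, Finset.sum_filter, ← Finset.sum_add_distrib]
          refine Finset.sum_congr rfl fun t _ => ?_
          by_cases ht : t ≤ n <;> simp [ha', hs, ht]
        · simp [ha', hs]
      have e : (fun x => quadForm B a (fun t => V t x) m
            - ∫ y, quadForm B a (fun t => V t y) m ∂μ) -
          (fun x => quadForm B a (fun t => V t x) n - ∫ y, quadForm B a (fun t => V t y) n ∂μ) =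
          fun x => quadForm B a' (fun t => V t x) m
            - ∫ y, quadForm B a' (fun t => V t y) m ∂μ := by
        ext x
        simp only [Pi.sub_apply, hdiff]
        rw [integral_sub ((hmem m).integrable h1q) ((hmem n).integrable h1q)]
        abel
      rw [e]
      refine (h.eLpNorm_quadratic_le hq.le hB (Finset.Icc 1 m) a').trans
        (ENNReal.ofReal_le_ofReal ?_)
      have hR : C * √2 * √A * √((m : ℝ) - n) = C * √(2 * (A * ((m : ℝ) - n))) := by
        rw [Real.sqrt_mul zero_le_two, Real.sqrt_mul hA]; ring
      rw [← hC, hR]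
      refine mul_le_mul_of_nonneg_left (Real.sqrt_le_sqrt ?_) hC0
      have hsub : Finset.Icc 1 m ⊆ Finset.Icc 1 T := Finset.Icc_subset_Icc_right hm
      have hcard : ∀ f : ℕ → ℝ, (∀ s, f s ≤ A) →
          ∑ s ∈ Finset.Icc 1 m, (if n < s then f s else 0) ≤ A * ((m : ℝ) - n) := by
        intro f hf
        rw [← Finset.sum_filter]
        have hI : (Finset.Icc 1 m).filter (n < ·) = Finset.Ioc n m := by
          ext s; simp only [Finset.mem_Icc, Finset.mem_filter, Finset.mem_Ioc]; omega
        rw [hI]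
        refine (Finset.sum_le_card_nsmul _ _ A fun s _ => hf s).trans (le_of_eq ?_)
        rw [Nat.card_Ioc, nsmul_eq_mul, Nat.cast_sub hnm, mul_comm]
      have h1 := hcard (fun s => ∑ t ∈ Finset.Icc 1 m, ‖a s t‖ ^ 2) fun s =>
        (Finset.sum_le_sum_of_subset_of_nonneg hsub fun _ _ _ => by positivity).trans (hrow s)
      have h2 := hcard (fun t => ∑ s ∈ Finset.Icc 1 m, ‖a s t‖ ^ 2) fun t =>
        (Finset.sum_le_sum_of_subset_of_nonneg hsub fun _ _ _ => by positivity).trans (hcol t)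
      have h3 : ∑ t ∈ Finset.Icc 1 m, (if n < t then ∑ s ∈ Finset.Icc 1 m, ‖a s t‖ ^ 2 else 0)
          = ∑ s ∈ Finset.Icc 1 m, ∑ t ∈ Finset.Icc 1 m, if n < t then ‖a s t‖ ^ 2 else 0 := by
        rw [Finset.sum_comm]
        refine Finset.sum_congr rfl fun t _ => ?_
        split_ifs <;> simp
      rw [h3] at h2
      rw [two_mul]
      refine le_trans ?_ (add_le_add h1 h2)
      rw [← Finset.sum_add_distrib]
      refine Finset.sum_le_sum fun s _ => ?_
      by_cases hs : n < s
      · rw [if_pos hs, ← Finset.sum_add_distrib]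
        refine Finset.sum_le_sum fun t _ => ?_
        simp only [ha', not_le.2 hs, false_and, if_false]
        have : 0 ≤ (if n < t then ‖a s t‖ ^ 2 else 0) := by split_ifs <;> positivity
        linarith
      · rw [if_neg hs, zero_add]
        refine Finset.sum_le_sum fun t _ => ?_
        by_cases ht : n < t
        · simp [ha', not_le.2 ht, ht]
        · simp [ha', not_lt.1 hs, not_lt.1 ht, ht])
  refine ⟨Y, hYm, hY, hYn.trans (le_of_eq ?_)⟩
  congr 1
  rw [quadConst, ← hC, show chainConst q * (C * √2 * √A) = chainConst q * (C * √2) * √A by ring,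
    mul_pow _ (√A), Real.sq_sqrt hA]

end QuadraticMaximal

section HilbertSchmidtSpace

variable (H : Type*) [NormedAddCommGroup H] [InnerProductSpace ℂ H] [CompleteSpace H]

/-- The Hilbert-Schmidt operators, represented by the images of the fixed orthonormal basis. -/
def HSSpace : Type _ := lp (fun _ : HSIndex H => H) 2

instance : NormedAddCommGroup (HSSpace H) :=
  inferInstanceAs (NormedAddCommGroup (lp (fun _ : HSIndex H => H) 2))

instance : InnerProductSpace ℂ (HSSpace H) :=
  inferInstanceAs (InnerProductSpace ℂ (lp (fun _ : HSIndex H => H) 2))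

instance : CompleteSpace (HSSpace H) :=
  inferInstanceAs (CompleteSpace (lp (fun _ : HSIndex H => H) 2))

variable {H}

/-- The image of the `i`-th basis vector. -/
def HSSpace.coord (k : HSSpace H) (i : HSIndex H) : H :=
  (show lp (fun _ : HSIndex H => H) 2 from k : (i : HSIndex H) → H) i

namespace HSSpace

theorem coord_add (k l : HSSpace H) (i) : (k + l).coord i = k.coord i + l.coord i := rfl

theorem coord_smul (c : ℂ) (k : HSSpace H) (i) : (c • k).coord i = c • k.coord i := rfl

theorem ext_coord {k l : HSSpace H} (h : ∀ i, k.coord i = l.coord i) : k = l :=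
  Subtype.ext (funext h)

theorem inner_eq (k l : HSSpace H) : inner ℂ k l = ∑' i, inner ℂ (k.coord i) (l.coord i) :=
  lp.inner_eq_tsum (𝕜 := ℂ) (G := fun _ : HSIndex H => H) k l

theorem summable_sq (k : HSSpace H) : Summable fun i => ‖k.coord i‖ ^ 2 := by
  have h : Memℓp (fun i => k.coord i) 2 := lp.memℓp (E := fun _ : HSIndex H => H) k
  rw [memℓp_gen_iff (by norm_num)] at h
  simpa using h

theorem norm_sq (k : HSSpace H) : ‖k‖ ^ 2 = ∑' i, ‖k.coord i‖ ^ 2 := by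
  have h := lp.norm_rpow_eq_tsum (p := 2) (E := fun _ : HSIndex H => H) (by norm_num) k
  have h2 : (2 : ℝ≥0∞).toReal = ((2 : ℕ) : ℝ) := by norm_num
  simp only [h2, Real.rpow_natCast] at h
  exact h

/-- An element with given square summable coordinates. -/
def ofCoord (f : HSIndex H → H) (hf : Summable fun i => ‖f i‖ ^ 2) : HSSpace H :=
  (⟨f, memℓp_gen (by simpa using hf)⟩ : lp (fun _ : HSIndex H => H) 2)

theorem coord_ofCoord (f : HSIndex H → H) (hf) (i) : (ofCoord f hf).coord i = f i := rfl

end HSSpace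

theorem HilbertBasis.hasSum_norm_inner_sq {ι : Type*} (e : HilbertBasis ι ℂ H) (x : H) :
    HasSum (fun i => ‖inner ℂ (e i) x‖ ^ 2) (‖x‖ ^ 2) := by
  have h := Complex.hasSum_re (e.hasSum_inner_mul_inner x x)
  have e1 : ∀ i, (inner ℂ x (e i) * inner ℂ (e i) x : ℂ).re = ‖inner ℂ (e i) x‖ ^ 2 := by
    intro i
    have := inner_mul_symm_re_eq_norm (𝕜 := ℂ) x (e i)
    rw [norm_mul, norm_inner_symm x, ← sq] at this
    exact this
  have e2 : (inner ℂ x x : ℂ).re = ‖x‖ ^ 2 := by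
    rw [inner_self_eq_norm_sq_to_K]; norm_cast
  simpa only [e1, e2] using h

/-- The tensor product as an element of the Hilbert-Schmidt space. -/
def hsTensorAux (f g : H) : HSSpace H :=
  HSSpace.ofCoord (fun i => (inner ℂ g (hsBasis H i) : ℂ) • f) (by
    simp_rw [norm_smul, mul_pow, norm_inner_symm g]
    exact ((hsBasis H).hasSum_norm_inner_sq g).summable.mul_right _)

theorem norm_hsTensorAux (f g : H) : ‖hsTensorAux f g‖ = ‖f‖ * ‖g‖ := by
  rw [← sq_eq_sq₀ (by positivity) (by positivity), HSSpace.norm_sq]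
  simp_rw [hsTensorAux, HSSpace.coord_ofCoord, norm_smul, mul_pow, norm_inner_symm g]
  rw [tsum_mul_right, ((hsBasis H).hasSum_norm_inner_sq g).tsum_eq, mul_comm]

/-- The tensor product as a continuous real bilinear map into the Hilbert-Schmidt space. -/
def hsTensor (H : Type*) [NormedAddCommGroup H] [InnerProductSpace ℂ H] [CompleteSpace H] :
    H →L[ℝ] H →L[ℝ] HSSpace H :=
  LinearMap.mkContinuous₂
    (LinearMap.mk₂ ℝ hsTensorAux
      (fun f f' g => HSSpace.ext_coord fun i => by
        simp [hsTensorAux, HSSpace.coord_ofCoord, HSSpace.coord_add])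
      (fun c f g => HSSpace.ext_coord fun i => by
        rw [← Complex.coe_smul c (hsTensorAux f g), HSSpace.coord_smul]
        simp only [hsTensorAux, HSSpace.coord_ofCoord]
        rw [← Complex.coe_smul c f, smul_comm])
      (fun f g g' => HSSpace.ext_coord fun i => by
        simp [hsTensorAux, HSSpace.coord_ofCoord, HSSpace.coord_add, add_smul])
      (fun c f g => HSSpace.ext_coord fun i => by
        rw [← Complex.coe_smul c (hsTensorAux f g), HSSpace.coord_smul]
        simp only [hsTensorAux, HSSpace.coord_ofCoord]
        rw [← Complex.coe_smul c g, inner_smul_left, Complex.conj_ofReal, mul_smul]))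
    1 (fun f g => by rw [one_mul]; exact (norm_hsTensorAux f g).le)

theorem coord_hsTensor (f g : H) (i) :
    (hsTensor H f g).coord i = (inner ℂ g (hsBasis H i) : ℂ) • f := rfl

theorem norm_hsTensor (f g : H) : ‖hsTensor H f g‖ = ‖f‖ * ‖g‖ := norm_hsTensorAux f g

theorem isTensor_hsTensor : IsTensor (hsTensor H) where
  smul_left c f g := HSSpace.ext_coord fun i => by
    rw [HSSpace.coord_smul, coord_hsTensor, coord_hsTensor, smul_comm]
  smul_right c f g := HSSpace.ext_coord fun i => by
    rw [HSSpace.coord_smul, coord_hsTensor, coord_hsTensor, inner_smul_left, mul_smul]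
  norm_le f g := (norm_hsTensor f g).le

theorem summable_hsOp (k : HSSpace H) (v : H) :
    (Summable fun i => ‖inner ℂ (hsBasis H i) v‖ * ‖k.coord i‖) ∧
      ∑' i, ‖inner ℂ (hsBasis H i) v‖ * ‖k.coord i‖ ≤ ‖k‖ * ‖v‖ := by
  have h1 := (hsBasis H).hasSum_norm_inner_sq v
  have h2 := k.summable_sq
  have hs : Summable fun i => ‖inner ℂ (hsBasis H i) v‖ * ‖k.coord i‖ := by
    refine Summable.of_nonneg_of_le (fun i => by positivity) (fun i => ?_) (h1.summable.add h2)
    nlinarith [sq_nonneg (‖inner ℂ (hsBasis H i) v‖ - ‖k.coord i‖),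
      sq_nonneg ‖inner ℂ (hsBasis H i) v‖, sq_nonneg ‖k.coord i‖]
  refine ⟨hs, ?_⟩
  refine Real.tsum_le_of_sum_le (fun i => by positivity) fun s => ?_
  refine (Real.sum_mul_le_sqrt_mul_sqrt s _ _).trans ?_
  rw [mul_comm]
  refine mul_le_mul ?_ ?_ (by positivity) (by positivity)
  · refine Real.sqrt_le_iff.2 ⟨by positivity, ?_⟩
    rw [k.norm_sq]
    exact h2.sum_le_tsum s fun _ _ => by positivity
  · refine Real.sqrt_le_iff.2 ⟨by positivity, ?_⟩
    exact sum_le_hasSum s (fun _ _ => by positivity) h1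

/-- The operator represented by an element of the Hilbert-Schmidt space. -/
def hsOp (H : Type*) [NormedAddCommGroup H] [InnerProductSpace ℂ H] [CompleteSpace H] :
    HSSpace H →L[ℂ] H →L[ℂ] H :=
  LinearMap.mkContinuous₂
    (LinearMap.mk₂ ℂ
      (fun (k : HSSpace H) v => ∑' i, (inner ℂ (hsBasis H i) v : ℂ) • k.coord i)
      (fun k l v => by
        have hk := Summable.of_norm_bounded (summable_hsOp k v).1 fun i => (norm_smul
          (inner ℂ (hsBasis H i) v : ℂ) (k.coord i)).le
        have hl := Summable.of_norm_bounded (summable_hsOp l v).1 fun i => (norm_smul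
          (inner ℂ (hsBasis H i) v : ℂ) (l.coord i)).le
        simp_rw [HSSpace.coord_add, smul_add]
        exact hk.tsum_add hl)
      (fun c k v => by
        simp_rw [HSSpace.coord_smul, smul_comm _ c]
        exact tsum_const_smul'' c)
      (fun k v v' => by
        have hk := fun v => Summable.of_norm_bounded (summable_hsOp k v).1 fun i => (norm_smul
          (inner ℂ (hsBasis H i) v : ℂ) (k.coord i)).le
        simp_rw [inner_add_right, add_smul]
        exact (hk v).tsum_add (hk v'))
      (fun c k v => by
        simp_rw [inner_smul_right, mul_smul]
        exact tsum_const_smul'' c))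
    1 (fun k v => by
      have h := summable_hsOp k v
      simp_rw [← norm_smul] at h
      rw [one_mul]
      exact (norm_tsum_le_tsum_norm h.1).trans h.2)

theorem hsOp_apply (k : HSSpace H) (v : H) :
    hsOp H k v = ∑' i, (inner ℂ (hsBasis H i) v : ℂ) • k.coord i := rfl

theorem norm_hsOp_le (k : HSSpace H) : ‖hsOp H k‖ ≤ ‖k‖ := by
  refine ContinuousLinearMap.opNorm_le_bound _ (norm_nonneg _) fun v => ?_
  have h := summable_hsOp k v
  simp_rw [← norm_smul] at h
  exact (norm_tsum_le_tsum_norm h.1).trans h.2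

theorem hsOp_basis (k : HSSpace H) (i) : hsOp H k (hsBasis H i) = k.coord i := by
  classical
  rw [hsOp_apply, tsum_eq_single i]
  · rw [orthonormal_iff_ite.1 (hsBasis H).orthonormal]; simp
  · intro j hj
    rw [orthonormal_iff_ite.1 (hsBasis H).orthonormal]; simp [hj]

theorem hsOp_injective : Function.Injective (hsOp H) := fun k l h =>
  HSSpace.ext_coord fun i => by rw [← hsOp_basis, ← hsOp_basis, h]

theorem hsOp_hsTensor (f g : H) : hsOp H (hsTensor H f g) = tensorOp f g := by
  ext v
  rw [hsOp_apply, tensorOp, InnerProductSpace.rankOne_apply,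
    ← ((hsBasis H).hasSum_inner_mul_inner g v).tsum_eq]
  rw [← ((hsBasis H).summable_inner_mul_inner g v).tsum_smul_const f]
  refine tsum_congr fun i => ?_
  rw [coord_hsTensor, smul_smul, mul_comm]

theorem hsInner_tensorOp (A : H →L[ℂ] H) (u φ : H) :
    hsInner A (tensorOp u φ) = inner ℂ u (A φ) := by
  rw [hsInner, ← ContinuousLinearMap.adjoint_inner_left,
    ← ((hsBasis H).hasSum_inner_mul_inner _ φ).tsum_eq]
  refine tsum_congr fun i => ?_
  rw [tensorOp, InnerProductSpace.rankOne_apply, inner_smul_left, inner_conj_symm,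
    ContinuousLinearMap.adjoint_inner_left, mul_comm]

theorem inner_hsTensor (u φ : H) (k : HSSpace H) :
    inner ℂ (hsTensor H u φ) k = inner ℂ u (hsOp H k φ) := by
  rw [← hsInner_tensorOp, hsInner, HSSpace.inner_eq]
  refine tsum_congr fun i => ?_
  rw [coord_hsTensor, hsOp_basis, tensorOp, InnerProductSpace.rankOne_apply]

theorem hsNormSq_smul (c : ℂ) (A : H →L[ℂ] H) : hsNormSq (c • A) = ‖c‖ ^ 2 * hsNormSq A := by
  simp_rw [hsNormSq, _root_.smul_apply, norm_smul, mul_pow]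
  exact tsum_mul_left

theorem hsNormSq_hsOp (k : HSSpace H) : hsNormSq (hsOp H k) = ‖k‖ ^ 2 := by
  simp_rw [hsNormSq, hsOp_basis, HSSpace.norm_sq]

theorem hsNormSq_proj_sub {φ ψ : H} (hφ : ‖φ‖ = 1) (hψ : ‖ψ‖ = 1) :
    hsNormSq (tensorOp φ φ - tensorOp ψ ψ) = 2 - 2 * ‖inner ℂ φ ψ‖ ^ 2 := by
  rw [← hsOp_hsTensor, ← hsOp_hsTensor, ← map_sub, hsNormSq_hsOp, norm_sub_sq (𝕜 := ℂ),
    norm_hsTensor, norm_hsTensor, hφ, hψ, inner_hsTensor, hsOp_hsTensor, tensorOp,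
    InnerProductSpace.rankOne_apply, inner_smul_right, inner_mul_symm_re_eq_norm, norm_mul,
    norm_inner_symm ψ φ]
  ring

end HilbertSchmidtSpace

section CovarianceDecay

theorem summable_rpow_mul_conv {d : ℤ → ℝ} (hd : ∀ h, 0 ≤ d h) (hneg : ∀ h < 0, d h = 0) {ℓ : ℝ}
    (hℓ : 0 ≤ ℓ) (hs : Summable d) (hsl : Summable fun h : ℤ => |(h : ℝ)| ^ ℓ * d h) :
    (∀ h : ℤ, Summable fun k : ℤ => d (h - k) * d (-k)) ∧
      Summable fun h : ℤ => |(h : ℝ)| ^ ℓ * ∑' k : ℤ, d (h - k) * d (-k) := by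
  let σ : ℤ × ℤ ≃ ℤ × ℤ :=
    { toFun := fun p => (p.1 - p.2, -p.2)
      invFun := fun p => (p.1 - p.2, -p.2)
      left_inv := fun p => by ext <;> simp
      right_inv := fun p => by ext <;> simp }
  have hp : ∀ h : ℤ, 0 ≤ |(h : ℝ)| ^ ℓ * d h := fun h => mul_nonneg (by positivity) (hd h)
  have h0 : Summable fun p : ℤ × ℤ => d p.1 * d p.2 :=
    hs.mul_of_nonneg hs (fun h => hd h) (fun h => hd h)
  have h1 : Summable fun p : ℤ × ℤ => |(p.1 : ℝ)| ^ ℓ * d p.1 * d p.2 :=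
    hsl.mul_of_nonneg hs hp (fun h => hd h)
  have h2 : Summable fun p : ℤ × ℤ => d p.1 * (|(p.2 : ℝ)| ^ ℓ * d p.2) :=
    hs.mul_of_nonneg hsl (fun h => hd h) hp
  have h3 : Summable fun p : ℤ × ℤ => |(p.1 : ℝ)| ^ ℓ * (d (p.1 - p.2) * d (-p.2)) := by
    refine Summable.of_nonneg_of_le (fun p => ?_) (fun p => ?_) (σ.summable_iff.2 (h1.add h2))
    · exact mul_nonneg (by positivity) (mul_nonneg (hd _) (hd _))
    · obtain ⟨h, k⟩ := p
      simp only [Function.comp_apply, Equiv.coe_fn_mk, σ]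
      by_cases hk : 0 ≤ h - k ∧ 0 ≤ -k
      · have hdd : 0 ≤ d (h - k) * d (-k) := mul_nonneg (hd _) (hd _)
        have key : |(h : ℝ)| ^ ℓ ≤ |((h - k : ℤ) : ℝ)| ^ ℓ + |((-k : ℤ) : ℝ)| ^ ℓ := by
          rcases le_or_gt |h| |h - k| with hle | hle
          · have : |(h : ℝ)| ≤ |((h - k : ℤ) : ℝ)| := by exact_mod_cast hle
            exact (Real.rpow_le_rpow (abs_nonneg _) this hℓ).trans
              (le_add_of_nonneg_right (by positivity))
          · have hle' : |h| ≤ |-k| := by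
              obtain ⟨ha, hb⟩ := hk
              rw [abs_of_nonneg ha] at hle
              rw [abs_of_nonneg hb]
              rcases abs_cases h with ⟨h', _⟩ | ⟨h', _⟩ <;> rw [h'] at hle ⊢ <;> omega
            have : |(h : ℝ)| ≤ |((-k : ℤ) : ℝ)| := by exact_mod_cast hle'
            exact (Real.rpow_le_rpow (abs_nonneg _) this hℓ).trans
              (le_add_of_nonneg_left (by positivity))
        nlinarith [mul_le_mul_of_nonneg_right key hdd]
      · have hz : d (h - k) * d (-k) = 0 := by
          rcases not_and_or.1 hk with hk | hk
          · rw [hneg _ (not_le.1 hk), zero_mul]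
          · rw [hneg (-k) (not_le.1 hk), mul_zero]
        rw [hz, mul_zero]
        exact add_nonneg (mul_nonneg (hp _) (hd _)) (mul_nonneg (hd _) (hp _))
  refine ⟨fun h => (σ.summable_iff.2 h0).prod_factor h, ?_⟩
  have h4 := h3.prod
  simpa only [tsum_mul_left] using h4

theorem summable_int_of_nat {f : ℤ → ℝ} (hneg : ∀ h < 0, f h = 0)
    (hs : Summable fun n : ℕ => f n) : Summable f := by
  refine Summable.of_nat_of_neg_add_one hs ?_
  have : (fun n : ℕ => f (-((n : ℤ) + 1))) = 0 := by
    ext n; exact hneg _ (by omega)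
  rw [this]
  exact summable_zero

end CovarianceDecay

section LagProcess

variable {Ω H : Type*} {mΩ : MeasurableSpace Ω} [NormedAddCommGroup H] [InnerProductSpace ℂ H]
  [CompleteSpace H]

/-- A process with short memory whose covariances `C (s - t) = E(V_s ⊗ V_t)` satisfy
`∑ |h| ^ ℓ ‖C h‖ < ∞`. -/
structure LagProcess (M : ℤ → MeasurableSpace Ω) (μ : Measure Ω) (V : ℤ → Ω → H)
    (C : ℤ → HSSpace H) (q ℓ : ℝ) (d : ℤ → ℝ) : Prop where
  short : ShortMemory M μ V (2 * q) d
  meas : ∀ t, StronglyMeasurable (V t)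
  cov : ∀ s t, ∫ x, hsTensor H (V s x) (V t x) ∂μ = C (s - t)
  summable_cov : Summable fun h : ℤ => |(h : ℝ)| ^ ℓ * ‖C h‖

/-- The spectral density as an element of the Hilbert-Schmidt space. -/
def specHS (C : ℤ → HSSpace H) (ω : ℝ) : HSSpace H :=
  ((2 * Real.pi : ℝ) : ℂ)⁻¹ • ∑' h : ℤ, Complex.exp (-(Complex.I * ω * h)) • C h

theorem norm_exp_neg_I_mul (ω h : ℝ) : ‖Complex.exp (-(Complex.I * ω * h))‖ = 1 := by
  rw [Complex.norm_exp]; simp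

theorem norm_exp_neg_I_mul_int (ω : ℝ) (h : ℤ) : ‖Complex.exp (-(Complex.I * ω * h))‖ = 1 := by
  simpa using norm_exp_neg_I_mul ω h

theorem summable_norm_of_rpow {C : ℤ → HSSpace H} {ℓ : ℝ} (hℓ : 0 ≤ ℓ)
    (hC : Summable fun h : ℤ => |(h : ℝ)| ^ ℓ * ‖C h‖) : Summable fun h => ‖C h‖ := by
  refine Summable.of_nonneg_of_le (fun _ => norm_nonneg _)
    (fun h => ?_) (hC.add (hasSum_ite_eq (0 : ℤ) ‖C 0‖).summable)
  split_ifs with h0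
  · subst h0
    exact le_add_of_nonneg_left (by positivity)
  · rw [add_zero]
    refine le_mul_of_one_le_left (norm_nonneg _) (Real.one_le_rpow ?_ hℓ)
    exact_mod_cast Int.one_le_abs h0

theorem summable_exp_smul {C : ℤ → HSSpace H} (hC : Summable fun h => ‖C h‖) (ω : ℝ) :
    Summable fun h : ℤ => Complex.exp (-(Complex.I * ω * h)) • C h :=
  Summable.of_norm_bounded hC fun h => by rw [norm_smul, norm_exp_neg_I_mul_int, one_mul]

theorem continuous_specHS {C : ℤ → HSSpace H} (hC : Summable fun h => ‖C h‖) :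
    Continuous (specHS C) := by
  have : Continuous fun ω : ℝ => ∑' h : ℤ, Complex.exp (-(Complex.I * ω * h)) • C h := by
    refine continuous_tsum (fun h => ?_) hC fun h ω => ?_
    · fun_prop
    · rw [norm_smul, norm_exp_neg_I_mul_int, one_mul]
  exact Continuous.const_smul this (((2 * Real.pi : ℝ) : ℂ)⁻¹)

end LagProcess

section CausalLag

variable {Ω S H : Type*} [MeasurableSpace Ω] [MeasurableSpace S]
  [NormedAddCommGroup H] [InnerProductSpace ℂ H] [CompleteSpace H]
  [SecondCountableTopology H] [MeasurableSpace H] [BorelSpace H]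
  {μ : Measure Ω} [IsProbabilityMeasure μ] {ε : ℤ → Ω → S} {ε₀ : Ω → S} {V : ℤ → Ω → H}

/-- The dependence measures as a function on `ℤ`. -/
def depFun (μ : Measure Ω) (ε : ℤ → Ω → S) (ε₀ : Ω → S) (V : ℤ → Ω → H) (p : ℝ≥0∞) (h : ℤ) : ℝ :=
  if 0 ≤ h then (depMeasure μ ε ε₀ V p h).toReal else 0

theorem PhysicalDependence.shortMemory {r : ℝ≥0∞} (h : PhysicalDependence μ ε ε₀ V r) {p : ℝ}
    (hp : 1 ≤ p) (hL : ∀ t, MemLp (V t) (ENNReal.ofReal p) μ) (h0 : ∀ t, ∫ x, V t x ∂μ = 0)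
    (hs : ∑' j : ℕ, depMeasure μ ε ε₀ V (ENNReal.ofReal p) (j : ℤ) ≠ ∞) :
    ShortMemory (innov ε) μ V p (depFun μ ε ε₀ V (ENNReal.ofReal p)) where
  le := h.innov_le
  indep := h.iIndep_innov
  memLp := hL
  meas := h.aestronglyMeasurable_innov
  mean := h0
  nonneg t := by unfold depFun; split_ifs <;> positivity
  summable := by
    refine summable_int_of_nat (fun t ht => if_neg (not_le.2 ht)) ?_
    simpa [depFun] using ENNReal.summable_toReal hs
  resid_le k t := by
    have h1p : 1 ≤ ENNReal.ofReal p := by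
      rw [← ENNReal.ofReal_one]; exact ENNReal.ofReal_le_ofReal hp
    rw [h.eLpNorm_resid_le (fun t => (hL t).integrable h1p)]
    by_cases hkt : k ≤ t
    · have hne : depMeasure μ ε ε₀ V (ENNReal.ofReal p) (t - k) ≠ ∞ := by
        have := ENNReal.ne_top_of_tsum_ne_top hs (t - k).toNat
        rwa [Int.toNat_of_nonneg (by omega)] at this
      rw [if_pos hkt, depFun, if_pos (by omega), ENNReal.ofReal_toReal hne]
    · rw [if_neg hkt]; exact zero_le

theorem norm_integral_hsTensor_le {d : ℤ → ℝ} (hd : ShortMemory (innov ε) μ V 2 d)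
    (hds : ∀ h : ℤ, Summable fun k : ℤ => d (h - k) * d (-k)) (t : ℤ) :
    ‖∫ x, hsTensor H (V t x) (V 0 x) ∂μ‖ ≤ ‖hsTensor H‖ * ∑' k : ℤ, d (t - k) * d (-k) := by
  have h2 : ENNReal.ofReal 2 = 2 := by norm_num
  have hL := hd.memLp
  have hr := hd.resid_le
  rw [h2] at hL hr
  exact norm_integral_bilin_le_tsum hd.le hd.indep (hsTensor H) (hL t) (hL 0) (hd.meas t)
    (hd.meas 0) (hd.mean t) (fun k => hd.nonneg _) (fun k => hd.nonneg _) (hds t)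
    (fun k => hr k t) (fun k => by simpa using hr k 0)

theorem hsOp_integral_hsTensor {f g : Ω → H} (hf : MemLp f 2 μ) (hg : MemLp g 2 μ) :
    hsOp H (∫ x, hsTensor H (f x) (g x) ∂μ) = crossCov μ f g := by
  rw [← ContinuousLinearMap.integral_comp_comm _ (integrable_bilin _ hf hg)]
  simp_rw [hsOp_hsTensor]
  rfl

theorem PhysicalDependence.lagProcess {δ : ℝ} (hδ : 0 < δ)
    (h : PhysicalDependence μ ε ε₀ V (ENNReal.ofReal (4 + δ)))
    (hL : ∀ t, MemLp (V t) (ENNReal.ofReal (4 + δ)) μ) (h0 : ∀ t, ∫ x, V t x ∂μ = 0)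
    (hcov : ∀ t h : ℤ, crossCov μ (V (t + h)) (V t) = crossCov μ (V h) (V 0))
    {ℓ : ℝ} (hℓ : 1 ≤ ℓ)
    (hs : ∑' h : ℕ, ENNReal.ofReal ((h : ℝ) ^ ℓ) * depMeasure μ ε ε₀ V 2 (h : ℤ) ≠ ∞) :
    LagProcess (innov ε) μ V (fun h => ∫ x, hsTensor H (V h x) (V 0 x) ∂μ) (2 + δ / 2) ℓ
      (depFun μ ε ε₀ V (ENNReal.ofReal (4 + δ))) ∧
      ∀ ω, spectralDensity μ V ω =
        hsOp H (specHS (fun h => ∫ x, hsTensor H (V h x) (V 0 x) ∂μ) ω) := by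
  have h2 : ENNReal.ofReal 2 = 2 := by norm_num
  have hle : (2 : ℝ≥0∞) ≤ ENNReal.ofReal (4 + δ) := by
    rw [← h2]; exact ENNReal.ofReal_le_ofReal (by linarith)
  have hL2 : ∀ t, MemLp (V t) 2 μ := fun t => (hL t).mono_exponent hle
  have hdep : ∀ j : ℤ, depMeasure μ ε ε₀ V 2 j ≤ depMeasure μ ε ε₀ V (ENNReal.ofReal (4 + δ)) j := by
    intro j
    exact eLpNorm_le_eLpNorm_of_exponent_le hle
      ((hL2 j).1.sub integrable_condExp.1)
  have hs2 : ∑' j : ℕ, depMeasure μ ε ε₀ V 2 (j : ℤ) ≠ ∞ :=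
    ne_top_of_le_ne_top h.summable (ENNReal.tsum_le_tsum fun j => hdep j)
  have hS2 : ShortMemory (innov ε) μ V 2 (depFun μ ε ε₀ V 2) := by
    have := h.shortMemory (p := 2) one_le_two (by simpa only [h2] using hL2) h0
      (by simpa only [h2] using hs2)
    simpa only [h2] using this
  have hneg : ∀ t < 0, depFun μ ε ε₀ V 2 t = 0 := fun t ht => if_neg (not_le.2 ht)
  have hsl : Summable fun h : ℤ => |(h : ℝ)| ^ ℓ * depFun μ ε ε₀ V 2 h := by
    refine summable_int_of_nat (fun t ht => by rw [hneg t ht, mul_zero]) ?_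
    refine (ENNReal.summable_toReal hs).congr fun n => ?_
    rw [ENNReal.toReal_mul, ENNReal.toReal_ofReal (by positivity), depFun, if_pos (by omega)]
    simp
  obtain ⟨hc1, hc2⟩ := summable_rpow_mul_conv hS2.nonneg hneg (by linarith) hS2.summable hsl
  have hsum : Summable fun h : ℤ => |(h : ℝ)| ^ ℓ * ‖∫ x, hsTensor H (V h x) (V 0 x) ∂μ‖ := by
    refine Summable.of_nonneg_of_le (fun t => by positivity) (fun t => ?_)
      (hc2.mul_left ‖hsTensor H‖)
    calc _ ≤ |(t : ℝ)| ^ ℓ * (‖hsTensor H‖ * ∑' k : ℤ, depFun μ ε ε₀ V 2 (t - k) *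
            depFun μ ε ε₀ V 2 (-k)) :=
          mul_le_mul_of_nonneg_left (norm_integral_hsTensor_le hS2 hc1 t) (by positivity)
      _ = _ := by ring
  refine ⟨⟨?_, fun t => (h.measurable_process t).stronglyMeasurable, fun s t => ?_, hsum⟩,
    fun ω => ?_⟩
  · rw [show 2 * (2 + δ / 2) = 4 + δ by ring]
    exact h.shortMemory (by linarith) hL h0 h.summable
  · refine hsOp_injective ?_
    rw [hsOp_integral_hsTensor (hL2 s) (hL2 t), hsOp_integral_hsTensor (hL2 _) (hL2 0),
      ← hcov t (s - t), add_sub_cancel]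
  · have hsm := summable_exp_smul (summable_norm_of_rpow (by linarith) hsum) ω
    rw [specHS, map_smul, (hsOp H).map_tsum hsm, spectralDensity]
    simp_rw [map_smul, hsOp_integral_hsTensor (hL2 _) (hL2 0)]

end CausalLag

section Window

variable {w : ℝ → ℝ}

theorem exists_abs_window_sub_one_le (hb : ∃ C, ∀ x, |w x| ≤ C) {ℓ : ℝ} (hℓ : 0 < ℓ)
    (hO : (fun x => w x - 1) =O[𝓝 0] (fun x => |x| ^ ℓ)) :
    ∃ C, 0 ≤ C ∧ ∀ x, |w x - 1| ≤ C * |x| ^ ℓ := by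
  obtain ⟨Cw, hCw⟩ := hb
  obtain ⟨c, hc0, hc⟩ := hO.exists_pos
  rw [IsBigOWith, Metric.eventually_nhds_iff] at hc
  obtain ⟨r, hr, hc⟩ := hc
  have hCw0 : 0 ≤ Cw := (abs_nonneg _).trans (hCw 0)
  refine ⟨c + (Cw + 1) / r ^ ℓ, by positivity, fun x => ?_⟩
  have hx : 0 ≤ |x| ^ ℓ := by positivity
  rcases lt_or_ge |x| r with h | h
  · have := hc (y := x) (by simpa using h)
    rw [Real.norm_eq_abs, Real.norm_of_nonneg hx] at this
    refine this.trans ?_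
    have : 0 ≤ (Cw + 1) / r ^ ℓ := by positivity
    nlinarith
  · have h1 : |w x - 1| ≤ Cw + 1 := (abs_sub _ _).trans (by simpa using hCw x)
    have h2 : r ^ ℓ ≤ |x| ^ ℓ := Real.rpow_le_rpow hr.le h hℓ.le
    have h3 : (Cw + 1) ≤ (Cw + 1) / r ^ ℓ * |x| ^ ℓ := by
      rw [div_mul_eq_mul_div, le_div_iff₀ (by positivity)]
      gcongr
    nlinarith

theorem LagWindow.exists_sum_sq_le (hw : LagWindow w) :
    ∃ C, 0 ≤ C ∧ ∀ᶠ b in 𝓝[>] (0 : ℝ), ∀ (s T : ℕ),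
      ∑ t ∈ Finset.Icc 1 T, w (b * ((t : ℝ) - s)) ^ 2 ≤ C / b := by
  set c := ∫⁻ x, ENNReal.ofReal (w x ^ 2) with hc
  have hcf : c ≠ ∞ := hw.sq_integrable
  have h1 : ∀ᶠ b in 𝓝[>] (0 : ℝ),
      ENNReal.ofReal b * ∑' h : ℤ, ENNReal.ofReal (w (b * h) ^ 2) < c + 1 :=
    hw.riemann_sum.eventually_lt_const (ENNReal.lt_add_right hcf one_ne_zero)
  refine ⟨(c + 1).toReal, ENNReal.toReal_nonneg, ?_⟩
  filter_upwards [h1, self_mem_nhdsWithin] with b hb hb0 s T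
  have hb0 : 0 < b := hb0
  rw [le_div_iff₀ hb0, mul_comm]
  rw [← ENNReal.ofReal_le_iff_le_toReal (by simp [hcf]), ENNReal.ofReal_mul hb0.le,
    ENNReal.ofReal_sum_of_nonneg fun _ _ => sq_nonneg _]
  refine le_trans ?_ hb.le
  gcongr
  have hinj : Set.InjOn (fun t : ℕ => (t : ℤ) - s) (Finset.Icc 1 T) := by
    intro t _ t' _ h; simpa using h
  have : ∑ t ∈ Finset.Icc 1 T, ENNReal.ofReal (w (b * ((t : ℝ) - s)) ^ 2) =
      ∑ h ∈ (Finset.Icc 1 T).image (fun t : ℕ => (t : ℤ) - s), ENNReal.ofReal (w (b * h) ^ 2) := by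
    rw [Finset.sum_image hinj]
    push_cast
    rfl
  rw [this]
  exact ENNReal.sum_le_tsum _

end Window

section Bias

variable {Ω H : Type*} {mΩ : MeasurableSpace Ω} [NormedAddCommGroup H] [InnerProductSpace ℂ H]
  [CompleteSpace H]

/-- The unnormalized estimation error `∑_{s,t ≤ m} w̃_{s,t} (v_s ⊗ v_t) - m F`. -/
def lagForm (w : ℝ → ℝ) (b : ℝ) (C : ℤ → HSSpace H) (v : ℤ → H) (m : ℕ) (ω : ℝ) : HSSpace H :=
  quadForm (hsTensor H) (lagWeight w b ω) v m - (m : ℂ) • specHS C ω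

theorem card_filter_notMem_le (m : ℕ) (h : ℤ) :
    (((Finset.Icc 1 m).filter fun s : ℕ => h ∉ Finset.Icc ((s : ℤ) - m) (s - 1)).card : ℝ) ≤
      |(h : ℝ)| := by
  have key : ((Finset.Icc 1 m).filter fun s : ℕ => h ∉ Finset.Icc ((s : ℤ) - m) (s - 1)).card
      ≤ h.natAbs := by
    rcases le_total 0 h with h0 | h0
    · refine (Finset.card_le_card (t := Finset.Icc 1 h.natAbs) fun s hs => ?_).trans (by simp)
      simp only [Finset.mem_filter, Finset.mem_Icc] at hs ⊢
      omega
    · refine (Finset.card_le_card (t := Finset.Ioc (m - h.natAbs) m) fun s hs => ?_).trans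
        (by rw [Nat.card_Ioc]; omega)
      simp only [Finset.mem_filter, Finset.mem_Icc, Finset.mem_Ioc] at hs ⊢
      omega
  calc _ ≤ ((h.natAbs : ℕ) : ℝ) := by exact_mod_cast key
    _ = _ := by rw [Nat.cast_natAbs]; push_cast; rfl

theorem lagWeight_smul_sum_eq (w : ℝ → ℝ) (hev : ∀ x, w (-x) = w x) (b : ℝ) (C : ℤ → HSSpace H)
    (ω : ℝ) (s m : ℕ) :
    ∑ t ∈ Finset.Icc 1 m, lagWeight w b ω s t • C ((s : ℤ) - t) =
      ((2 * Real.pi : ℝ) : ℂ)⁻¹ • ∑ h ∈ Finset.Icc ((s : ℤ) - m) (s - 1),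
        (w (b * h) : ℂ) • Complex.exp (-(Complex.I * ω * h)) • C h := by
  have hI : Finset.Icc ((s : ℤ) - m) (s - 1) =
      (Finset.Icc 1 m).image (fun t : ℕ => (s : ℤ) - t) := by
    ext h
    simp only [Finset.mem_Icc, Finset.mem_image]
    constructor
    · intro hh; exact ⟨((s : ℤ) - h).toNat, by omega, by omega⟩
    · rintro ⟨t, ht, rfl⟩; omega
  rw [hI, Finset.sum_image (fun t _ t' _ h => by simpa using h), Finset.smul_sum]
  refine Finset.sum_congr rfl fun t _ => ?_
  rw [smul_smul, smul_smul, lagWeight]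
  congr 2
  · have : w (b * (((s : ℤ) - (t : ℤ) : ℤ) : ℝ)) = w (b * ((t : ℝ) - s)) := by
      rw [← hev]; congr 1; push_cast; ring
    rw [this]
  · congr 1
    push_cast; ring

theorem norm_sum_lagWeight_sub_le {w : ℝ → ℝ} (hev : ∀ x, w (-x) = w x) {Cw ℓ : ℝ} (hCw : 0 ≤ Cw)
    (hℓ : 1 ≤ ℓ) (hw : ∀ x, |w x - 1| ≤ Cw * |x| ^ ℓ) {b : ℝ} (hb : 0 ≤ b) {C : ℤ → HSSpace H}
    (hC : Summable fun h : ℤ => |(h : ℝ)| ^ ℓ * ‖C h‖) (ω : ℝ) (m : ℕ) :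
    ‖∑ s ∈ Finset.Icc 1 m, ∑ t ∈ Finset.Icc 1 m, lagWeight w b ω s t • C ((s : ℤ) - t)
      - (m : ℂ) • specHS C ω‖ ≤
      (∑' h : ℤ, |(h : ℝ)| ^ ℓ * ‖C h‖) * (1 + Cw * (m * b ^ ℓ)) := by
  set S := ∑' h : ℤ, |(h : ℝ)| ^ ℓ * ‖C h‖ with hS
  have hn := summable_norm_of_rpow (by linarith) hC
  have hg := summable_exp_smul hn ω
  set g : ℤ → HSSpace H := fun h => Complex.exp (-(Complex.I * ω * h)) • C h with hgdef
  have hgn : ∀ h, ‖g h‖ = ‖C h‖ := fun h => by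
    rw [hgdef]; simp only; rw [norm_smul, norm_exp_neg_I_mul_int, one_mul]
  have hpi : ‖((2 * Real.pi : ℝ) : ℂ)⁻¹‖ ≤ 1 := by
    rw [norm_inv, Complex.norm_real, Real.norm_of_nonneg (by positivity)]
    exact inv_le_one_of_one_le₀ (by nlinarith [Real.pi_gt_three])
  set I : ℕ → Finset ℤ := fun s => Finset.Icc ((s : ℤ) - m) (s - 1) with hI
  have hrow : ∀ s, ‖∑ h ∈ I s, (w (b * h) : ℂ) • g h - ∑' h, g h‖ ≤
      Cw * b ^ ℓ * S + ∑' h, (if h ∉ I s then ‖C h‖ else 0) := by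
    intro s
    have hsum : Summable fun h => if h ∉ I s then g h else 0 :=
      Summable.of_norm_bounded hn fun h => by split_ifs <;> simp [hgn]
    have hsumn : Summable fun h => if h ∉ I s then ‖C h‖ else 0 :=
      Summable.of_nonneg_of_le (fun h => by split_ifs <;> simp) (fun h => by split_ifs <;> simp) hn
    have e1 : ∑' h, g h = ∑ h ∈ I s, g h + ∑' h, (if h ∉ I s then g h else 0) := by
      have hI' : ∑ h ∈ I s, g h = ∑' h, (if h ∈ I s then g h else 0) := by
        rw [tsum_eq_sum (s := I s) fun h hh => if_neg hh]
        exact Finset.sum_congr rfl fun h hh => (if_pos hh).symm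
      rw [hI', ← Summable.tsum_add
        (summable_of_ne_finset_zero (s := I s) fun h hh => if_neg hh) hsum]
      refine tsum_congr fun h => ?_
      by_cases hh : h ∈ I s <;> simp [hh]
    rw [e1, ← sub_sub, ← Finset.sum_sub_distrib]
    refine (norm_sub_le _ _).trans (add_le_add ?_ ?_)
    · refine (norm_sum_le _ _).trans ?_
      calc ∑ h ∈ I s, ‖(w (b * h) : ℂ) • g h - g h‖
          ≤ ∑ h ∈ I s, Cw * b ^ ℓ * (|(h : ℝ)| ^ ℓ * ‖C h‖) := by
            refine Finset.sum_le_sum fun h _ => ?_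
            have e2 : (w (b * h) : ℂ) • g h - g h = ((w (b * h) - 1 : ℝ) : ℂ) • g h := by
              push_cast; rw [sub_smul, one_smul]
            rw [e2, norm_smul, hgn, Complex.norm_real, Real.norm_eq_abs]
            refine (mul_le_mul_of_nonneg_right (hw _) (norm_nonneg _)).trans (le_of_eq ?_)
            rw [abs_mul, abs_of_nonneg hb, Real.mul_rpow hb (abs_nonneg _)]
            ring
        _ ≤ Cw * b ^ ℓ * S := by
            rw [← Finset.mul_sum]
            exact mul_le_mul_of_nonneg_left
              (hC.sum_le_tsum _ fun h _ => by positivity) (by positivity)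
    · refine (norm_tsum_le_tsum_norm (hsumn.congr fun h => ?_)).trans (le_of_eq
        (tsum_congr fun h => ?_)) <;> split_ifs <;> simp [hgn]
  have e3 : ∑ s ∈ Finset.Icc 1 m, ∑ t ∈ Finset.Icc 1 m, lagWeight w b ω s t • C ((s : ℤ) - t)
      - (m : ℂ) • specHS C ω = ((2 * Real.pi : ℝ) : ℂ)⁻¹ • ∑ s ∈ Finset.Icc 1 m,
        (∑ h ∈ I s, (w (b * h) : ℂ) • g h - ∑' h, g h) := by
    simp_rw [lagWeight_smul_sum_eq w hev, Finset.sum_sub_distrib, smul_sub, ← Finset.smul_sum]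
    congr 1
    rw [specHS, smul_comm, Finset.sum_const, Nat.card_Icc, Nat.add_sub_cancel, Nat.cast_smul_eq_nsmul]
  rw [e3, norm_smul]
  refine (mul_le_of_le_one_left (norm_nonneg _) hpi).trans ((norm_sum_le _ _).trans
    ((Finset.sum_le_sum fun s _ => hrow s).trans ?_))
  rw [Finset.sum_add_distrib, Finset.sum_const, Nat.card_Icc, Nat.add_sub_cancel, nsmul_eq_mul]
  have hcount : ∑ s ∈ Finset.Icc 1 m, ∑' h, (if h ∉ I s then ‖C h‖ else 0) ≤ S := by
    rw [← Summable.tsum_finsetSum fun s _ => Summable.of_nonneg_of_le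
      (fun h => by split_ifs <;> simp) (fun h => by split_ifs <;> simp) hn]
    refine Summable.tsum_le_tsum (fun h => ?_) ?_ hC
    · rw [← Finset.sum_filter, Finset.sum_const, nsmul_eq_mul]
      refine mul_le_mul_of_nonneg_right ((card_filter_notMem_le m h).trans ?_) (norm_nonneg _)
      rcases eq_or_ne h 0 with rfl | h0
      · simp; positivity
      · refine Real.self_le_rpow_of_one_le ?_ hℓ
        exact_mod_cast Int.one_le_abs h0
    · exact summable_sum fun s _ => Summable.of_nonneg_of_le
        (fun h => by split_ifs <;> simp) (fun h => by split_ifs <;> simp) hn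
  nlinarith [hcount]

variable {μ : Measure Ω} [IsProbabilityMeasure μ] {M : ℤ → MeasurableSpace Ω} {V : ℤ → Ω → H}
  {C : ℤ → HSSpace H} {q ℓ : ℝ} {d : ℤ → ℝ}

theorem LagProcess.integral_quadForm (h : LagProcess M μ V C q ℓ d) (hq : 1 ≤ q) (a : ℕ → ℕ → ℂ)
    (m : ℕ) :
    ∫ x, quadForm (hsTensor H) a (fun t => V t x) m ∂μ =
      ∑ s ∈ Finset.Icc 1 m, ∑ t ∈ Finset.Icc 1 m, a s t • C ((s : ℤ) - t) := by
  have h1q : 1 ≤ ENNReal.ofReal q := by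
    rw [← ENNReal.ofReal_one]; exact ENNReal.ofReal_le_ofReal hq
  have hi : ∀ s t : ℕ, Integrable (fun x => a s t • hsTensor H (V s x) (V t x)) μ := fun s t =>
    ((isTensor_hsTensor.memLp (h.short.memLp s) (h.short.memLp t)).const_smul (a s t)).integrable h1q
  simp only [quadForm]
  rw [integral_finsetSum _ fun s _ => integrable_finsetSum _ fun t _ => hi s t]
  refine Finset.sum_congr rfl fun s _ => ?_
  rw [integral_finsetSum _ fun t _ => hi s t]
  refine Finset.sum_congr rfl fun t _ => ?_
  rw [integral_smul, h.cov]

end Bias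

section LagRate

/-- The consequences of the window and bandwidth conditions used below. -/
structure LagRate (w : ℝ → ℝ) (b : ℕ → ℝ) (ℓ : ℝ) : Prop where
  one_le : 1 ≤ ℓ
  even : ∀ x, w (-x) = w x
  bounded : ∃ C, ∀ x, |w x| ≤ C
  order : ∃ C, 0 ≤ C ∧ ∀ x, |w x - 1| ≤ C * |x| ^ ℓ
  sum_sq : ∃ C, 0 ≤ C ∧ ∀ᶠ T in atTop, ∀ s m : ℕ,
    ∑ t ∈ Finset.Icc 1 m, w (b T * ((t : ℝ) - s)) ^ 2 ≤ C / b T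
  pos : ∀ᶠ T : ℕ in atTop, 0 < b T ∧ 0 < T
  tendsto_zero : Tendsto b atTop (𝓝 0)
  tendsto_mul : Tendsto (fun T : ℕ => b T * T) atTop atTop
  tendsto_bias : Tendsto (fun T : ℕ => b T ^ (1 + 2 * ℓ) * T) atTop (𝓝 0)

theorem BandwidthCondition.lagRate {Ω S H : Type*} [MeasurableSpace Ω] [MeasurableSpace S]
    [NormedAddCommGroup H] [InnerProductSpace ℂ H] [CompleteSpace H]
    {μ : Measure Ω} {ε : ℤ → Ω → S} {ε₀ : Ω → S} {V : ℤ → Ω → H}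
    {w : ℝ → ℝ} {b : ℕ → ℝ} {ℓ : ℝ} (h : BandwidthCondition μ ε ε₀ V w b ℓ) (hw : LagWindow w) :
    LagRate w b ℓ := by
  have hpos : ∀ᶠ T : ℕ in atTop, 0 < b T ∧ 0 < T := by
    filter_upwards [h.tendsto_mul.eventually_gt_atTop 0, eventually_gt_atTop 0] with T hT hT0
    exact ⟨pos_of_mul_pos_left hT (Nat.cast_nonneg T), hT0⟩
  refine ⟨h.one_le, hw.even, hw.bounded, exists_abs_window_sub_one_le hw.bounded
    (by linarith [h.one_le]) h.window_order, ?_, hpos, h.tendsto_zero, h.tendsto_mul,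
    h.tendsto_bias⟩
  obtain ⟨C, hC0, hC⟩ := hw.exists_sum_sq_le
  refine ⟨C, hC0, ?_⟩
  have : Tendsto b atTop (𝓝[>] 0) :=
    tendsto_nhdsWithin_iff.2 ⟨h.tendsto_zero, hpos.mono fun T hT => hT.1⟩
  exact (this.eventually hC).mono fun T hT s m => hT s m

variable {w : ℝ → ℝ} {b : ℕ → ℝ} {ℓ : ℝ}

theorem LagRate.tendsto_bias_bound (h : LagRate w b ℓ) (S C : ℝ) :
    Tendsto (fun T : ℕ => Real.sqrt (b T / T) * (S * (1 + C * (T * b T ^ ℓ)))) atTop (𝓝 0) := by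
  have h1 : Tendsto (fun T : ℕ => Real.sqrt (b T / T)) atTop (𝓝 0) := by
    have : Tendsto (fun T : ℕ => b T / T) atTop (𝓝 0) := by
      simpa [div_eq_mul_inv] using h.tendsto_zero.mul
        (tendsto_inv_atTop_nhds_zero_nat (𝕜 := ℝ))
    simpa using this.sqrt
  have h2 : Tendsto (fun T : ℕ => Real.sqrt (b T ^ (1 + 2 * ℓ) * T)) atTop (𝓝 0) := by
    simpa using h.tendsto_bias.sqrt
  have h3 : Tendsto (fun T : ℕ => S * Real.sqrt (b T / T) +
      S * C * Real.sqrt (b T ^ (1 + 2 * ℓ) * T)) atTop (𝓝 0) := by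
    simpa using (h1.const_mul S).add (h2.const_mul (S * C))
  refine h3.congr' ?_
  filter_upwards [h.pos] with T hT
  have hT0 : (0 : ℝ) < T := by exact_mod_cast hT.2
  have e : Real.sqrt (b T ^ (1 + 2 * ℓ) * T) = Real.sqrt (b T / T) * (T * b T ^ ℓ) := by
    rw [← Real.sqrt_sq (by have := hT.1; positivity : 0 ≤ (T : ℝ) * b T ^ ℓ),
      ← Real.sqrt_mul (by have := hT.1; positivity)]
    congr 1
    rw [Real.rpow_add hT.1, Real.rpow_one, mul_comm 2 ℓ, Real.rpow_mul hT.1.le, mul_pow,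
      Real.rpow_two]
    field_simp
  rw [e]; ring

end LagRate

section LagWeights

theorem norm_lagWeight_le (w : ℝ → ℝ) (b ω : ℝ) (s t : ℕ) :
    ‖lagWeight w b ω s t‖ ≤ |w (b * ((t : ℝ) - s))| := by
  have h1 : ‖Complex.exp (Complex.I * ω * ((t : ℂ) - s))‖ = 1 := by
    rw [Complex.norm_exp]; simp
  rw [lagWeight, norm_mul, norm_mul, h1, mul_one, Complex.norm_real, Real.norm_eq_abs, norm_inv,
    Complex.norm_real, Real.norm_of_nonneg (by positivity)]
  exact mul_le_of_le_one_left (abs_nonneg _)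
    (inv_le_one_of_one_le₀ (by nlinarith [Real.pi_gt_three]))

theorem continuous_lagWeight (w : ℝ → ℝ) (b : ℝ) (s t : ℕ) :
    Continuous fun ω : ℝ => lagWeight w b ω s t := by
  unfold lagWeight
  fun_prop

variable {H : Type*} [NormedAddCommGroup H] [InnerProductSpace ℂ H] [CompleteSpace H]

theorem continuous_lagForm (w : ℝ → ℝ) (b : ℝ) {C : ℤ → HSSpace H} (hC : Summable fun h => ‖C h‖)
    (v : ℤ → H) (m : ℕ) : Continuous (lagForm w b C v m) := by
  have h1 : Continuous fun ω => quadForm (hsTensor H) (lagWeight w b ω) v m := by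
    unfold quadForm
    exact continuous_finsetSum _ fun s _ => continuous_finsetSum _ fun t _ =>
      (continuous_lagWeight w b s t).smul continuous_const
  exact h1.sub (Continuous.const_smul (continuous_specHS hC) (m : ℂ))

theorem exists_norm_lagForm_le (w : ℝ → ℝ) (b : ℝ) {C : ℤ → HSSpace H}
    (hC : Summable fun h => ‖C h‖) (v : ℤ → H) (m : ℕ) :
    ∃ c, ∀ ω, ‖lagForm w b C v m ω‖ ≤ c := by
  refine ⟨∑ s ∈ Finset.Icc 1 m, ∑ t ∈ Finset.Icc 1 m,
    |w (b * ((t : ℝ) - s))| * ‖hsTensor H (v s) (v t)‖ +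
      ‖(m : ℂ)‖ * (‖((2 * Real.pi : ℝ) : ℂ)⁻¹‖ * ∑' h, ‖C h‖), fun ω => ?_⟩
  refine (norm_sub_le _ _).trans (add_le_add ?_ ?_)
  · refine (norm_sum_le _ _).trans (Finset.sum_le_sum fun s _ => (norm_sum_le _ _).trans
      (Finset.sum_le_sum fun t _ => ?_))
    rw [norm_smul]
    exact mul_le_mul_of_nonneg_right (norm_lagWeight_le _ _ _ _ _) (norm_nonneg _)
  · rw [norm_smul, specHS, norm_smul]
    gcongr
    refine (norm_tsum_le_tsum_norm (hC.congr fun h => ?_)).trans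
      (le_of_eq (tsum_congr fun h => ?_)) <;> rw [norm_smul, norm_exp_neg_I_mul_int, one_mul]

theorem sum_norm_lagWeight_sq_le {w : ℝ → ℝ} (hev : ∀ x, w (-x) = w x) {b A : ℝ}
    (hA : ∀ s m : ℕ, ∑ t ∈ Finset.Icc 1 m, w (b * ((t : ℝ) - s)) ^ 2 ≤ A) (ω : ℝ) (T : ℕ) :
    (∀ s, ∑ t ∈ Finset.Icc 1 T, ‖lagWeight w b ω s t‖ ^ 2 ≤ A) ∧
      ∀ t, ∑ s ∈ Finset.Icc 1 T, ‖lagWeight w b ω s t‖ ^ 2 ≤ A := by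
  have hle : ∀ s t : ℕ, ‖lagWeight w b ω s t‖ ^ 2 ≤ w (b * ((t : ℝ) - s)) ^ 2 := fun s t => by
    rw [← sq_abs (w _)]
    exact pow_le_pow_left₀ (norm_nonneg _) (norm_lagWeight_le _ _ _ _ _) 2
  refine ⟨fun s => (Finset.sum_le_sum fun t _ => hle s t).trans (hA s T), fun t => ?_⟩
  refine (Finset.sum_le_sum fun s _ => hle s t).trans (le_trans (le_of_eq ?_) (hA t T))
  refine Finset.sum_congr rfl fun s _ => ?_
  rw [← hev]
  congr 2
  ring

/-- Bessel's inequality for indicator functions on a subinterval of `[0, π]`. -/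
theorem sum_norm_integral_exp_sq_le {α β : ℝ} (hα : 0 ≤ α) (hβ : β ≤ Real.pi) {E : Set ℝ}
    (hE : MeasurableSet E) (S : Finset ℤ) :
    ∑ h ∈ S, ‖((2 * Real.pi : ℝ) : ℂ)⁻¹ *
      ∫ ω in E, Complex.exp (Complex.I * ω * h) ∂(volume.restrict (Set.Icc α β))‖ ^ 2 ≤ 1 := by
  classical
  have hpi := Real.pi_pos
  have h2 : (0 : ℝ) < 2 * Real.pi := by positivity
  set f : ℝ → ℂ := (E ∩ Set.Icc α β).indicator fun _ => 1 with hf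
  have hEm : MeasurableSet (E ∩ Set.Icc α β) := hE.inter measurableSet_Icc
  have hfb : ∀ x, ‖f x‖ ≤ 1 := fun x => by
    rw [hf, Set.indicator_apply]; split_ifs <;> simp
  have hfm : AEStronglyMeasurable f (volume.restrict (Set.Ioc 0 (2 * Real.pi))) :=
    (stronglyMeasurable_const.indicator hEm).aestronglyMeasurable
  have hL2 : MemLp f 2 (volume.restrict (Set.Ioc 0 (2 * Real.pi))) :=
    MemLp.of_bound hfm 1 (ae_of_all _ hfb)
  have hsum := hasSum_sq_fourierCoeffOn h2 hL2
  have hle : ((2 * Real.pi - 0)⁻¹ • ∫ x in (0 : ℝ)..(2 * Real.pi), ‖f x‖ ^ 2) ≤ 1 := by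
    have : ∫ x in (0 : ℝ)..(2 * Real.pi), ‖f x‖ ^ 2 ≤ ∫ x in (0 : ℝ)..(2 * Real.pi), (1 : ℝ) := by
      refine intervalIntegral.integral_mono_on h2.le ?_ intervalIntegrable_const fun x _ => ?_
      · rw [intervalIntegrable_iff_integrableOn_Ioc_of_le h2.le]
        exact hL2.integrable_norm_pow two_ne_zero
      · exact pow_le_one₀ (norm_nonneg _) (hfb x)
    rw [intervalIntegral.integral_const, smul_eq_mul, mul_one] at this
    rw [smul_eq_mul, inv_mul_le_iff₀ (by linarith), mul_one]
    exact this
  have hcoef : ∀ h : ℤ, fourierCoeffOn h2 f (-h) = ((2 * Real.pi : ℝ) : ℂ)⁻¹ *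
      ∫ ω in E, Complex.exp (Complex.I * ω * h) ∂(volume.restrict (Set.Icc α β)) := by
    intro h
    rw [fourierCoeffOn_eq_integral, neg_neg, intervalIntegral.integral_of_le h2.le,
      Measure.restrict_restrict hE, ← integral_Icc_eq_integral_Ioc]
    have e : ∀ x : ℝ, fourier h (x : AddCircle (2 * Real.pi - 0)) • f x =
        (E ∩ Set.Icc α β).indicator (fun ω : ℝ => Complex.exp (Complex.I * ω * h)) x := by
      intro x
      rw [hf, Set.indicator_apply, Set.indicator_apply]
      split_ifs
      · rw [fourier_coe_apply, smul_eq_mul, mul_one]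
        congr 1
        have : (Real.pi : ℂ) ≠ 0 := by exact_mod_cast hpi.ne'
        push_cast
        rw [sub_zero]
        field_simp
      · simp
    simp_rw [e]
    rw [integral_indicator hEm, Measure.restrict_restrict hEm, Set.inter_eq_left.2]
    · rw [sub_zero, Complex.real_smul]; push_cast; rw [one_div]
    · intro x hx
      exact ⟨hα.trans hx.2.1, hx.2.2.trans (by linarith)⟩
  have hinj : Set.InjOn (fun h : ℤ => -h) S := fun _ _ _ _ h => neg_injective h
  calc _ = ∑ h ∈ S.image fun h => -h, ‖fourierCoeffOn h2 f h‖ ^ 2 := by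
        rw [Finset.sum_image hinj]
        exact Finset.sum_congr rfl fun h _ => by rw [hcoef]
    _ ≤ _ := (sum_le_hasSum _ (fun _ _ => by positivity) hsum).trans hle

theorem sum_norm_integral_lagWeight_sq_le {w : ℝ → ℝ} {Cw : ℝ} (hw : ∀ x, |w x| ≤ Cw) (b : ℝ)
    {α β : ℝ} (hα : 0 ≤ α) (hβ : β ≤ Real.pi) {E : Set ℝ} (hE : MeasurableSet E) (T : ℕ) :
    (∀ s, ∑ t ∈ Finset.Icc 1 T,
      ‖∫ ω in E, lagWeight w b ω s t ∂(volume.restrict (Set.Icc α β))‖ ^ 2 ≤ Cw ^ 2) ∧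
    ∀ t, ∑ s ∈ Finset.Icc 1 T,
      ‖∫ ω in E, lagWeight w b ω s t ∂(volume.restrict (Set.Icc α β))‖ ^ 2 ≤ Cw ^ 2 := by
  set G : ℤ → ℂ := fun h => ((2 * Real.pi : ℝ) : ℂ)⁻¹ *
      ∫ ω in E, Complex.exp (Complex.I * ω * h) ∂(volume.restrict (Set.Icc α β)) with hG
  have hle : ∀ s t : ℕ, ‖∫ ω in E, lagWeight w b ω s t ∂(volume.restrict (Set.Icc α β))‖ ^ 2 ≤
      Cw ^ 2 * ‖G ((t : ℤ) - s)‖ ^ 2 := by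
    intro s t
    have : ∫ ω in E, lagWeight w b ω s t ∂(volume.restrict (Set.Icc α β)) =
        (w (b * ((t : ℝ) - s)) : ℂ) * G ((t : ℤ) - s) := by
      simp only [lagWeight, hG]
      rw [integral_const_mul]
      push_cast
      ring
    rw [this, norm_mul, mul_pow, Complex.norm_real, Real.norm_eq_abs]
    gcongr
    exact hw _
  have key : ∀ g : ℕ → ℤ, Function.Injective g →
      ∑ t ∈ Finset.Icc 1 T, Cw ^ 2 * ‖G (g t)‖ ^ 2 ≤ Cw ^ 2 := by
    intro g hg
    rw [← Finset.mul_sum]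
    refine mul_le_of_le_one_right (sq_nonneg _) ?_
    rw [← Finset.sum_image (f := fun h => ‖G h‖ ^ 2) hg.injOn]
    exact sum_norm_integral_exp_sq_le hα hβ hE _
  exact ⟨fun s => (Finset.sum_le_sum fun t _ => hle s t).trans
      (key (fun t => (t : ℤ) - s) fun t t' h => by simpa using h),
    fun t => (Finset.sum_le_sum fun s _ => hle s t).trans
      (key (fun s => (t : ℤ) - s) fun s s' h => by simpa using h)⟩

end LagWeights

section UniformBounds

variable {Ω H : Type*} {mΩ : MeasurableSpace Ω} [NormedAddCommGroup H] [InnerProductSpace ℂ H]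
  [CompleteSpace H] {μ : Measure Ω} [IsProbabilityMeasure μ] {M : ℤ → MeasurableSpace Ω}
  {V : ℤ → Ω → H} {C : ℤ → HSSpace H} {q ℓ : ℝ} {d : ℤ → ℝ} {w : ℝ → ℝ} {b : ℕ → ℝ}

theorem ENNReal.add_sq_le_four_mul (x y : ℝ≥0∞) : (x + y) ^ 2 ≤ 4 * (x ^ 2 + y ^ 2) := by
  rcases le_total x y with h | h
  · calc (x + y) ^ 2 ≤ (y + y) ^ 2 := by gcongr
      _ = 4 * y ^ 2 := by ring
      _ ≤ _ := by gcongr; exact le_add_self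
  · calc (x + y) ^ 2 ≤ (x + x) ^ 2 := by gcongr
      _ = 4 * x ^ 2 := by ring
      _ ≤ _ := by gcongr; exact le_self_add

theorem LagProcess.summable_norm (h : LagProcess M μ V C q ℓ d) (hℓ : 0 ≤ ℓ) :
    Summable fun h => ‖C h‖ := summable_norm_of_rpow hℓ h.summable_cov

/-- The mean of the quadratic form with lag weights. -/
def meanForm (w : ℝ → ℝ) (b : ℝ) (C : ℤ → HSSpace H) (m : ℕ) (ω : ℝ) : HSSpace H :=
  ∑ s ∈ Finset.Icc 1 m, ∑ t ∈ Finset.Icc 1 m, lagWeight w b ω s t • C ((s : ℤ) - t)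

theorem continuous_meanForm (w : ℝ → ℝ) (b : ℝ) (C : ℤ → HSSpace H) (m : ℕ) :
    Continuous (meanForm w b C m) :=
  continuous_finsetSum _ fun s _ => continuous_finsetSum _ fun t _ =>
    (continuous_lagWeight w b s t).smul continuous_const

theorem norm_meanForm_sub_le (hr : LagRate w b ℓ)
    (hC : Summable fun h : ℤ => |(h : ℝ)| ^ ℓ * ‖C h‖) :
    ∃ c, 0 ≤ c ∧ ∀ᶠ T in atTop, ∀ m ≤ T, ∀ ω,
      ‖meanForm w (b T) C m ω - (m : ℂ) • specHS C ω‖ ≤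
        (∑' h : ℤ, |(h : ℝ)| ^ ℓ * ‖C h‖) * (1 + c * (T * b T ^ ℓ)) := by
  obtain ⟨c, hc0, hc⟩ := hr.order
  refine ⟨c, hc0, ?_⟩
  filter_upwards [hr.pos] with T hT m hm ω
  refine (norm_sum_lagWeight_sub_le hr.even hc0 hr.one_le hc hT.1.le hC ω m).trans ?_
  have : (m : ℝ) ≤ T := by exact_mod_cast hm
  have h2 : 0 ≤ b T ^ ℓ := Real.rpow_nonneg hT.1.le _
  have h3 : 0 ≤ ∑' h : ℤ, |(h : ℝ)| ^ ℓ * ‖C h‖ := tsum_nonneg fun h => by positivity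
  gcongr

theorem LagProcess.stronglyMeasurable_quadForm (h : LagProcess M μ V C q ℓ d) (w : ℝ → ℝ) (b : ℝ)
    (m : ℕ) : StronglyMeasurable fun p : Ω × ℝ =>
      quadForm (hsTensor H) (lagWeight w b p.2) (fun t => V t p.1) m := by
  unfold quadForm
  refine Finset.stronglyMeasurable_fun_sum _ fun s _ =>
    Finset.stronglyMeasurable_fun_sum _ fun t _ => ?_
  have h1 : StronglyMeasurable fun p : Ω × ℝ => lagWeight w b p.2 s t :=
    ((continuous_lagWeight w b s t).stronglyMeasurable).comp_measurable measurable_snd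
  have h2 : StronglyMeasurable fun p : Ω × ℝ => hsTensor H (V s p.1) (V t p.1) :=
    (hsTensor H).continuous₂.comp_stronglyMeasurable
      (((h.meas s).comp_measurable measurable_fst).prodMk
        ((h.meas t).comp_measurable measurable_fst))
  exact h1.smul h2

/-- The integrated squared estimation error is of order `T / b`, uniformly over partial samples. -/
theorem LagProcess.exists_lintegral_sq_le (h : LagProcess M μ V C q ℓ d) (hq : 2 < q)
    (hr : LagRate w b ℓ) (ν : Measure ℝ) [IsFiniteMeasure ν] :
    ∃ c : ℝ≥0∞, c ≠ ∞ ∧ ∀ᶠ T in atTop, ∃ Y : Ω → ℝ≥0∞, AEMeasurable Y μ ∧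
      (∀ m ≤ T, ∀ x, ∫⁻ ω, (ENNReal.ofReal (Real.sqrt (b T / T)) *
        ‖lagForm w (b T) C (fun t => V t x) m ω‖ₑ) ^ 2 ∂ν ≤ Y x) ∧ ∫⁻ x, Y x ∂μ ≤ c := by
  obtain ⟨A, hA0, hA⟩ := hr.sum_sq
  obtain ⟨cb, hcb0, hcb⟩ := norm_meanForm_sub_le hr h.summable_cov
  set S := ∑' h : ℤ, |(h : ℝ)| ^ ℓ * ‖C h‖ with hS
  refine ⟨4 * (ENNReal.ofReal (quadConst q d * A) + 1) * ν Set.univ, by finiteness, ?_⟩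
  have hb1 := (hr.tendsto_bias_bound S cb).eventually_le_const zero_lt_one
  filter_upwards [hA, hcb, hb1, hr.pos] with T hA hcb hb1 hT
  obtain ⟨hbT, hT0⟩ := hT
  set κ := ENNReal.ofReal (Real.sqrt (b T / T)) with hκ
  have hT0' : (0 : ℝ) < T := by exact_mod_cast hT0
  have hκ2 : κ ^ 2 = ENNReal.ofReal (b T / T) := by
    rw [hκ, ← ENNReal.ofReal_pow (Real.sqrt_nonneg _), Real.sq_sqrt (by positivity)]
  have hqm : ∀ m ω, ∫ x, quadForm (hsTensor H) (lagWeight w (b T) ω) (fun t => V t x) m ∂μ =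
      meanForm w (b T) C m ω := fun m ω => h.integral_quadForm (by linarith) _ m
  set G : Ω × ℝ → ℝ≥0∞ := fun p => ⨆ m : Fin (T + 1),
    ‖quadForm (hsTensor H) (lagWeight w (b T) p.2) (fun t => V t p.1) m
      - meanForm w (b T) C m p.2‖ₑ ^ 2 with hG
  have hGm : Measurable G := by
    refine Measurable.iSup fun m => Measurable.pow_const ?_ 2
    exact ((h.stronglyMeasurable_quadForm w (b T) m).sub
      ((continuous_meanForm w (b T) C m).stronglyMeasurable.comp_measurable measurable_snd)).enorm
  have hGi : ∀ ω, ∫⁻ x, G (x, ω) ∂μ ≤ ENNReal.ofReal (quadConst q d * (A / b T) * T) := by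
    intro ω
    obtain ⟨hrow, hcol⟩ := sum_norm_lagWeight_sq_le hr.even hA ω T
    obtain ⟨Y, -, hY, hYi⟩ := h.short.exists_dominating_quadForm hq isTensor_hsTensor hT0
      (by positivity) hrow hcol
    refine (lintegral_mono fun x => iSup_le fun m => ?_).trans hYi
    have := hY m (Nat.lt_succ_iff.1 m.2) x
    rw [hqm] at this
    exact pow_le_pow_left' this 2
  refine ⟨fun x => ∫⁻ ω, 4 * (κ ^ 2 * G (x, ω) + 1) ∂ν, ?_, fun m hm x => ?_, ?_⟩
  · exact (Measurable.lintegral_prod_right' (f := fun p => 4 * (κ ^ 2 * G p + 1))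
      (((hGm.const_mul _).add_const _).const_mul _)).aemeasurable
  · refine lintegral_mono fun ω => ?_
    have e : lagForm w (b T) C (fun t => V t x) m ω =
        (quadForm (hsTensor H) (lagWeight w (b T) ω) (fun t => V t x) m - meanForm w (b T) C m ω) +
          (meanForm w (b T) C m ω - (m : ℂ) • specHS C ω) := by
      rw [lagForm]; abel
    have hbias : κ * ‖meanForm w (b T) C m ω - (m : ℂ) • specHS C ω‖ₑ ≤ 1 := by
      rw [hκ, ← ofReal_norm, ← ENNReal.ofReal_mul (Real.sqrt_nonneg _), ← ENNReal.ofReal_one]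
      exact ENNReal.ofReal_le_ofReal ((mul_le_mul_of_nonneg_left (hcb m hm ω)
        (Real.sqrt_nonneg _)).trans hb1)
    rw [e]
    calc _ ≤ (κ * ‖quadForm (hsTensor H) (lagWeight w (b T) ω) (fun t => V t x) m
              - meanForm w (b T) C m ω‖ₑ +
            κ * ‖meanForm w (b T) C m ω - (m : ℂ) • specHS C ω‖ₑ) ^ 2 := by
          rw [← mul_add]
          gcongr
          exact enorm_add_le _ _
      _ ≤ _ := by
          refine (ENNReal.add_sq_le_four_mul _ _).trans ?_
          gcongr
          · rw [mul_pow]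
            gcongr
            exact le_iSup (fun m : Fin (T + 1) =>
              ‖quadForm (hsTensor H) (lagWeight w (b T) ω) (fun t => V t x) m
                - meanForm w (b T) C m ω‖ₑ ^ 2) ⟨m, Nat.lt_succ_of_le hm⟩
          · exact pow_le_one' hbias 2
  · rw [lintegral_lintegral_swap]
    · calc _ ≤ ∫⁻ _, 4 * (ENNReal.ofReal (quadConst q d * A) + 1) ∂ν := by
            refine lintegral_mono fun ω => ?_
            have hGω : Measurable fun x => G (x, ω) := hGm.comp measurable_prodMk_right
            rw [lintegral_const_mul _ ((hGω.const_mul _).add_const _),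
              lintegral_add_right _ measurable_const, lintegral_const_mul _ hGω]
            simp only [lintegral_const, measure_univ, mul_one]
            gcongr
            refine (mul_le_mul_right (hGi ω) _).trans (le_of_eq ?_)
            rw [hκ2, ← ENNReal.ofReal_mul (by positivity)]
            congr 1
            field_simp
        _ = _ := lintegral_const _
    · exact (((hGm.const_mul _).add_const _).const_mul _).aemeasurable

theorem integral_lagForm_eq {v : ℤ → H} (hC : Summable fun h => ‖C h‖) (w : ℝ → ℝ) (b : ℝ) (m : ℕ)
    (ν : Measure ℝ) [IsFiniteMeasure ν] :
    ∫ ω, lagForm w b C v m ω ∂ν =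
      (quadForm (hsTensor H) (fun s t => ∫ ω, lagWeight w b ω s t ∂ν) v m -
        ∑ s ∈ Finset.Icc 1 m, ∑ t ∈ Finset.Icc 1 m,
          (∫ ω, lagWeight w b ω s t ∂ν) • C ((s : ℤ) - t)) +
      ∫ ω, (meanForm w b C m ω - (m : ℂ) • specHS C ω) ∂ν := by
  have hi : ∀ s t, Integrable (fun ω => lagWeight w b ω s t) ν := fun s t =>
    Integrable.of_bound (continuous_lagWeight w b s t).aestronglyMeasurable _
      (ae_of_all _ fun ω => norm_lagWeight_le w b ω s t)
  have hsum : ∀ k : ℕ → ℕ → HSSpace H,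
      ∫ ω, ∑ s ∈ Finset.Icc 1 m, ∑ t ∈ Finset.Icc 1 m, lagWeight w b ω s t • k s t ∂ν =
        ∑ s ∈ Finset.Icc 1 m, ∑ t ∈ Finset.Icc 1 m, (∫ ω, lagWeight w b ω s t ∂ν) • k s t := by
    intro k
    rw [integral_finsetSum _ fun s _ => integrable_finsetSum _ fun t _ => (hi s t).smul_const _]
    refine Finset.sum_congr rfl fun s _ => ?_
    rw [integral_finsetSum _ fun t _ => (hi s t).smul_const _]
    exact Finset.sum_congr rfl fun t _ => integral_smul_const _ _
  have hqi : Integrable (fun ω => quadForm (hsTensor H) (lagWeight w b ω) v m) ν :=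
    integrable_finsetSum _ fun s _ => integrable_finsetSum _ fun t _ => (hi s t).smul_const _
  have hmi : Integrable (fun ω => meanForm w b C m ω) ν :=
    integrable_finsetSum _ fun s _ => integrable_finsetSum _ fun t _ => (hi s t).smul_const _
  have hFi : Integrable (fun ω => (m : ℂ) • specHS C ω) ν := by
    refine Integrable.of_bound (Continuous.const_smul (continuous_specHS hC)
      (m : ℂ)).aestronglyMeasurable (‖(m : ℂ)‖ * (‖((2 * Real.pi : ℝ) : ℂ)⁻¹‖ * ∑' h, ‖C h‖))
      (ae_of_all _ fun ω => ?_)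
    rw [norm_smul, specHS, norm_smul]
    gcongr
    refine (norm_tsum_le_tsum_norm (hC.congr fun h => ?_)).trans
      (le_of_eq (tsum_congr fun h => ?_)) <;> rw [norm_smul, norm_exp_neg_I_mul_int, one_mul]
  have h1 : ∫ ω, quadForm (hsTensor H) (lagWeight w b ω) v m ∂ν =
      quadForm (hsTensor H) (fun s t => ∫ ω, lagWeight w b ω s t ∂ν) v m :=
    hsum fun s t => hsTensor H (v s) (v t)
  have h2 : ∫ ω, meanForm w b C m ω ∂ν = ∑ s ∈ Finset.Icc 1 m, ∑ t ∈ Finset.Icc 1 m,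
      (∫ ω, lagWeight w b ω s t ∂ν) • C ((s : ℤ) - t) := hsum fun s t => C ((s : ℤ) - t)
  simp only [lagForm]
  rw [integral_sub hqi hFi, integral_sub hmi hFi, h1, h2]
  abel

/-- Integration over a set of frequencies gains a factor `√b`. -/
theorem LagProcess.exists_setIntegral_le (h : LagProcess M μ V C q ℓ d) (hq : 2 < q)
    (hr : LagRate w b ℓ) {α β : ℝ} (hα : 0 ≤ α) (hβ : β ≤ Real.pi) {E : Set ℝ}
    (hE : MeasurableSet E) {e : ℝ≥0∞} (he : e ≠ 0) :
    ∀ᶠ T in atTop, ∃ Y : Ω → ℝ≥0∞, AEMeasurable Y μ ∧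
      (∀ m ≤ T, ∀ x, ENNReal.ofReal (Real.sqrt (b T / T)) *
        ‖∫ ω in E, lagForm w (b T) C (fun t => V t x) m ω ∂(volume.restrict (Set.Icc α β))‖ₑ ≤ Y x) ∧
      ∫⁻ x, Y x ∂μ ≤ e := by
  obtain ⟨Cw, hCw⟩ := hr.bounded
  obtain ⟨cb, hcb0, hcb⟩ := norm_meanForm_sub_le hr h.summable_cov
  set S := ∑' h : ℤ, |(h : ℝ)| ^ ℓ * ‖C h‖ with hS
  set ν := (volume.restrict (Set.Icc α β)).restrict E with hν
  have hc := h.summable_norm (by linarith [hr.one_le])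
  set D := quadConst q d * Cw ^ 2 with hD
  have ht1 : Tendsto (fun T => (ENNReal.ofReal (D * b T)) ^ (1 / 2 : ℝ)) atTop (𝓝 0) := by
    have := (ENNReal.tendsto_ofReal (hr.tendsto_zero.const_mul D)).ennrpow_const (1 / 2 : ℝ)
    simpa using this
  have ht2 : Tendsto (fun T : ℕ => ENNReal.ofReal (Real.sqrt (b T / T) *
      (S * (1 + cb * (T * b T ^ ℓ)))) * ν Set.univ) atTop (𝓝 0) := by
    have := ENNReal.Tendsto.mul_const (ENNReal.tendsto_ofReal (hr.tendsto_bias_bound S cb))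
      (Or.inr (measure_ne_top ν Set.univ))
    simpa using this
  have ht : Tendsto (fun T : ℕ => (ENNReal.ofReal (D * b T)) ^ (1 / 2 : ℝ) +
      ENNReal.ofReal (Real.sqrt (b T / T) * (S * (1 + cb * (T * b T ^ ℓ)))) * ν Set.univ)
      atTop (𝓝 0) := by simpa using ht1.add ht2
  filter_upwards [hcb, hr.pos, ht.eventually_le_const (pos_iff_ne_zero.2 he)] with T hcb hT hle
  obtain ⟨hbT, hT0⟩ := hT
  have hT0' : (0 : ℝ) < T := by exact_mod_cast hT0
  set κ := ENNReal.ofReal (Real.sqrt (b T / T)) with hκ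
  have hκ2 : κ ^ 2 = ENNReal.ofReal (b T / T) := by
    rw [hκ, ← ENNReal.ofReal_pow (Real.sqrt_nonneg _), Real.sq_sqrt (by positivity)]
  obtain ⟨hrow, hcol⟩ := sum_norm_integral_lagWeight_sq_le hCw (b T) hα hβ hE T
  obtain ⟨Y, hYm, hY, hYi⟩ := h.short.exists_dominating_quadForm hq isTensor_hsTensor hT0
    (sq_nonneg Cw) hrow hcol
  refine ⟨fun x => κ * Y x + ENNReal.ofReal (Real.sqrt (b T / T) *
    (S * (1 + cb * (T * b T ^ ℓ)))) * ν Set.univ, (hYm.const_mul κ).add_const _,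
    fun m hm x => ?_, ?_⟩
  · rw [integral_lagForm_eq hc]
    have h1 := hY m hm x
    rw [h.integral_quadForm (by linarith)] at h1
    refine (mul_le_mul_right (enorm_add_le _ _) κ).trans ?_
    rw [mul_add]
    refine add_le_add (mul_le_mul_right h1 κ) ?_
    refine (mul_le_mul_right (enorm_integral_le_lintegral_enorm _) κ).trans ?_
    rw [ENNReal.ofReal_mul (Real.sqrt_nonneg _), mul_assoc, ← hκ]
    refine mul_le_mul_right ?_ κ
    rw [← lintegral_const]
    refine lintegral_mono fun ω => ?_
    rw [← ofReal_norm]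
    exact ENNReal.ofReal_le_ofReal (hcb m hm ω)
  · refine le_trans ?_ hle
    rw [lintegral_add_right _ measurable_const, lintegral_const,
      measure_univ (μ := μ), mul_one]
    gcongr
    rw [lintegral_const_mul'' _ hYm]
    have hJ : (∫⁻ x, Y x ∂μ) ≤ (∫⁻ x, Y x ^ 2 ∂μ) ^ (1 / 2 : ℝ) := by
      have := ENNReal.lintegral_mul_le_Lp_mul_Lq μ Real.HolderConjugate.two_two hYm
        (aemeasurable_const (b := 1))
      simpa using this
    calc κ * ∫⁻ x, Y x ∂μ ≤ κ * (∫⁻ x, Y x ^ 2 ∂μ) ^ (1 / 2 : ℝ) := by gcongr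
      _ = (κ ^ 2 * ∫⁻ x, Y x ^ 2 ∂μ) ^ (1 / 2 : ℝ) := by
          rw [ENNReal.mul_rpow_of_nonneg _ _ (by norm_num)]
          congr 1
          rw [← ENNReal.rpow_natCast, ← ENNReal.rpow_mul]
          simp
      _ ≤ _ := by
          refine ENNReal.rpow_le_rpow ?_ (by norm_num)
          rw [hκ2]
          refine (mul_le_mul_right hYi _).trans (le_of_eq ?_)
          rw [← ENNReal.ofReal_mul (by positivity)]
          congr 1
          rw [hD]
          field_simp

end UniformBounds

section LinearFunctionals

variable {Ω H : Type*} {mΩ : MeasurableSpace Ω} [NormedAddCommGroup H] [InnerProductSpace ℂ H]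
  [CompleteSpace H] {μ : Measure Ω} [IsProbabilityMeasure μ] {M : ℤ → MeasurableSpace Ω}
  {V : ℤ → Ω → H} {C : ℤ → HSSpace H} {q ℓ : ℝ} {d : ℤ → ℝ} {w : ℝ → ℝ} {b : ℕ → ℝ}

theorem enorm_inner_le_enorm {E : Type*} [NormedAddCommGroup E] [InnerProductSpace ℂ E] (x y : E) :
    ‖(inner ℂ x y : ℂ)‖ₑ ≤ ‖x‖ₑ * ‖y‖ₑ := by
  rw [← ofReal_norm, ← ofReal_norm, ← ofReal_norm, ← ENNReal.ofReal_mul (norm_nonneg _)]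
  exact ENNReal.ofReal_le_ofReal (norm_inner_le_norm _ _)

theorem integrable_inner_lagForm (hC : Summable fun h => ‖C h‖) (w : ℝ → ℝ) (b : ℝ) (v : ℤ → H)
    (m : ℕ) {ν : Measure ℝ} [IsFiniteMeasure ν] {U : ℝ → HSSpace H} (hU : Integrable U ν) :
    Integrable (fun ω => inner ℂ (U ω) (lagForm w b C v m ω)) ν := by
  obtain ⟨c, hc⟩ := exists_norm_lagForm_le w b hC v m
  refine (hU.norm.mul_const c).mono'
    (hU.1.inner (continuous_lagForm w b hC v m).aestronglyMeasurable) (ae_of_all _ fun ω => ?_)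
  exact (norm_inner_le_norm _ _).trans (mul_le_mul_of_nonneg_left (hc ω) (norm_nonneg _))

/-- Integrating against a square integrable function of the frequency gains a factor `√b`. -/
theorem LagProcess.exists_integral_inner_le (h : LagProcess M μ V C q ℓ d) (hq : 2 < q)
    (hr : LagRate w b ℓ) {α β : ℝ} (hα : 0 ≤ α) (hβ : β ≤ Real.pi) {U : ℝ → HSSpace H}
    (hU : MemLp U 2 (volume.restrict (Set.Icc α β))) {e : ℝ≥0∞} (he : e ≠ 0) :
    ∀ᶠ T in atTop, ∃ Y : Ω → ℝ≥0∞, AEMeasurable Y μ ∧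
      (∀ m ≤ T, ∀ x, ENNReal.ofReal (Real.sqrt (b T / T)) *
        ‖∫ ω in Set.Icc α β, inner ℂ (U ω) (lagForm w (b T) C (fun t => V t x) m ω)‖ₑ ≤ Y x) ∧
      ∫⁻ x, Y x ∂μ ≤ e := by
  set ν := volume.restrict (Set.Icc α β) with hν
  have hc := h.summable_norm (by linarith [hr.one_le])
  have hint : ∀ {g : ℝ → HSSpace H}, MemLp g 2 ν → ∀ (T m : ℕ) (x : Ω),
      Integrable (fun ω => inner ℂ (g ω) (lagForm w (b T) C (fun t => V t x) m ω)) ν :=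
    fun hg T m x => integrable_inner_lagForm hc w (b T) _ m (hg.integrable one_le_two)
  set P : (ℝ → HSSpace H) → Prop := fun g => MemLp g 2 ν ∧ ∀ e : ℝ≥0∞, e ≠ 0 →
    ∀ᶠ T in atTop, ∃ Y : Ω → ℝ≥0∞, AEMeasurable Y μ ∧
      (∀ m ≤ T, ∀ x, ENNReal.ofReal (Real.sqrt (b T / T)) *
        ‖∫ ω, inner ℂ (g ω) (lagForm w (b T) C (fun t => V t x) m ω) ∂ν‖ₑ ≤ Y x) ∧
      ∫⁻ x, Y x ∂μ ≤ e with hP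
  have hind : ∀ (c : HSSpace H) ⦃s : Set ℝ⦄, MeasurableSet s → ν s < ∞ →
      ∀ {ε : ℝ≥0∞}, ε ≠ 0 → ∃ g, eLpNorm (g - s.indicator fun _ => c) 2 ν ≤ ε ∧ P g := by
    intro c s hs hνs ε _
    refine ⟨s.indicator fun _ => c, by simp, memLp_indicator_const _ hs _ (Or.inr hνs.ne), ?_⟩
    intro e he
    have he' : e / (‖c‖ₑ + 1) ≠ 0 := ENNReal.div_ne_zero.2 ⟨he, by finiteness⟩
    filter_upwards [h.exists_setIntegral_le hq hr hα hβ hs he'] with T hT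
    obtain ⟨Y, hYm, hY, hYi⟩ := hT
    refine ⟨fun x => ‖c‖ₑ * Y x, hYm.const_mul _, fun m hm x => ?_, ?_⟩
    · have e1 : ∫ ω, inner ℂ (s.indicator (fun _ => c) ω)
          (lagForm w (b T) C (fun t => V t x) m ω) ∂ν =
          inner ℂ c (∫ ω in s, lagForm w (b T) C (fun t => V t x) m ω ∂ν) := by
        obtain ⟨k, hk⟩ := exists_norm_lagForm_le w (b T) hc (fun t => V t x) m
        have hi : Integrable (fun ω => lagForm w (b T) C (fun t => V t x) m ω) (ν.restrict s) :=
          Integrable.of_bound (continuous_lagForm w (b T) hc _ m).aestronglyMeasurable k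
            (ae_of_all _ hk)
        rw [← integral_inner hi, ← integral_indicator hs]
        refine integral_congr_ae (ae_of_all _ fun ω => ?_)
        by_cases hω : ω ∈ s <;> simp [hω]
      rw [e1]
      calc _ ≤ ENNReal.ofReal (Real.sqrt (b T / T)) *
            (‖c‖ₑ * ‖∫ ω in s, lagForm w (b T) C (fun t => V t x) m ω ∂ν‖ₑ) := by
            gcongr
            exact enorm_inner_le_enorm _ _
        _ = ‖c‖ₑ * (ENNReal.ofReal (Real.sqrt (b T / T)) *
            ‖∫ ω in s, lagForm w (b T) C (fun t => V t x) m ω ∂ν‖ₑ) := by ring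
        _ ≤ _ := mul_le_mul_right (hY m hm x) _
    · rw [lintegral_const_mul'' _ hYm]
      calc _ ≤ (‖c‖ₑ + 1) * (e / (‖c‖ₑ + 1)) := by gcongr; exact le_self_add
        _ ≤ e := ENNReal.mul_div_le
  have hadd : ∀ f g, P f → P g → P (f + g) := by
    rintro f g ⟨hf, hf'⟩ ⟨hg, hg'⟩
    refine ⟨hf.add hg, fun e he => ?_⟩
    have he2 : e / 2 ≠ 0 := by simp [he]
    filter_upwards [hf' _ he2, hg' _ he2] with T h1 h2
    obtain ⟨Y₁, hm₁, hY₁, hi₁⟩ := h1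
    obtain ⟨Y₂, hm₂, hY₂, hi₂⟩ := h2
    refine ⟨fun x => Y₁ x + Y₂ x, hm₁.add hm₂, fun m hm x => ?_, ?_⟩
    · simp_rw [Pi.add_apply, inner_add_left]
      rw [integral_add (hint hf T m x) (hint hg T m x)]
      refine (mul_le_mul_right (enorm_add_le _ _) _).trans ?_
      rw [mul_add]
      exact add_le_add (hY₁ m hm x) (hY₂ m hm x)
    · rw [lintegral_add_left' hm₁]
      exact (add_le_add hi₁ hi₂).trans (ENNReal.add_halves e).le
  obtain ⟨c, hcf, hA⟩ := h.exists_lintegral_sq_le hq hr ν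
  have he1 : e / 2 / (1 + c) ≠ 0 := ENNReal.div_ne_zero.2 ⟨by simp [he], by finiteness⟩
  obtain ⟨g, hg, hg2, hgP⟩ := MemLp.induction_dense ENNReal.ofNat_ne_top P hind hadd
    (fun f hf => hf.1.1) hU he1
  filter_upwards [hA, hgP (e / 2) (by simp [he])] with T hA hg'
  obtain ⟨Y₁, hm₁, hY₁, hi₁⟩ := hA
  obtain ⟨Y₂, hm₂, hY₂, hi₂⟩ := hg'
  set κ := ENNReal.ofReal (Real.sqrt (b T / T)) with hκ
  refine ⟨fun x => e / 2 / (1 + c) * (1 + Y₁ x) + Y₂ x,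
    ((hm₁.const_add 1).const_mul _).add hm₂, fun m hm x => ?_, ?_⟩
  · have hsub : ∫ ω, inner ℂ (U ω) (lagForm w (b T) C (fun t => V t x) m ω) ∂ν =
        ∫ ω, inner ℂ ((U - g) ω) (lagForm w (b T) C (fun t => V t x) m ω) ∂ν +
          ∫ ω, inner ℂ (g ω) (lagForm w (b T) C (fun t => V t x) m ω) ∂ν := by
      rw [← integral_add (hint (hU.sub hg2) T m x) (hint hg2 T m x)]
      refine integral_congr_ae (ae_of_all _ fun ω => ?_)
      simp only [Pi.sub_apply]
      rw [← inner_add_left, sub_add_cancel]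
    rw [hsub]
    refine (mul_le_mul_right (enorm_add_le _ _) _).trans ?_
    rw [mul_add]
    refine add_le_add ?_ (hY₂ m hm x)
    have hLm : AEMeasurable (fun ω => κ * ‖lagForm w (b T) C (fun t => V t x) m ω‖ₑ) ν :=
      (continuous_lagForm w (b T) hc _ m).aestronglyMeasurable.enorm.const_mul κ
    have hUm : AEMeasurable (fun ω => ‖(U - g) ω‖ₑ) ν := (hU.sub hg2).1.enorm
    have h2 : (∫⁻ ω, ‖(U - g) ω‖ₑ ^ (2 : ℝ) ∂ν) ^ (1 / 2 : ℝ) = eLpNorm (U - g) 2 ν := by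
      rw [eLpNorm_eq_lintegral_rpow_enorm_toReal two_ne_zero ENNReal.ofNat_ne_top]
      simp
    calc κ * ‖∫ ω, inner ℂ ((U - g) ω) (lagForm w (b T) C (fun t => V t x) m ω) ∂ν‖ₑ
        ≤ κ * ∫⁻ ω, ‖(U - g) ω‖ₑ * ‖lagForm w (b T) C (fun t => V t x) m ω‖ₑ ∂ν := by
          gcongr
          exact (enorm_integral_le_lintegral_enorm _).trans
            (lintegral_mono fun ω => enorm_inner_le_enorm _ _)
      _ = ∫⁻ ω, ‖(U - g) ω‖ₑ * (κ * ‖lagForm w (b T) C (fun t => V t x) m ω‖ₑ) ∂ν := by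
          rw [← lintegral_const_mul' _ _ ENNReal.ofReal_ne_top]
          refine lintegral_congr fun ω => by ring
      _ ≤ eLpNorm (U - g) 2 ν *
          (∫⁻ ω, (κ * ‖lagForm w (b T) C (fun t => V t x) m ω‖ₑ) ^ (2 : ℝ) ∂ν) ^ (1 / 2 : ℝ) := by
          rw [← h2]
          exact ENNReal.lintegral_mul_le_Lp_mul_Lq ν Real.HolderConjugate.two_two hUm hLm
      _ ≤ e / 2 / (1 + c) * (1 + Y₁ x) := by
          refine mul_le_mul' hg ?_
          have h3 := hY₁ m hm x
          simp_rw [← ENNReal.rpow_two] at h3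
          refine (ENNReal.rpow_le_rpow h3 (by norm_num)).trans ?_
          rcases le_total (Y₁ x) 1 with hy | hy
          · exact (ENNReal.rpow_le_one hy (by norm_num)).trans le_self_add
          · calc Y₁ x ^ (1 / 2 : ℝ) ≤ Y₁ x ^ (1 : ℝ) :=
                  ENNReal.rpow_le_rpow_of_exponent_le hy (by norm_num)
              _ = Y₁ x := ENNReal.rpow_one _
              _ ≤ _ := le_add_self
  · rw [lintegral_add_right' _ hm₂, lintegral_const_mul'' _ (hm₁.const_add 1),
      lintegral_add_right' _ hm₁, lintegral_const, measure_univ, mul_one]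
    calc _ ≤ e / 2 / (1 + c) * (1 + c) + e / 2 := by gcongr
      _ ≤ e / 2 + e / 2 := by
          gcongr
          rw [mul_comm]; exact ENNReal.mul_div_le
      _ = e := ENNReal.add_halves e

end LinearFunctionals

section EigenPerturbation

variable {H ι : Type*} [NormedAddCommGroup H] [InnerProductSpace ℂ H] [CompleteSpace H] {m : ℕ}
  {e : Fin m ↪ ι} {A A' : H →L[ℂ] H} {lam lam' : ι → ℝ} {φ φ' : ι → H}

/-- The Hilbert basis formed by the eigenvectors. -/
def IsEigensystem.basis (h : IsEigensystem e A lam φ) : HilbertBasis ι ℂ H :=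
  HilbertBasis.mk h.orthonormal h.complete.ge

theorem IsEigensystem.basis_apply (h : IsEigensystem e A lam φ) (j : ι) : h.basis j = φ j := by
  rw [IsEigensystem.basis, HilbertBasis.coe_mk]

theorem IsEigensystem.norm_eq_one (h : IsEigensystem e A lam φ) (j : ι) : ‖φ j‖ = 1 :=
  h.orthonormal.1 j

theorem IsEigensystem.inner_ne (h : IsEigensystem e A lam φ) {i j : ι} (hij : i ≠ j) :
    inner ℂ (φ i) (φ j) = 0 := h.orthonormal.2 hij

theorem IsEigensystem.hasSum_repr (h : IsEigensystem e A lam φ) (x : H) :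
    HasSum (fun j => (inner ℂ (φ j) x : ℂ) • φ j) x := by
  simpa only [HilbertBasis.repr_apply_apply, h.basis_apply] using h.basis.hasSum_repr x

theorem IsEigensystem.hasSum_inner (h : IsEigensystem e A lam φ) (x y : H) :
    HasSum (fun j => inner ℂ x (φ j) * inner ℂ (φ j) y) (inner ℂ x y : ℂ) := by
  simpa only [h.basis_apply] using h.basis.hasSum_inner_mul_inner x y

theorem IsEigensystem.hasSum_norm_sq (h : IsEigensystem e A lam φ) (x : H) :
    HasSum (fun j => ‖(inner ℂ (φ j) x : ℂ)‖ ^ 2) (‖x‖ ^ 2) := by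
  simpa only [h.basis_apply] using h.basis.hasSum_norm_inner_sq x

theorem IsEigensystem.inner_apply (h : IsEigensystem e A lam φ) (j : ι) (x : H) :
    inner ℂ (φ j) (A x) = (lam j : ℂ) * inner ℂ (φ j) x := by
  have h1 := ((h.hasSum_repr x).mapL A).mapL (innerSL ℂ (φ j))
  simp only [map_smul, h.eigen, smul_eq_mul, innerSL_apply_apply] at h1
  rw [← h1.tsum_eq, tsum_eq_single j]
  · rw [inner_self_eq_norm_sq_to_K, h.norm_eq_one]
    simp [mul_comm]
  · intro i hi
    rw [h.inner_ne (Ne.symm hi)]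
    simp

theorem IsEigensystem.hasSum_re_inner (h : IsEigensystem e A lam φ) (x : H) :
    HasSum (fun j => lam j * ‖(inner ℂ (φ j) x : ℂ)‖ ^ 2) (inner ℂ x (A x) : ℂ).re := by
  have h1 := Complex.hasSum_re (h.hasSum_inner x (A x))
  refine h1.congr_fun fun j => ?_
  rw [h.inner_apply, ← inner_conj_symm x, mul_left_comm, ← Complex.normSq_eq_conj_mul_self,
    ← Complex.ofReal_mul, Complex.ofReal_re, Complex.normSq_eq_norm_sq]

theorem IsEigensystem.exists_mem_span_orthogonal (φ : ι → H)
    (h' : IsEigensystem e A' lam' φ') (i : Fin m) :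
    ∃ v : H, ‖v‖ = 1 ∧ (∀ i' < i, inner ℂ (φ (e i')) v = 0) ∧
      ∀ j, (∀ i' ≤ i, j ≠ e i') → inner ℂ (φ' j) v = 0 := by
  let L : ({i' : Fin m // i' ≤ i} → ℂ) →ₗ[ℂ] H :=
    Fintype.linearCombination ℂ fun i' : {i' : Fin m // i' ≤ i} => φ' (e i')
  let R : H →ₗ[ℂ] ({i' : Fin m // i' < i} → ℂ) :=
    LinearMap.pi fun i' => (innerSL ℂ (φ (e i'))).toLinearMap
  have hlt : Module.finrank ℂ ({i' : Fin m // i' < i} → ℂ) <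
      Module.finrank ℂ ({i' : Fin m // i' ≤ i} → ℂ) := by
    rw [Module.finrank_fintype_fun_eq_card, Module.finrank_fintype_fun_eq_card]
    refine Fintype.card_lt_of_injective_of_notMem
      (fun x => ⟨x.1, x.2.le⟩) (fun x y hxy => Subtype.ext (by simpa using hxy))
      (b := ⟨i, le_rfl⟩) ?_
    rintro ⟨x, hx⟩
    exact x.2.ne (by simpa using hx)
  obtain ⟨c, hc, hc0⟩ := (Submodule.ne_bot_iff _).1
    (LinearMap.ker_ne_bot_of_finrank_lt (f := R ∘ₗ L) hlt)
  have hinj : Function.Injective fun i' : {i' : Fin m // i' ≤ i} => e i' := fun x y hxy =>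
    Subtype.ext (e.injective hxy)
  have hli : LinearIndependent ℂ fun i' : {i' : Fin m // i' ≤ i} => φ' (e i') :=
    (h'.orthonormal.comp _ hinj).linearIndependent
  have hv0 : L c ≠ 0 := by
    intro h0
    rw [Fintype.linearCombination_apply] at h0
    exact hc0 (funext (Fintype.linearIndependent_iff.1 hli c h0))
  have hn : ‖L c‖ ≠ 0 := norm_ne_zero_iff.2 hv0
  refine ⟨((‖L c‖⁻¹ : ℝ) : ℂ) • L c, ?_, fun i' hi' => ?_, fun j hj => ?_⟩
  · rw [norm_smul, Complex.norm_real, norm_inv, norm_norm, inv_mul_cancel₀ hn]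
  · have h1 : R (L c) = 0 := hc
    have h2 := congrFun h1 ⟨i', hi'⟩
    rw [inner_smul_right]
    rw [show inner ℂ (φ (e i')) (L c) = (0 : ℂ) from h2, mul_zero]
  · have h0 : inner ℂ (φ' j) (L c) = (0 : ℂ) := by
      rw [Fintype.linearCombination_apply, inner_sum]
      refine Finset.sum_eq_zero fun i' _ => ?_
      rw [inner_smul_right, h'.inner_ne (hj i' i'.2), mul_zero]
    rw [inner_smul_right, h0, mul_zero]

theorem IsEigensystem.eigenvalue_le (h : IsEigensystem e A lam φ)
    (h' : IsEigensystem e A' lam' φ') (i : Fin m) : lam' (e i) ≤ lam (e i) + ‖A' - A‖ := by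
  obtain ⟨v, hv, hv1, hv2⟩ := h'.exists_mem_span_orthogonal φ i
  have h1 : lam' (e i) ≤ (inner ℂ v (A' v) : ℂ).re := by
    have hs := (h'.hasSum_norm_sq v).mul_left (lam' (e i))
    rw [hv, one_pow, mul_one] at hs
    refine hasSum_le (fun j => ?_) hs (h'.hasSum_re_inner v)
    by_cases hj : ∀ i' ≤ i, j ≠ e i'
    · simp [hv2 j hj]
    · push Not at hj
      obtain ⟨i', hi', rfl⟩ := hj
      exact mul_le_mul_of_nonneg_right (h'.ordered hi') (by positivity)
  have h2 : (inner ℂ v (A v) : ℂ).re ≤ lam (e i) := by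
    have hs := (h.hasSum_norm_sq v).mul_left (lam (e i))
    rw [hv, one_pow, mul_one] at hs
    refine hasSum_le (fun j => ?_) (h.hasSum_re_inner v) hs
    by_cases hj : j ∈ Set.range e
    · obtain ⟨i', rfl⟩ := hj
      rcases lt_or_ge i' i with hi' | hi'
      · simp [hv1 i' hi']
      · exact mul_le_mul_of_nonneg_right (h.ordered hi') (by positivity)
    · exact mul_le_mul_of_nonneg_right (h.top j hj i) (by positivity)
  have h3 : (inner ℂ v (A' v) : ℂ).re - (inner ℂ v (A v) : ℂ).re ≤ ‖A' - A‖ := by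
    rw [← Complex.sub_re, ← inner_sub_right, ← _root_.sub_apply]
    refine (Complex.re_le_norm _).trans ((norm_inner_le_norm _ _).trans ?_)
    have := (A' - A).le_opNorm v
    rw [hv] at this ⊢
    linarith
  linarith

/-- Weyl's inequality. -/
theorem IsEigensystem.abs_eigenvalue_sub_le (h : IsEigensystem e A lam φ)
    (h' : IsEigensystem e A' lam' φ') (i : Fin m) : |lam' (e i) - lam (e i)| ≤ ‖A' - A‖ := by
  have h1 := h.eigenvalue_le h' i
  have h2 := h'.eigenvalue_le h i
  rw [norm_sub_rev] at h2
  rw [abs_le]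
  constructor <;> linarith

theorem IsEigensystem.gap_mul_norm_le (h : IsEigensystem e A lam φ) {k : ι} {γ : ℝ} (hγ : 0 ≤ γ)
    (hgap : ∀ j ≠ k, γ ≤ |lam j - lam k|) {x : H} (hx : inner ℂ (φ k) x = 0) :
    γ * ‖x‖ ≤ ‖A x - (lam k : ℂ) • x‖ := by
  refine abs_le_of_sq_le_sq' ?_ (norm_nonneg _) |>.2
  rw [mul_pow]
  refine hasSum_le (fun j => ?_) ((h.hasSum_norm_sq x).mul_left (γ ^ 2)) (h.hasSum_norm_sq _)
  rw [inner_sub_right, inner_smul_right, h.inner_apply, ← sub_mul, norm_mul, mul_pow,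
    ← Complex.ofReal_sub, Complex.norm_real, Real.norm_eq_abs]
  rcases eq_or_ne j k with rfl | hj
  · simp [hx]
  · gcongr
    exact hgap j hj

/-- The vector with prescribed coefficients in an orthonormal family. -/
def coefVec (φ : ι → H) (c : ι → ℂ) : H := ∑' j, c j • φ j

theorem IsEigensystem.coefVec_spec (h : IsEigensystem e A lam φ) {c : ι → ℂ} {K : ℝ} (hK : 0 ≤ K)
    {ψ : H} (hc : ∀ j, ‖c j‖ ≤ K * ‖(inner ℂ (φ j) ψ : ℂ)‖) :
    HasSum (fun j => c j • φ j) (coefVec φ c) ∧ ‖coefVec φ c‖ ≤ K * ‖ψ‖ ∧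
      ∀ j, inner ℂ (φ j) (coefVec φ c) = c j := by
  have hle : ∀ j, ‖c j‖ ^ 2 ≤ K ^ 2 * ‖(inner ℂ (φ j) ψ : ℂ)‖ ^ 2 := fun j => by
    rw [← mul_pow]; exact pow_le_pow_left₀ (norm_nonneg _) (hc j) 2
  have hs : Summable fun j => ‖c j‖ ^ 2 := Summable.of_nonneg_of_le (fun j => by positivity) hle
    ((h.hasSum_norm_sq ψ).mul_left (K ^ 2)).summable
  have hsum : Summable fun j => c j • φ j := by
    have := (OrthogonalFamily.summable_iff_norm_sq_summable h.orthonormal.orthogonalFamily c).2 hs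
    simpa using this
  have hinner : ∀ j, inner ℂ (φ j) (coefVec φ c) = c j := by
    intro j
    have h1 := hsum.hasSum.mapL (innerSL ℂ (φ j))
    simp only [map_smul, smul_eq_mul, innerSL_apply_apply] at h1
    rw [coefVec, ← h1.tsum_eq, tsum_eq_single j]
    · rw [inner_self_eq_norm_sq_to_K, h.norm_eq_one]; simp
    · intro i hi
      rw [h.inner_ne (Ne.symm hi), mul_zero]
  refine ⟨hsum.hasSum, ?_, hinner⟩
  refine abs_le_of_sq_le_sq' ?_ (by positivity) |>.2
  rw [mul_pow]
  refine hasSum_le (fun j => ?_) (h.hasSum_norm_sq _) ((h.hasSum_norm_sq ψ).mul_left (K ^ 2))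
  rw [hinner]
  exact hle j

/-- Coefficients of the reduced resolvent at `lam k` applied to `ψ`. -/
def resolventCoef (lam : ι → ℝ) (φ : ι → H) (k : ι) (ψ : H) (j : ι) : ℂ :=
  ((lam j - lam k : ℝ) : ℂ)⁻¹ * inner ℂ (φ j) ψ

theorem norm_resolventCoef_le {k : ι} {γ : ℝ} (hγ : 0 < γ)
    (hgap : ∀ j ≠ k, γ ≤ |lam j - lam k|) (ψ : H) (j : ι) :
    ‖resolventCoef lam φ k ψ j‖ ≤ γ⁻¹ * ‖(inner ℂ (φ j) ψ : ℂ)‖ := by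
  rw [resolventCoef, norm_mul, norm_inv, Complex.norm_real, Real.norm_eq_abs]
  rcases eq_or_ne j k with rfl | hj
  · simp; positivity
  · gcongr
    exact hgap j hj

theorem IsEigensystem.inner_coefVec_resolvent (h : IsEigensystem e A lam φ) {k : ι} {γ : ℝ}
    (hγ : 0 < γ) (hgap : ∀ j ≠ k, γ ≤ |lam j - lam k|) (ψ : H) {x : H}
    (hx : inner ℂ (φ k) x = 0) :
    inner ℂ (coefVec φ (resolventCoef lam φ k ψ)) (A x - (lam k : ℂ) • x) = (inner ℂ ψ x : ℂ) := by
  obtain ⟨-, -, hc⟩ := h.coefVec_spec (inv_nonneg.2 hγ.le)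
    (norm_resolventCoef_le (φ := φ) hγ hgap ψ)
  rw [← (h.hasSum_inner _ _).tsum_eq, ← (h.hasSum_inner ψ x).tsum_eq]
  refine tsum_congr fun j => ?_
  rw [← inner_conj_symm, hc, inner_sub_right, inner_smul_right, h.inner_apply, ← sub_mul,
    resolventCoef, map_mul, inner_conj_symm, map_inv₀, Complex.conj_ofReal, Complex.ofReal_sub]
  rcases eq_or_ne j k with rfl | hj
  · simp [hx]
  · have : ((lam j : ℂ) - lam k) ≠ 0 := by
      rw [← Complex.ofReal_sub, Complex.ofReal_ne_zero]
      intro h0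
      have := hgap j hj
      rw [h0, abs_zero] at this
      linarith
    field_simp

/-- The part of `y` orthogonal to `x`. -/
def orthPart (x y : H) : H := y - (inner ℂ x y : ℂ) • x

theorem inner_orthPart {x : H} (hx : ‖x‖ = 1) (y : H) : inner ℂ x (orthPart x y) = (0 : ℂ) := by
  rw [orthPart, inner_sub_right, inner_smul_right, inner_self_eq_norm_sq_to_K, hx]
  simp

theorem smul_add_orthPart (x y : H) : (inner ℂ x y : ℂ) • x + orthPart x y = y := by
  rw [orthPart]; abel

theorem norm_inner_sq_eq {x y : H} (hx : ‖x‖ = 1) (hy : ‖y‖ = 1) :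
    ‖(inner ℂ x y : ℂ)‖ ^ 2 = 1 - ‖orthPart x y‖ ^ 2 := by
  have h2 := norm_add_sq_eq_norm_sq_add_norm_sq_of_inner_eq_zero (𝕜 := ℂ)
    ((inner ℂ x y : ℂ) • x) (orthPart x y) (by rw [inner_smul_left, inner_orthPart hx, mul_zero])
  rw [smul_add_orthPart, hy, norm_smul, hx] at h2
  nlinarith

theorem norm_orthPart_le_one {x y : H} (hx : ‖x‖ = 1) (hy : ‖y‖ = 1) : ‖orthPart x y‖ ≤ 1 := by
  have h := norm_inner_sq_eq hx hy
  nlinarith [sq_nonneg ‖(inner ℂ x y : ℂ)‖, norm_nonneg (orthPart x y)]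

theorem IsEigensystem.apply_orthPart (h : IsEigensystem e A lam φ)
    (h' : IsEigensystem e A' lam' φ') (k : ι) :
    A (orthPart (φ k) (φ' k)) - (lam k : ℂ) • orthPart (φ k) (φ' k) =
      ((lam' k - lam k : ℝ) : ℂ) • φ' k - (A' - A) (φ' k) := by
  rw [_root_.sub_apply, h'.eigen, orthPart, map_sub, map_smul, h.eigen]
  push_cast
  module

theorem IsEigensystem.norm_orthPart_le (h : IsEigensystem e A lam φ)
    (h' : IsEigensystem e A' lam' φ') (i : Fin m) {γ : ℝ} (hγ : 0 < γ)
    (hgap : ∀ j ≠ e i, γ ≤ |lam j - lam (e i)|) :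
    ‖orthPart (φ (e i)) (φ' (e i))‖ ≤ 2 * ‖A' - A‖ / γ := by
  rw [le_div_iff₀ hγ, mul_comm]
  refine (h.gap_mul_norm_le hγ.le hgap (inner_orthPart (h.norm_eq_one _) _)).trans ?_
  rw [h.apply_orthPart h']
  refine (norm_sub_le _ _).trans ?_
  rw [norm_smul, h'.norm_eq_one, Complex.norm_real, Real.norm_eq_abs, mul_one, two_mul]
  have := (A' - A).le_opNorm (φ' (e i))
  rw [h'.norm_eq_one, mul_one] at this
  exact add_le_add (h.abs_eigenvalue_sub_le h' i) this

/-- First order expansion of an eigenvector, tested against a vector `ψ`. -/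
theorem IsEigensystem.norm_inner_orthPart_add_le (h : IsEigensystem e A lam φ)
    (h' : IsEigensystem e A' lam' φ') (i : Fin m) {γ : ℝ} (hγ : 0 < γ)
    (hgap : ∀ j ≠ e i, γ ≤ |lam j - lam (e i)|) {ψ : H} (hψ : ‖ψ‖ = 1) :
    ‖starRingEnd ℂ (inner ℂ (φ (e i)) (φ' (e i))) * inner ℂ ψ (orthPart (φ (e i)) (φ' (e i)))
      + inner ℂ (coefVec φ (resolventCoef lam φ (e i) ψ)) ((A' - A) (φ (e i)))‖ ≤
      6 * ‖A' - A‖ ^ 2 / γ ^ 2 := by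
  set u := coefVec φ (resolventCoef lam φ (e i) ψ) with hu
  set r := orthPart (φ (e i)) (φ' (e i)) with hr
  set α : ℂ := inner ℂ (φ (e i)) (φ' (e i)) with hα
  set δ := ‖A' - A‖ with hδ
  have hδ0 : 0 ≤ δ := norm_nonneg _
  obtain ⟨-, hun, huc⟩ := h.coefVec_spec (inv_nonneg.2 hγ.le)
    (norm_resolventCoef_le (φ := φ) hγ hgap ψ)
  rw [hψ, mul_one] at hun
  have hr0 : inner ℂ (φ (e i)) r = (0 : ℂ) := inner_orthPart (h.norm_eq_one _) _
  have hrn : ‖r‖ ≤ 2 * δ / γ := h.norm_orthPart_le h' i hγ hgap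
  have hr1 : ‖r‖ ≤ 1 := norm_orthPart_le_one (h.norm_eq_one _) (h'.norm_eq_one _)
  have hα2 : ‖α‖ ^ 2 = 1 - ‖r‖ ^ 2 := norm_inner_sq_eq (h.norm_eq_one _) (h'.norm_eq_one _)
  have hα1 : ‖α‖ ≤ 1 := by nlinarith [norm_nonneg α, sq_nonneg ‖r‖]
  have huφ : inner ℂ u (φ (e i)) = (0 : ℂ) := by
    rw [← inner_conj_symm, huc, resolventCoef]; simp
  have hφ' : φ' (e i) = α • φ (e i) + r := (smul_add_orthPart _ _).symm
  have h1 : inner ℂ ψ r = ((lam' (e i) - lam (e i) : ℝ) : ℂ) * inner ℂ u r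
      - α * inner ℂ u ((A' - A) (φ (e i))) - inner ℂ u ((A' - A) r) := by
    rw [← h.inner_coefVec_resolvent hγ hgap ψ hr0, h.apply_orthPart h', ← hu, inner_sub_right,
      inner_smul_right, hφ', map_add, map_smul, inner_add_right, inner_add_right,
      inner_smul_right, inner_smul_right, huφ]
    ring
  have hαα : starRingEnd ℂ α * α = ((1 - ‖r‖ ^ 2 : ℝ) : ℂ) := by
    rw [← Complex.normSq_eq_conj_mul_self, Complex.normSq_eq_norm_sq, hα2]
  have h2 : starRingEnd ℂ α * inner ℂ ψ r + inner ℂ u ((A' - A) (φ (e i))) =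
      starRingEnd ℂ α * (((lam' (e i) - lam (e i) : ℝ) : ℂ) * inner ℂ u r
        - inner ℂ u ((A' - A) r)) + ((‖r‖ ^ 2 : ℝ) : ℂ) * inner ℂ u ((A' - A) (φ (e i))) := by
    rw [h1]
    have : starRingEnd ℂ α * (((lam' (e i) - lam (e i) : ℝ) : ℂ) * inner ℂ u r
      - α * inner ℂ u ((A' - A) (φ (e i))) - inner ℂ u ((A' - A) r)) =
      starRingEnd ℂ α * (((lam' (e i) - lam (e i) : ℝ) : ℂ) * inner ℂ u r
        - inner ℂ u ((A' - A) r)) - (starRingEnd ℂ α * α) * inner ℂ u ((A' - A) (φ (e i))) := by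
      ring
    rw [this, hαα]
    push_cast
    ring
  have hA : ∀ x : H, ‖(inner ℂ u ((A' - A) x) : ℂ)‖ ≤ γ⁻¹ * (δ * ‖x‖) := fun x =>
    (norm_inner_le_norm _ _).trans (mul_le_mul hun ((A' - A).le_opNorm x) (norm_nonneg _)
      (by positivity))
  have hlam : |lam' (e i) - lam (e i)| ≤ δ := h.abs_eigenvalue_sub_le h' i
  rw [h2]
  have h3 : ‖starRingEnd ℂ α * (((lam' (e i) - lam (e i) : ℝ) : ℂ) * inner ℂ u r
        - inner ℂ u ((A' - A) r))‖ ≤ 2 * (γ⁻¹ * (δ * (2 * δ / γ))) := by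
    rw [norm_mul, RCLike.norm_conj]
    refine (mul_le_of_le_one_left (norm_nonneg _) hα1).trans ((norm_sub_le _ _).trans ?_)
    rw [two_mul]
    refine add_le_add ?_ ((hA r).trans (by gcongr))
    rw [norm_mul, Complex.norm_real, Real.norm_eq_abs]
    calc _ ≤ δ * (γ⁻¹ * (2 * δ / γ)) := by
          gcongr
          exact (norm_inner_le_norm _ _).trans (by gcongr)
      _ = _ := by ring
  have h4 : ‖((‖r‖ ^ 2 : ℝ) : ℂ) * inner ℂ u ((A' - A) (φ (e i)))‖ ≤
      (2 * δ / γ) * (γ⁻¹ * δ) := by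
    rw [norm_mul, Complex.norm_real, Real.norm_of_nonneg (by positivity)]
    have := hA (φ (e i))
    rw [h.norm_eq_one, mul_one] at this
    refine mul_le_mul ?_ this (norm_nonneg _) (by positivity)
    nlinarith [norm_nonneg r]
  refine (norm_add_le _ _).trans ((add_le_add h3 h4).trans (le_of_eq ?_))
  field_simp
  ring

theorem abs_norm_sq_expansion_le {α β p s t z : ℂ} {ρ σ : ℝ} (hρ : 0 ≤ ρ) (hρ1 : ρ ≤ 1)
    (hσ : 0 ≤ σ) (hσ1 : σ ≤ 1) (hα : ‖α‖ ^ 2 = 1 - ρ ^ 2) (hβ : ‖β‖ ^ 2 = 1 - σ ^ 2)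
    (hp : ‖p‖ ≤ 1) (hs : ‖s‖ ≤ ρ) (ht : ‖t‖ ≤ σ) (hz : ‖z‖ ≤ ρ * σ) :
    |‖starRingEnd ℂ β * α * p + (starRingEnd ℂ β * s + α * starRingEnd ℂ t) + z‖ ^ 2 - ‖p‖ ^ 2
      - 2 * (starRingEnd ℂ p * (starRingEnd ℂ α * s)).re - 2 * (p * (starRingEnd ℂ β * t)).re| ≤
      12 * (ρ ^ 2 + σ ^ 2) := by
  have hα1 : ‖α‖ ≤ 1 := by
    rw [← sq_le_one_iff₀ (norm_nonneg _), hα]; linarith only [sq_nonneg ρ]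
  have hβ1 : ‖β‖ ≤ 1 := by
    rw [← sq_le_one_iff₀ (norm_nonneg _), hβ]; linarith only [sq_nonneg σ]
  set z0 := starRingEnd ℂ β * α * p with hz0
  set z1 := starRingEnd ℂ β * s + α * starRingEnd ℂ t with hz1
  set P := (starRingEnd ℂ p * (starRingEnd ℂ α * s)).re with hP
  set Q := (p * (starRingEnd ℂ β * t)).re with hQ
  have hexp : ‖z0 + z1 + z‖ ^ 2 = ‖z0‖ ^ 2 + 2 * (z0 * starRingEnd ℂ z1).re +
      2 * (z0 * starRingEnd ℂ z).re + ‖z1 + z‖ ^ 2 := by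
    rw [add_assoc]
    simp only [← Complex.normSq_eq_norm_sq]
    rw [Complex.normSq_add z0, map_add (starRingEnd ℂ), mul_add, Complex.add_re]
    ring
  have hcross : (z0 * starRingEnd ℂ z1).re = ‖β‖ ^ 2 * P + ‖α‖ ^ 2 * Q := by
    have e1 : z0 * starRingEnd ℂ z1 = (starRingEnd ℂ β * β) *
        (starRingEnd ℂ (starRingEnd ℂ p * (starRingEnd ℂ α * s))) +
        (starRingEnd ℂ α * α) * (p * (starRingEnd ℂ β * t)) := by
      rw [hz0, hz1]
      simp only [map_add, map_mul, Complex.conj_conj]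
      ring
    rw [e1, ← Complex.normSq_eq_conj_mul_self, ← Complex.normSq_eq_conj_mul_self, Complex.add_re,
      Complex.re_ofReal_mul, Complex.re_ofReal_mul, Complex.conj_re, Complex.normSq_eq_norm_sq,
      Complex.normSq_eq_norm_sq]
  have hz0n : ‖z0‖ ^ 2 = (1 - σ ^ 2) * (1 - ρ ^ 2) * ‖p‖ ^ 2 := by
    rw [hz0, norm_mul, norm_mul, RCLike.norm_conj, mul_pow, mul_pow, hα, hβ]
  have hz0le : ‖z0‖ ≤ 1 := by
    rw [hz0, norm_mul, norm_mul, RCLike.norm_conj]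
    exact mul_le_one₀ (mul_le_one₀ hβ1 (norm_nonneg _) hα1) (norm_nonneg _) hp
  have hPle : |P| ≤ ρ := by
    refine (Complex.abs_re_le_norm _).trans ?_
    rw [norm_mul, norm_mul, RCLike.norm_conj, RCLike.norm_conj]
    calc ‖p‖ * (‖α‖ * ‖s‖) ≤ 1 * (1 * ρ) := by gcongr
      _ = ρ := by ring
  have hQle : |Q| ≤ σ := by
    refine (Complex.abs_re_le_norm _).trans ?_
    rw [norm_mul, norm_mul, RCLike.norm_conj]
    calc ‖p‖ * (‖β‖ * ‖t‖) ≤ 1 * (1 * σ) := by gcongr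
      _ = σ := by ring
  have hzz : |(z0 * starRingEnd ℂ z).re| ≤ ρ * σ := by
    refine (Complex.abs_re_le_norm _).trans ?_
    rw [norm_mul, RCLike.norm_conj]
    calc ‖z0‖ * ‖z‖ ≤ 1 * (ρ * σ) := by gcongr
      _ = _ := one_mul _
  have hz1n : ‖z1 + z‖ ≤ ρ + 2 * σ := by
    have h1 : ‖starRingEnd ℂ β * s‖ ≤ ρ := by
      rw [norm_mul, RCLike.norm_conj]
      exact (mul_le_of_le_one_left (norm_nonneg _) hβ1).trans hs
    have h2 : ‖α * starRingEnd ℂ t‖ ≤ σ := by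
      rw [norm_mul, RCLike.norm_conj]
      exact (mul_le_of_le_one_left (norm_nonneg _) hα1).trans ht
    have h3 := norm_add_le (starRingEnd ℂ β * s) (α * starRingEnd ℂ t)
    have h4 := norm_add_le z1 z
    have h5 : ρ * σ ≤ σ := mul_le_of_le_one_left hσ hρ1
    linarith only [h1, h2, h3, h4, h5, hz]
  have hz1s : ‖z1 + z‖ ^ 2 ≤ (ρ + 2 * σ) ^ 2 := pow_le_pow_left₀ (norm_nonneg _) hz1n 2
  have hp2 : ‖p‖ ^ 2 ≤ 1 := pow_le_one₀ (norm_nonneg _) hp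
  have hp0 : 0 ≤ ‖p‖ ^ 2 := by positivity
  have hρ2 : ρ ^ 2 ≤ 1 := pow_le_one₀ hρ hρ1
  have hσ2 : σ ^ 2 ≤ 1 := pow_le_one₀ hσ hσ1
  have hmain : |‖z0‖ ^ 2 - ‖p‖ ^ 2| ≤ ρ ^ 2 + σ ^ 2 := by
    have e1 : ‖z0‖ ^ 2 - ‖p‖ ^ 2 = -((ρ ^ 2 + σ ^ 2 - ρ ^ 2 * σ ^ 2) * ‖p‖ ^ 2) := by
      rw [hz0n]; ring
    have h1 : 0 ≤ ρ ^ 2 * σ ^ 2 := by positivity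
    have h2 : ρ ^ 2 * σ ^ 2 ≤ ρ ^ 2 := mul_le_of_le_one_right (sq_nonneg ρ) hσ2
    have h3 : 0 ≤ ρ ^ 2 + σ ^ 2 - ρ ^ 2 * σ ^ 2 := by linarith only [h2, sq_nonneg σ]
    rw [e1, abs_neg, abs_of_nonneg (mul_nonneg h3 hp0)]
    exact (mul_le_of_le_one_right h3 hp2).trans (by linarith only [h1])
  have hPQ : |(z0 * starRingEnd ℂ z1).re - P - Q| ≤ ρ ^ 2 + σ ^ 2 := by
    rw [hcross, hα, hβ, show (1 - σ ^ 2) * P + (1 - ρ ^ 2) * Q - P - Q =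
      -(σ ^ 2 * P + ρ ^ 2 * Q) by ring, abs_neg]
    refine (abs_add_le _ _).trans ?_
    rw [abs_mul, abs_mul, abs_of_nonneg (sq_nonneg σ), abs_of_nonneg (sq_nonneg ρ)]
    have h1 : σ ^ 2 * |P| ≤ σ ^ 2 * 1 := by gcongr; exact hPle.trans hρ1
    have h2 : ρ ^ 2 * |Q| ≤ ρ ^ 2 * 1 := by gcongr; exact hQle.trans hσ1
    linarith only [h1, h2]
  have hsplit : ‖z0 + z1 + z‖ ^ 2 - ‖p‖ ^ 2 - 2 * P - 2 * Q =
      (‖z0‖ ^ 2 - ‖p‖ ^ 2) + 2 * ((z0 * starRingEnd ℂ z1).re - P - Q) +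
        2 * (z0 * starRingEnd ℂ z).re + ‖z1 + z‖ ^ 2 := by rw [hexp]; ring
  rw [hsplit, abs_le]
  rw [abs_le] at hmain hPQ hzz
  have h0 : 0 ≤ 2 * (ρ - σ) ^ 2 + 5 * ρ ^ 2 + 2 * σ ^ 2 := by positivity
  have h1 : ρ * σ ≤ (ρ ^ 2 + σ ^ 2) / 2 := by
    have e1 : (ρ ^ 2 + σ ^ 2) / 2 - ρ * σ = (ρ - σ) ^ 2 / 2 := by ring
    exact sub_nonneg.1 (e1 ▸ by positivity)
  have h2 : (ρ + 2 * σ) ^ 2 ≤ 8 * (ρ ^ 2 + σ ^ 2) := by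
    have e1 : 8 * (ρ ^ 2 + σ ^ 2) - (ρ + 2 * σ) ^ 2 =
      2 * (ρ - σ) ^ 2 + 5 * ρ ^ 2 + 2 * σ ^ 2 := by ring
    exact sub_nonneg.1 (e1 ▸ h0)
  have h3 : 0 ≤ ‖z1 + z‖ ^ 2 := by positivity
  have h4 : 0 ≤ ρ ^ 2 + σ ^ 2 := by positivity
  obtain ⟨hm1, hm2⟩ := hmain
  obtain ⟨hq1, hq2⟩ := hPQ
  obtain ⟨hr1, hr2⟩ := hzz
  constructor
  · linarith only [hm1, hq1, hr1, h1, h3, h4]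
  · linarith only [hm2, hq2, hr2, h1, h2, h4, hz1s]

variable {B B' : H →L[ℂ] H} {κ κ' : ι → ℝ} {ψ ψ' : ι → H}

/-- Second order bound for the squared overlap of two perturbed eigenvectors. -/
theorem abs_overlap_expansion_le (hA : IsEigensystem e A lam φ) (hA' : IsEigensystem e A' lam' φ')
    (hB : IsEigensystem e B κ ψ) (hB' : IsEigensystem e B' κ' ψ') (i : Fin m) {γ : ℝ} (hγ : 0 < γ)
    (hgapA : ∀ j ≠ e i, γ ≤ |lam j - lam (e i)|) (hgapB : ∀ j ≠ e i, γ ≤ |κ j - κ (e i)|) :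
    |‖(inner ℂ (ψ' (e i)) (φ' (e i)) : ℂ)‖ ^ 2 - ‖(inner ℂ (ψ (e i)) (φ (e i)) : ℂ)‖ ^ 2
      + 2 * (inner ℂ (φ (e i)) (ψ (e i)) *
          inner ℂ (coefVec φ (resolventCoef lam φ (e i) (ψ (e i)))) ((A' - A) (φ (e i)))).re
      + 2 * (inner ℂ (ψ (e i)) (φ (e i)) *
          inner ℂ (coefVec ψ (resolventCoef κ ψ (e i) (φ (e i)))) ((B' - B) (ψ (e i)))).re| ≤
      60 / γ ^ 2 * (‖A' - A‖ ^ 2 + ‖B' - B‖ ^ 2) := by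
  have hφ := hA.norm_eq_one (e i)
  have hφ' := hA'.norm_eq_one (e i)
  have hψ := hB.norm_eq_one (e i)
  have hψ' := hB'.norm_eq_one (e i)
  set r := orthPart (φ (e i)) (φ' (e i)) with hr
  set q := orthPart (ψ (e i)) (ψ' (e i)) with hq
  set α : ℂ := inner ℂ (φ (e i)) (φ' (e i)) with hα
  set β : ℂ := inner ℂ (ψ (e i)) (ψ' (e i)) with hβ
  set p : ℂ := inner ℂ (ψ (e i)) (φ (e i)) with hp
  have hp' : inner ℂ (φ (e i)) (ψ (e i)) = starRingEnd ℂ p := (inner_conj_symm _ _).symm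
  have hrn := hA.norm_orthPart_le hA' i hγ hgapA
  have hqn := hB.norm_orthPart_le hB' i hγ hgapB
  have h1 := hA.norm_inner_orthPart_add_le hA' i hγ hgapA hψ
  have h2 := hB.norm_inner_orthPart_add_le hB' i hγ hgapB hφ
  rw [← hr] at hrn
  rw [← hq] at hqn
  rw [← hr, ← hα] at h1
  rw [← hq, ← hβ] at h2
  set u : ℂ := inner ℂ (coefVec φ (resolventCoef lam φ (e i) (ψ (e i)))) ((A' - A) (φ (e i)))
  set v : ℂ := inner ℂ (coefVec ψ (resolventCoef κ ψ (e i) (φ (e i)))) ((B' - B) (ψ (e i)))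
  have hle : ∀ {x y : H}, ‖x‖ = 1 → ‖(inner ℂ x y : ℂ)‖ ≤ ‖y‖ := fun {x y} hx => by
    simpa [hx] using norm_inner_le_norm (𝕜 := ℂ) x y
  have hp1 : ‖p‖ ≤ 1 := (hle hψ).trans hφ.le
  have hzz : inner ℂ (ψ' (e i)) (φ' (e i)) = starRingEnd ℂ β * α * p +
      (starRingEnd ℂ β * inner ℂ (ψ (e i)) r + α * starRingEnd ℂ (inner ℂ (φ (e i)) q)) +
      inner ℂ q r := by
    have e1 : φ' (e i) = α • φ (e i) + r := (smul_add_orthPart _ _).symm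
    have e2 : ψ' (e i) = β • ψ (e i) + q := (smul_add_orthPart _ _).symm
    rw [inner_conj_symm q (φ (e i)), e1, e2]
    simp only [inner_add_left, inner_add_right, inner_smul_left, inner_smul_right, ← hp]
    ring
  have h3 := abs_norm_sq_expansion_le (norm_nonneg r) (norm_orthPart_le_one hφ hφ') (norm_nonneg q)
    (norm_orthPart_le_one hψ hψ') (norm_inner_sq_eq hφ hφ') (norm_inner_sq_eq hψ hψ') hp1
    (hle hψ (y := r)) (hle hφ (y := q)) ((norm_inner_le_norm (𝕜 := ℂ) q r).trans (mul_comm _ _).le)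
  rw [← hα, ← hβ, ← hzz] at h3
  have h4 : |2 * (starRingEnd ℂ p * (starRingEnd ℂ α * inner ℂ (ψ (e i)) r)).re
      + 2 * (starRingEnd ℂ p * u).re| ≤ 2 * (6 * ‖A' - A‖ ^ 2 / γ ^ 2) := by
    rw [← mul_add, ← Complex.add_re, ← mul_add, abs_mul, abs_two]
    gcongr
    refine (Complex.abs_re_le_norm _).trans ?_
    rw [norm_mul, RCLike.norm_conj]
    exact (mul_le_of_le_one_left (norm_nonneg _) hp1).trans h1
  have h5 : |2 * (p * (starRingEnd ℂ β * inner ℂ (φ (e i)) q)).re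
      + 2 * (p * v).re| ≤ 2 * (6 * ‖B' - B‖ ^ 2 / γ ^ 2) := by
    rw [← mul_add, ← Complex.add_re, ← mul_add, abs_mul, abs_two]
    gcongr
    refine (Complex.abs_re_le_norm _).trans ?_
    rw [norm_mul]
    exact (mul_le_of_le_one_left (norm_nonneg _) hp1).trans h2
  have h6 : ‖r‖ ^ 2 ≤ (2 * ‖A' - A‖ / γ) ^ 2 := pow_le_pow_left₀ (norm_nonneg _) hrn 2
  have h7 : ‖q‖ ^ 2 ≤ (2 * ‖B' - B‖ / γ) ^ 2 := pow_le_pow_left₀ (norm_nonneg _) hqn 2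
  have e3 : 60 / γ ^ 2 * (‖A' - A‖ ^ 2 + ‖B' - B‖ ^ 2) =
      12 * ((2 * ‖A' - A‖ / γ) ^ 2 + (2 * ‖B' - B‖ / γ) ^ 2) +
      2 * (6 * ‖A' - A‖ ^ 2 / γ ^ 2) + 2 * (6 * ‖B' - B‖ ^ 2 / γ ^ 2) := by
    field_simp; ring
  rw [e3, hp']
  rw [abs_le] at h3 h4 h5 ⊢
  constructor <;> linarith [h3.1, h3.2, h4.1, h4.2, h5.1, h5.2]

end EigenPerturbation

section EigenBand

variable {H ι : Type*} [NormedAddCommGroup H] [InnerProductSpace ℂ H] [CompleteSpace H] {m : ℕ}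
  {e : Fin m ↪ ι}

theorem Orthonormal.countable [SecondCountableTopology H] {φ : ι → H} (h : Orthonormal ℂ φ) :
    Countable ι := by
  refine Pairwise.countable_of_isOpen_disjoint (s := fun j => Metric.ball (φ j) (1 / 2))
    (fun i j hij => Metric.ball_disjoint_ball ?_) (fun j => Metric.isOpen_ball)
    fun j => Metric.nonempty_ball.2 (by norm_num)
  have h1 : ‖φ i - φ j‖ ^ 2 = 2 := by
    rw [norm_sub_sq (𝕜 := ℂ), h.1 i, h.1 j, h.2 hij]
    norm_num
  rw [dist_eq_norm]
  nlinarith [norm_nonneg (φ i - φ j)]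

/-- Coefficients of the vector which represents the weight operator. -/
def weightCoef (lam : ι → ℝ) (φ ψ : ι → H) (k j : ι) : ℂ :=
  4 * (((lam k * (hsInner (tensorOp (φ k) (φ j)) (tensorOp (ψ k) (ψ k))).re)
      / (lam k * lam j - lam k ^ 2) : ℝ) : ℂ)

theorem hsInner_tensorOp_tensorOp (f g u v : H) :
    hsInner (tensorOp f g) (tensorOp u v) = inner ℂ g v * inner ℂ u f := by
  rw [hsInner_tensorOp, tensorOp, InnerProductSpace.rankOne_apply, inner_smul_right]

theorem norm_weightCoef_le {lam : ι → ℝ} {φ ψ : ι → H} {k : ι} {γ : ℝ} (hγ : 0 < γ)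
    (hpos : 0 < lam k) (hgap : ∀ j ≠ k, γ ≤ |lam j - lam k|) (hφ : ‖φ k‖ = 1) (hψ : ‖ψ k‖ = 1)
    (j : ι) : ‖weightCoef lam φ ψ k j‖ ≤ 4 / γ * ‖(inner ℂ (φ j) (ψ k) : ℂ)‖ := by
  rw [weightCoef, hsInner_tensorOp_tensorOp]
  rcases eq_or_ne j k with rfl | hj
  · rw [← sq, sub_self, div_zero]
    simp; positivity
  · have e1 : lam k * (inner ℂ (φ j) (ψ k) * inner ℂ (ψ k) (φ k) : ℂ).re /
        (lam k * lam j - lam k ^ 2) =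
        (inner ℂ (φ j) (ψ k) * inner ℂ (ψ k) (φ k) : ℂ).re / (lam j - lam k) := by
      rw [sq, ← mul_sub, mul_div_mul_left _ _ hpos.ne']
    have h2 : |(inner ℂ (φ j) (ψ k) * inner ℂ (ψ k) (φ k) : ℂ).re| ≤
        ‖(inner ℂ (φ j) (ψ k) : ℂ)‖ := by
      refine (Complex.abs_re_le_norm _).trans ?_
      rw [norm_mul]
      refine mul_le_of_le_one_right (norm_nonneg _) ?_
      simpa [hφ, hψ] using norm_inner_le_norm (𝕜 := ℂ) (ψ k) (φ k)
    rw [e1, norm_mul, Complex.norm_real, Real.norm_eq_abs, abs_div, div_mul_eq_mul_div]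
    rw [show ‖(4 : ℂ)‖ = 4 by simp, mul_div_assoc]
    have := hgap j hj
    gcongr

variable {A : H →L[ℂ] H}

theorem IsEigensystem.weightOp_eq {lam : ι → ℝ} {φ ψ : ι → H} (h : IsEigensystem e A lam φ) {k : ι}
    {γ : ℝ} (hγ : 0 < γ) (hpos : 0 < lam k) (hgap : ∀ j ≠ k, γ ≤ |lam j - lam k|)
    (hψ : ‖ψ k‖ = 1) :
    weightOp lam φ ψ k = tensorOp (coefVec φ (weightCoef lam φ ψ k)) (φ k) := by
  obtain ⟨hs, -, -⟩ := h.coefVec_spec (by positivity : 0 ≤ 4 / γ)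
    (norm_weightCoef_le hγ hpos hgap (h.norm_eq_one k) hψ)
  have h1 := hs.mapL ((InnerProductSpace.rankOne ℂ : H →L[ℂ] H →L⋆[ℂ] H →L[ℂ] H).flip (φ k))
  rw [weightOp, ← tsum_const_smul'']
  rw [show tensorOp (coefVec φ (weightCoef lam φ ψ k)) (φ k) =
    ((InnerProductSpace.rankOne ℂ : H →L[ℂ] H →L⋆[ℂ] H →L[ℂ] H).flip (φ k))
      (coefVec φ (weightCoef lam φ ψ k)) from rfl, ← h1.tsum_eq]
  rw [← tsum_subtype_eq_of_support_subset (s := {j | j ≠ k})]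
  · refine tsum_congr fun j => ?_
    rw [smul_smul, map_smul]
    rfl
  · intro j hj
    simp only [Function.mem_support, Set.mem_ofPred_eq] at hj ⊢
    rintro rfl
    refine hj ?_
    rw [weightCoef, ← sq, sub_self, div_zero]
    simp

/-- A measurable family of eigensystems on a frequency band, with a uniform spectral gap at the
position `e i`. -/
structure EigenBand (α β : ℝ) (F : ℝ → HSSpace H) (e : Fin m ↪ ι) (i : Fin m) (lam : ℝ → ι → ℝ)
    (φ : ℝ → ι → H) (γ : ℝ) : Prop where
  cont : Continuous F
  eig : ∀ ω ∈ Set.Icc α β, IsEigensystem e (hsOp H (F ω)) (lam ω) (φ ω)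
  meas : ∀ j, AEStronglyMeasurable (fun ω => φ ω j) (volume.restrict (Set.Icc α β))
  pos : ∀ ω ∈ Set.Icc α β, 0 < lam ω (e i)
  gap_pos : 0 < γ
  gap : ∀ ω ∈ Set.Icc α β, ∀ j ≠ e i, γ ≤ |lam ω j - lam ω (e i)|

theorem exists_eigenBand {α β : ℝ} {F : ℝ → HSSpace H} (hF : Continuous F)
    {lam : ℝ → ι → ℝ} {φ : ℝ → ι → H}
    (heig : ∀ ω ∈ Set.Icc α β, IsEigensystem e (hsOp H (F ω)) (lam ω) (φ ω))
    (hmeas : ∀ j, AEStronglyMeasurable (fun ω => φ ω j) (volume.restrict (Set.Icc α β)))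
    (hsep : ∀ ω ∈ Set.Icc α β, StrictAnti (fun i => lam ω (e i)) ∧ ∀ i, 0 < lam ω (e i))
    (i : Fin m) (hi : (i : ℕ) + 1 < m) : ∃ γ, EigenBand α β F e i lam φ γ := by
  have hcont : ∀ i, ContinuousOn (fun ω => lam ω (e i)) (Set.Icc α β) := by
    intro i ω hω
    have h1 : Tendsto (fun ω' => ‖hsOp H (F ω') - hsOp H (F ω)‖) (𝓝[Set.Icc α β] ω) (𝓝 0) := by
      have hc : Continuous fun ω' => ‖hsOp H (F ω') - hsOp H (F ω)‖ :=
        (((hsOp H).continuous.comp hF).sub continuous_const).norm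
      have := hc.continuousWithinAt (s := Set.Icc α β) (x := ω)
      simpa [ContinuousWithinAt] using this
    refine tendsto_iff_dist_tendsto_zero.2 (squeeze_zero' (Eventually.of_forall fun _ => dist_nonneg)
      ?_ h1)
    filter_upwards [self_mem_nhdsWithin] with ω' hω'
    exact (heig ω hω).abs_eigenvalue_sub_le (heig ω' hω') i
  have hg : ∀ i' : Fin m, ∃ γ : ℝ, 0 < γ ∧ (i' ≠ i →
      ∀ ω ∈ Set.Icc α β, γ ≤ |lam ω (e i') - lam ω (e i)|) := by
    intro i'
    rcases (Set.Icc α β).eq_empty_or_nonempty with hemp | hne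
    · exact ⟨1, one_pos, fun _ ω hω => by rw [hemp] at hω; exact hω.elim⟩
    rcases eq_or_ne i' i with rfl | hii
    · exact ⟨1, one_pos, fun h => (h rfl).elim⟩
    obtain ⟨ω₀, hω₀, hmin⟩ := isCompact_Icc.exists_isMinOn hne ((hcont i').sub (hcont i)).abs
    refine ⟨|lam ω₀ (e i') - lam ω₀ (e i)|, abs_pos.2 (sub_ne_zero.2 ?_), fun _ ω hω => hmin hω⟩
    exact fun h => hii ((hsep ω₀ hω₀).1.injective h)
  choose g hg0 hg using hg
  have hne : (Finset.univ : Finset (Fin m)).Nonempty := ⟨i, Finset.mem_univ _⟩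
  refine ⟨Finset.univ.inf' hne g, hF, heig, hmeas, fun ω hω => (hsep ω hω).2 i,
    (Finset.lt_inf'_iff _).2 fun i' _ => hg0 i', fun ω hω j hj => ?_⟩
  by_cases hr : j ∈ Set.range e
  · obtain ⟨i', rfl⟩ := hr
    exact (Finset.inf'_le _ (Finset.mem_univ i')).trans (hg i' (fun h => hj (by rw [h])) ω hω)
  · set i₁ : Fin m := ⟨i + 1, hi⟩ with hi₁
    have hlt : i < i₁ := Fin.lt_def.2 (Nat.lt_succ_self _)
    refine (Finset.inf'_le _ (Finset.mem_univ i₁)).trans ((hg i₁ hlt.ne' ω hω).trans ?_)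
    have h1 : lam ω (e i₁) < lam ω (e i) := (hsep ω hω).1 hlt
    have h2 : lam ω j ≤ lam ω (e i₁) := (heig ω hω).top j hr i₁
    rw [abs_sub_comm, abs_of_nonneg (by linarith), abs_sub_comm, abs_of_nonneg (by linarith)]
    linarith

theorem EigenBand.mono {α β : ℝ} {F : ℝ → HSSpace H} {i : Fin m} {lam : ℝ → ι → ℝ}
    {φ : ℝ → ι → H} {γ γ' : ℝ} (h : EigenBand α β F e i lam φ γ) (hγ' : 0 < γ') (hle : γ' ≤ γ) :
    EigenBand α β F e i lam φ γ' :=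
  ⟨h.cont, h.eig, h.meas, h.pos, hγ', fun ω hω j hj => hle.trans (h.gap ω hω j hj)⟩

variable {α β : ℝ} {F G : ℝ → HSSpace H} {i : Fin m} {lam κ : ℝ → ι → ℝ} {φ ψ : ℝ → ι → H} {γ : ℝ}

theorem EigenBand.aestronglyMeasurable_eigenvalue (h : EigenBand α β F e i lam φ γ) (j : ι) :
    AEStronglyMeasurable (fun ω => lam ω j) (volume.restrict (Set.Icc α β)) := by
  have h1 : AEStronglyMeasurable (fun ω => hsOp H (F ω) (φ ω j))
      (volume.restrict (Set.Icc α β)) :=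
    (isBoundedBilinearMap_apply (𝕜 := ℂ) (E := H) (F := H)).continuous.comp_aestronglyMeasurable
      ((((hsOp H).continuous.comp h.cont).aestronglyMeasurable).prodMk (h.meas j))
  refine (Complex.continuous_re.comp_aestronglyMeasurable ((h.meas j).inner (𝕜 := ℂ) h1)).congr ?_
  refine (ae_restrict_iff' measurableSet_Icc).2 (ae_of_all _ fun ω hω => ?_)
  have hω := h.eig ω hω
  show (inner ℂ (φ ω j) (hsOp H (F ω) (φ ω j)) : ℂ).re = lam ω j
  rw [hω.inner_apply, inner_self_eq_norm_sq_to_K, hω.norm_eq_one]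
  simp

theorem EigenBand.aestronglyMeasurable_coefVec [SecondCountableTopology H]
    (h : EigenBand α β F e i lam φ γ) {c : ℝ → ι → ℂ} {K : ℝ} (hK : 0 ≤ K) {v : ℝ → H}
    (hc : ∀ j, AEStronglyMeasurable (fun ω => c ω j) (volume.restrict (Set.Icc α β)))
    (hle : ∀ ω ∈ Set.Icc α β, ∀ j, ‖c ω j‖ ≤ K * ‖(inner ℂ (φ ω j) (v ω) : ℂ)‖) :
    AEStronglyMeasurable (fun ω => coefVec (φ ω) (c ω)) (volume.restrict (Set.Icc α β)) := by
  rcases (Set.Icc α β).eq_empty_or_nonempty with hemp | ⟨ω₀, hω₀⟩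
  · rw [hemp, Measure.restrict_empty]
    exact aestronglyMeasurable_zero_measure _
  have : Countable ι := (h.eig ω₀ hω₀).orthonormal.countable
  refine aestronglyMeasurable_of_tendsto_ae (atTop : Filter (Finset ι))
    (f := fun s ω => ∑ j ∈ s, c ω j • φ ω j) (fun s => ?_) ?_
  · exact Finset.aestronglyMeasurable_fun_sum s fun j _ => (hc j).smul (h.meas j)
  · refine (ae_restrict_iff' measurableSet_Icc).2 (ae_of_all _ fun ω hω => ?_)
    exact ((h.eig ω hω).coefVec_spec hK (hle ω hω)).1

/-- The vector representing the first order term of the perturbed overlap. -/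
def overlapVec (lam : ι → ℝ) (φ ψ : ι → H) (k : ι) : H :=
  (inner ℂ (ψ k) (φ k) : ℂ) • coefVec φ (resolventCoef lam φ k (ψ k))

theorem EigenBand.memLp_overlap [SecondCountableTopology H] (h : EigenBand α β F e i lam φ γ)
    (h' : EigenBand α β G e i κ ψ γ) :
    MemLp (fun ω => hsTensor H (overlapVec (lam ω) (φ ω) (ψ ω) (e i)) (φ ω (e i))) 2
      (volume.restrict (Set.Icc α β)) := by
  have hγ := h.gap_pos
  have h1 : AEStronglyMeasurable (fun ω => overlapVec (lam ω) (φ ω) (ψ ω) (e i))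
      (volume.restrict (Set.Icc α β)) := by
    refine ((h'.meas (e i)).inner (𝕜 := ℂ) (h.meas (e i))).smul
      (h.aestronglyMeasurable_coefVec (inv_nonneg.2 hγ.le) (v := fun ω => ψ ω (e i)) (fun j => ?_)
      fun ω hω => norm_resolventCoef_le hγ (h.gap ω hω) _)
    have h2 := (h.aestronglyMeasurable_eigenvalue j).sub
      (h.aestronglyMeasurable_eigenvalue (e i))
    have h3 : AEStronglyMeasurable (fun ω => ((lam ω j - lam ω (e i) : ℝ) : ℂ)⁻¹)
        (volume.restrict (Set.Icc α β)) :=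
      ((Complex.measurable_ofReal.comp_aemeasurable h2.aemeasurable).inv).aestronglyMeasurable
    exact h3.mul ((h.meas j).inner (𝕜 := ℂ) (h'.meas (e i)))
  refine MemLp.of_bound ((hsTensor H).aestronglyMeasurable_comp₂ h1 (h.meas (e i))) γ⁻¹ ?_
  refine (ae_restrict_iff' measurableSet_Icc).2 (ae_of_all _ fun ω hω => ?_)
  have hφ := (h.eig ω hω).norm_eq_one (e i)
  have hψ := (h'.eig ω hω).norm_eq_one (e i)
  rw [norm_hsTensor, hφ, mul_one, overlapVec, norm_smul]
  obtain ⟨-, hn, -⟩ := (h.eig ω hω).coefVec_spec (inv_nonneg.2 hγ.le)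
    (norm_resolventCoef_le (φ := φ ω) hγ (h.gap ω hω) (ψ ω (e i)))
  rw [hψ, mul_one] at hn
  refine (mul_le_of_le_one_left (norm_nonneg _) ?_).trans hn
  simpa [hφ, hψ] using norm_inner_le_norm (𝕜 := ℂ) (ψ ω (e i)) (φ ω (e i))

theorem EigenBand.memLp_weight [SecondCountableTopology H] (h : EigenBand α β F e i lam φ γ)
    (h' : EigenBand α β G e i κ ψ γ) :
    MemLp (fun ω => hsTensor H (coefVec (φ ω) (weightCoef (lam ω) (φ ω) (ψ ω) (e i)))
      (φ ω (e i))) 2 (volume.restrict (Set.Icc α β)) := by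
  have hγ := h.gap_pos
  have hle : ∀ ω ∈ Set.Icc α β, ∀ j, ‖weightCoef (lam ω) (φ ω) (ψ ω) (e i) j‖ ≤
      4 / γ * ‖(inner ℂ (φ ω j) (ψ ω (e i)) : ℂ)‖ := fun ω hω =>
    norm_weightCoef_le hγ (h.pos ω hω) (h.gap ω hω) ((h.eig ω hω).norm_eq_one _)
      ((h'.eig ω hω).norm_eq_one _)
  have h1 : AEStronglyMeasurable
      (fun ω => coefVec (φ ω) (weightCoef (lam ω) (φ ω) (ψ ω) (e i)))
      (volume.restrict (Set.Icc α β)) := by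
    refine h.aestronglyMeasurable_coefVec (by positivity : 0 ≤ 4 / γ)
      (v := fun ω => ψ ω (e i)) (fun j => ?_) hle
    simp only [weightCoef, hsInner_tensorOp_tensorOp]
    have hlj := (h.aestronglyMeasurable_eigenvalue j).aemeasurable
    have hlk := (h.aestronglyMeasurable_eigenvalue (e i)).aemeasurable
    have h2 := (Complex.measurable_re.comp_aemeasurable
      ((((h.meas j).inner (𝕜 := ℂ) (h'.meas (e i))).mul
      ((h'.meas (e i)).inner (𝕜 := ℂ) (h.meas (e i))))).aemeasurable)
    have h3 := (hlk.mul h2).div ((hlk.mul hlj).sub (hlk.pow_const 2))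
    exact ((Complex.measurable_ofReal.comp_aemeasurable h3).const_mul 4).aestronglyMeasurable
  refine MemLp.of_bound ((hsTensor H).aestronglyMeasurable_comp₂ h1 (h.meas (e i))) (4 / γ) ?_
  refine (ae_restrict_iff' measurableSet_Icc).2 (ae_of_all _ fun ω hω => ?_)
  have hφ := (h.eig ω hω).norm_eq_one (e i)
  have hψ := (h'.eig ω hω).norm_eq_one (e i)
  rw [norm_hsTensor, hφ, mul_one]
  obtain ⟨-, hn, -⟩ := (h.eig ω hω).coefVec_spec (by positivity : 0 ≤ 4 / γ) (hle ω hω)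
  rwa [hψ, mul_one] at hn

end EigenBand

section TotalBound

variable {Ω H : Type*} {mΩ : MeasurableSpace Ω} [NormedAddCommGroup H] [InnerProductSpace ℂ H]
  [CompleteSpace H] {μ : Measure Ω} [IsProbabilityMeasure μ] {M : ℤ → MeasurableSpace Ω}
  {V : ℤ → Ω → H} {C : ℤ → HSSpace H} {q ℓ : ℝ} {d : ℤ → ℝ} {w : ℝ → ℝ} {b : ℕ → ℝ}

/-- A common bound `y` for the error functionals of a sample path `v` of length `T`. -/
structure PathBound (w : ℝ → ℝ) (b : ℝ) (T : ℕ) (C : ℤ → HSSpace H) (U W : ℝ → HSSpace H)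
    (ν : Measure ℝ) (v : ℤ → H) (y : ℝ) : Prop where
  sqrt_le : Real.sqrt b ≤ y
  lin_le : ∀ m ≤ T, Real.sqrt (b / T) * ‖∫ ω, inner ℂ (U ω) (lagForm w b C v m ω) ∂ν‖ ≤ y
  lin_le' : ∀ m ≤ T, Real.sqrt (b / T) * ‖∫ ω, inner ℂ (W ω) (lagForm w b C v m ω) ∂ν‖ ≤ y
  sq_le : ∀ m ≤ T, b / T * (∫ ω, ‖lagForm w b C v m ω‖ ^ 2 ∂ν) / Real.sqrt (b * T) ≤ y

theorem ofReal_integral_norm_sq (hC : Summable fun h => ‖C h‖) (w : ℝ → ℝ) (b : ℝ) (v : ℤ → H)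
    (m : ℕ) (ν : Measure ℝ) [IsFiniteMeasure ν] :
    ENNReal.ofReal (∫ ω, ‖lagForm w b C v m ω‖ ^ 2 ∂ν) = ∫⁻ ω, ‖lagForm w b C v m ω‖ₑ ^ 2 ∂ν := by
  obtain ⟨c, hc⟩ := exists_norm_lagForm_le w b hC v m
  have hc0 : 0 ≤ c := (norm_nonneg _).trans (hc 0)
  have hcont := continuous_lagForm w b hC v m
  rw [ofReal_integral_eq_lintegral_ofReal]
  · refine lintegral_congr fun ω => ?_
    rw [ENNReal.ofReal_pow (norm_nonneg _), ofReal_norm]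
  · refine Integrable.of_bound (hcont.norm.pow 2).aestronglyMeasurable (c ^ 2)
      (ae_of_all _ fun ω => ?_)
    rw [norm_pow, norm_norm]
    exact pow_le_pow_left₀ (norm_nonneg _) (hc ω) 2
  · exact ae_of_all _ fun ω => by positivity

theorem LagProcess.exists_pathBound (h : LagProcess M μ V C q ℓ d) (hq : 2 < q)
    (hr : LagRate w b ℓ) {α β : ℝ} (hα : 0 ≤ α) (hβ : β ≤ Real.pi) {U W : ℝ → HSSpace H}
    (hU : MemLp U 2 (volume.restrict (Set.Icc α β)))
    (hW : MemLp W 2 (volume.restrict (Set.Icc α β))) {e : ℝ≥0∞} (he : e ≠ 0) :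
    ∀ᶠ T in atTop, ∃ Y : Ω → ℝ≥0∞, AEMeasurable Y μ ∧ ∫⁻ x, Y x ∂μ ≤ e ∧
      ∀ x, Y x ≠ ∞ → PathBound w (b T) T C U W (volume.restrict (Set.Icc α β)) (fun t => V t x)
        (Y x).toReal := by
  set ν := volume.restrict (Set.Icc α β) with hν
  have hc := h.summable_norm (by linarith [hr.one_le])
  have he4 : e / 4 ≠ 0 := ENNReal.div_ne_zero.2 ⟨he, by finiteness⟩
  obtain ⟨c, hcf, hA⟩ := h.exists_lintegral_sq_le hq hr ν
  have ht1 : ∀ᶠ T in atTop, ENNReal.ofReal (Real.sqrt (b T)) ≤ e / 4 := by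
    have : Tendsto (fun T => ENNReal.ofReal (Real.sqrt (b T))) atTop (𝓝 0) := by
      simpa using ENNReal.tendsto_ofReal hr.tendsto_zero.sqrt
    exact this.eventually_le_const (pos_iff_ne_zero.2 he4)
  have ht2 : ∀ᶠ T : ℕ in atTop, ENNReal.ofReal (Real.sqrt (b T * T))⁻¹ * c ≤ e / 4 := by
    have h1 : Tendsto (fun T : ℕ => (Real.sqrt (b T * T))⁻¹) atTop (𝓝 0) :=
      tendsto_inv_atTop_zero.comp (Real.tendsto_sqrt_atTop.comp hr.tendsto_mul)
    have : Tendsto (fun T : ℕ => ENNReal.ofReal (Real.sqrt (b T * T))⁻¹ * c) atTop (𝓝 0) := by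
      simpa using ENNReal.Tendsto.mul_const (ENNReal.tendsto_ofReal h1) (Or.inr hcf)
    exact this.eventually_le_const (pos_iff_ne_zero.2 he4)
  filter_upwards [hA, ht1, ht2, h.exists_integral_inner_le hq hr hα hβ hU he4,
    h.exists_integral_inner_le hq hr hα hβ hW he4, hr.pos] with T hA ht1 ht2 hU hW hT
  obtain ⟨hbT, hT0⟩ := hT
  have hT0' : (0 : ℝ) < T := by exact_mod_cast hT0
  obtain ⟨Y₁, hm₁, hY₁, hi₁⟩ := hA
  obtain ⟨Y₂, hm₂, hY₂, hi₂⟩ := hU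
  obtain ⟨Y₃, hm₃, hY₃, hi₃⟩ := hW
  set ρ := ENNReal.ofReal (Real.sqrt (b T * T))⁻¹ with hρ
  refine ⟨fun x => ENNReal.ofReal (Real.sqrt (b T)) + ρ * Y₁ x + Y₂ x + Y₃ x,
    (((hm₁.const_mul ρ).const_add _).add hm₂).add hm₃, ?_, fun x hx => ?_⟩
  · rw [lintegral_add_right' _ hm₃, lintegral_add_right' _ hm₂,
      lintegral_add_right' _ (hm₁.const_mul ρ), lintegral_const, measure_univ, mul_one,
      lintegral_const_mul'' _ hm₁]
    calc _ ≤ e / 4 + e / 4 + e / 4 + e / 4 := by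
          gcongr
          exact (mul_le_mul_right hi₁ ρ).trans ht2
      _ = 4 * (e / 4) := by ring
      _ ≤ e := ENNReal.mul_div_le
  · have hle : ∀ {z : ℝ}, ENNReal.ofReal z ≤ ENNReal.ofReal (Real.sqrt (b T)) + ρ * Y₁ x + Y₂ x +
        Y₃ x → z ≤ (ENNReal.ofReal (Real.sqrt (b T)) + ρ * Y₁ x + Y₂ x + Y₃ x).toReal :=
      fun hz => (ENNReal.ofReal_le_iff_le_toReal hx).1 hz
    refine ⟨hle ?_, fun m hm => hle ?_, fun m hm => hle ?_, fun m hm => hle ?_⟩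
    · exact le_self_add.trans (le_self_add.trans le_self_add)
    · rw [ENNReal.ofReal_mul (Real.sqrt_nonneg _), ofReal_norm]
      exact (hY₂ m hm x).trans (le_add_self.trans le_self_add)
    · rw [ENNReal.ofReal_mul (Real.sqrt_nonneg _), ofReal_norm]
      exact (hY₃ m hm x).trans le_add_self
    · refine le_trans (le_trans (le_of_eq ?_) (mul_le_mul_right (hY₁ m hm x) ρ))
        (le_add_self.trans (le_self_add.trans le_self_add))
      simp_rw [mul_pow]
      rw [lintegral_const_mul' _ _ (by finiteness), ← ofReal_integral_norm_sq hc, hρ,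
        ← ENNReal.ofReal_pow (Real.sqrt_nonneg _), Real.sq_sqrt (by positivity),
        ← ENNReal.ofReal_mul (by positivity), ← ENNReal.ofReal_mul (by positivity)]
      congr 1
      rw [div_eq_inv_mul]

end TotalBound

section ScalarBounds

variable {b η r c y J I : ℝ} {T m : ℕ}

theorem sqrt_mul_div_eq (hb : 0 < b) (hT : 0 < T) :
    Real.sqrt (b * T) / T = Real.sqrt (b / T) := by
  have hT0 : (0 : ℝ) < T := by exact_mod_cast hT
  rw [div_eq_iff hT0.ne', ← Real.sqrt_sq hT0.le, ← Real.sqrt_mul (by positivity),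
    Real.sqrt_sq hT0.le]
  congr 1
  field_simp

theorem rate_mul_lin_le (hb : 0 < b) (hT : 0 < T) (hη : 0 ≤ η) (hη1 : η ≤ 1) (hm : 1 ≤ m)
    (hηm : η * T ≤ 2 * m) (hc : 0 ≤ c) (hr : r ≤ c * Real.sqrt (b * T)) (hJ : 0 ≤ J)
    (hy : Real.sqrt (b / T) * J ≤ y) : r * (η ^ 2 * (J / m)) ≤ 2 * c * y := by
  have hT0 : (0 : ℝ) < T := by exact_mod_cast hT
  have hm0 : (0 : ℝ) < m := by exact_mod_cast hm
  have h1 : η ^ 2 * (J / m) ≤ 2 * J / T := by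
    rw [mul_div_assoc', div_le_div_iff₀ hm0 hT0]
    calc η ^ 2 * J * T = η * (η * T) * J := by ring
      _ ≤ 1 * (2 * m) * J := by gcongr
      _ = _ := by ring
  calc r * (η ^ 2 * (J / m)) ≤ c * Real.sqrt (b * T) * (2 * J / T) :=
        mul_le_mul hr h1 (by positivity) (by positivity)
    _ = 2 * c * (Real.sqrt (b * T) / T * J) := by ring
    _ ≤ 2 * c * y := by rw [sqrt_mul_div_eq hb hT]; gcongr

theorem rate_mul_lin_le' (hb : 0 < b) (hT : 0 < T) (hη : 0 ≤ η) (hη1 : η ≤ 1) (hc : 0 ≤ c)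
    (hr : r ≤ c * Real.sqrt (b * T)) (hJ : 0 ≤ J) (hy : Real.sqrt (b / T) * J ≤ y) :
    r * (η * (Real.sqrt b / Real.sqrt T * J / Real.sqrt (b * T))) ≤ c * y := by
  have hT0 : (0 : ℝ) < T := by exact_mod_cast hT
  have h0 : 0 ≤ Real.sqrt b / Real.sqrt T * J / Real.sqrt (b * T) := by positivity
  have hs : 0 < Real.sqrt (b * T) := Real.sqrt_pos.2 (by positivity)
  calc r * (η * (Real.sqrt b / Real.sqrt T * J / Real.sqrt (b * T)))
      ≤ c * Real.sqrt (b * T) * (1 * (Real.sqrt b / Real.sqrt T * J / Real.sqrt (b * T))) :=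
        mul_le_mul hr (by gcongr) (by positivity) (by positivity)
    _ = c * (Real.sqrt (b / T) * J) := by
        rw [Real.sqrt_div hb.le]
        field_simp
    _ ≤ c * y := by gcongr

theorem rate_mul_sq_le (hb : 0 < b) (hT : 0 < T) (hη : 0 ≤ η) (hm : 1 ≤ m)
    (hηm : η * T ≤ 2 * m) (hc : 0 ≤ c) (hr : r ≤ c * Real.sqrt (b * T)) (hI : 0 ≤ I)
    (hy : b / T * I / Real.sqrt (b * T) ≤ y) : r * (η ^ 2 * (I / m ^ 2)) ≤ 4 * c * y := by
  have hT0 : (0 : ℝ) < T := by exact_mod_cast hT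
  have hm0 : (0 : ℝ) < m := by exact_mod_cast hm
  have hs : 0 < Real.sqrt (b * T) := Real.sqrt_pos.2 (by positivity)
  have h1 : η ^ 2 * (I / m ^ 2) ≤ 4 * I / T ^ 2 := by
    rw [mul_div_assoc', div_le_div_iff₀ (by positivity) (by positivity)]
    calc η ^ 2 * I * T ^ 2 = (η * T) ^ 2 * I := by ring
      _ ≤ (2 * m) ^ 2 * I := by gcongr
      _ = _ := by ring
  have h2 : Real.sqrt (b * T) / T ^ 2 = b / T / Real.sqrt (b * T) := by
    rw [div_eq_div_iff (by positivity) hs.ne', Real.mul_self_sqrt (by positivity)]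
    field_simp
  calc r * (η ^ 2 * (I / m ^ 2)) ≤ c * Real.sqrt (b * T) * (4 * I / T ^ 2) :=
        mul_le_mul hr h1 (by positivity) (by positivity)
    _ = 4 * c * (Real.sqrt (b * T) / T ^ 2 * I) := by ring
    _ = 4 * c * (b / T * I / Real.sqrt (b * T)) := by rw [h2]; ring
    _ ≤ 4 * c * y := by gcongr

theorem rate_mul_sq_le_of_lt (hb : 0 < b) (hT : 0 < T) (hη : 0 ≤ η) (hηT : η * T ≤ 1)
    (hc : 0 ≤ c) (hr : r ≤ c * Real.sqrt (b * T)) (hy : Real.sqrt b ≤ y) : r * η ^ 2 ≤ c * y := by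
  have hT1 : (1 : ℝ) ≤ T := by exact_mod_cast hT
  have h1 : Real.sqrt T * η ^ 2 ≤ 1 := by
    have h2 : Real.sqrt T ≤ T ^ 2 := by
      rw [Real.sqrt_le_left (by positivity)]
      calc (T : ℝ) = T ^ 1 := (pow_one _).symm
        _ ≤ T ^ 4 := pow_le_pow_right₀ hT1 (by norm_num)
        _ = _ := by ring
    calc Real.sqrt T * η ^ 2 ≤ T ^ 2 * η ^ 2 := by gcongr
      _ = (η * T) ^ 2 := by ring
      _ ≤ 1 := pow_le_one₀ (by positivity) hηT
  calc r * η ^ 2 ≤ c * Real.sqrt (b * T) * η ^ 2 := by gcongr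
    _ = c * Real.sqrt b * (Real.sqrt T * η ^ 2) := by rw [Real.sqrt_mul hb.le]; ring
    _ ≤ c * Real.sqrt b * 1 := by gcongr
    _ ≤ c * y := by rw [mul_one]; gcongr

end ScalarBounds

section Remainder

variable {H ι : Type*} [NormedAddCommGroup H] [InnerProductSpace ℂ H] [CompleteSpace H] {k₀ : ℕ}
  {e : Fin k₀ ↪ ι} {α β : ℝ} {i : Fin k₀}

theorem seqEstimator_sub_eq (w : ℝ → ℝ) (b : ℝ) (T : ℕ) (v : ℤ → H) (C : ℤ → HSSpace H) (η ω : ℝ)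
    (hm : 1 ≤ ⌊η * T⌋₊) : seqEstimator w b T v η ω - hsOp H (specHS C ω) =
      ((⌊η * T⌋₊ : ℂ))⁻¹ • hsOp H (lagForm w b C v ⌊η * T⌋₊ ω) := by
  have hm0 : ((⌊η * T⌋₊ : ℕ) : ℂ) ≠ 0 := by
    exact_mod_cast (by omega : ⌊η * T⌋₊ ≠ 0)
  rw [seqEstimator, lagForm, quadForm, map_sub, smul_sub, map_smul, inv_smul_smul₀ hm0]
  simp_rw [map_sum, map_smul, hsOp_hsTensor]

theorem partialSumProcess_eq (w : ℝ → ℝ) (b : ℝ) (T : ℕ) (v : ℤ → H) (C : ℤ → HSSpace H)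
    (η ω : ℝ) : partialSumProcess w b T v (hsOp H (specHS C ω)) η ω =
      ((Real.sqrt b / Real.sqrt T : ℝ) : ℂ) • hsOp H (lagForm w b C v ⌊η * T⌋₊ ω) := by
  rw [partialSumProcess, lagForm, quadForm, map_sub, map_smul]
  simp_rw [map_sum, map_smul, hsOp_hsTensor]
  rw [Finset.sum_sub_distrib, Finset.sum_const, Nat.card_Icc, Nat.add_sub_cancel,
    Nat.cast_smul_eq_nsmul]

/-- Squared overlap of unit vectors. -/
def overlap (f g : ℝ → H) (ω : ℝ) : ℝ := ‖(inner ℂ (g ω) (f ω) : ℂ)‖ ^ 2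

theorem overlap_nonneg (f g : ℝ → H) (ω : ℝ) : 0 ≤ overlap f g ω := by
  unfold overlap; positivity

theorem overlap_le_one {f g : ℝ → H} {ω : ℝ} (hf : ‖f ω‖ = 1) (hg : ‖g ω‖ = 1) :
    overlap f g ω ≤ 1 := by
  refine pow_le_one₀ (norm_nonneg _) ?_
  simpa [hf, hg] using norm_inner_le_norm (𝕜 := ℂ) (g ω) (f ω)

theorem integrable_overlap {f g : ℝ → H}
    (hf : AEStronglyMeasurable f (volume.restrict (Set.Icc α β)))
    (hg : AEStronglyMeasurable g (volume.restrict (Set.Icc α β)))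
    (hf1 : ∀ ω ∈ Set.Icc α β, ‖f ω‖ = 1) (hg1 : ∀ ω ∈ Set.Icc α β, ‖g ω‖ = 1) :
    Integrable (overlap f g) (volume.restrict (Set.Icc α β)) := by
  refine Integrable.of_bound ((hg.inner (𝕜 := ℂ) hf).norm.pow 2) 1
    ((ae_restrict_iff' measurableSet_Icc).2 (ae_of_all _ fun ω hω => ?_))
  show ‖overlap f g ω‖ ≤ 1
  rw [Real.norm_of_nonneg (overlap_nonneg _ _ _)]
  exact overlap_le_one (hf1 ω hω) (hg1 ω hω)

theorem centeredDistance_eq (hαβ : α ≤ β) (η : ℝ) {fX fY gX gY : ℝ → H}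
    (hfX : ∀ ω ∈ Set.Icc α β, ‖fX ω‖ = 1) (hfY : ∀ ω ∈ Set.Icc α β, ‖fY ω‖ = 1)
    (hgX : ∀ ω ∈ Set.Icc α β, ‖gX ω‖ = 1) (hgY : ∀ ω ∈ Set.Icc α β, ‖gY ω‖ = 1) :
    centeredDistance α β η fX fY gX gY =
      -(2 * η ^ 2 * ∫ ω in Set.Icc α β, (overlap fX fY ω - overlap gX gY ω)) := by
  rw [centeredDistance, intervalIntegral.integral_of_le hαβ, ← integral_Icc_eq_integral_Ioc,
    ← integral_const_mul, ← integral_neg]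
  refine setIntegral_congr_fun measurableSet_Icc fun ω hω => ?_
  simp only [overlap]
  rw [hsNormSq_smul, hsNormSq_proj_sub (hfX ω hω) (hfY ω hω),
    hsNormSq_proj_sub (hgX ω hω) (hgY ω hω), Complex.norm_real, Real.norm_eq_abs, sq_abs,
    norm_inner_symm (fX ω), norm_inner_symm (gX ω)]
  ring

theorem abs_centeredDistance_le (hαβ : α ≤ β) {η : ℝ} {fX fY gX gY : ℝ → H}
    (hfX : ∀ ω ∈ Set.Icc α β, ‖fX ω‖ = 1) (hfY : ∀ ω ∈ Set.Icc α β, ‖fY ω‖ = 1)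
    (hgX : ∀ ω ∈ Set.Icc α β, ‖gX ω‖ = 1) (hgY : ∀ ω ∈ Set.Icc α β, ‖gY ω‖ = 1) :
    |centeredDistance α β η fX fY gX gY| ≤ 2 * (β - α) * η ^ 2 := by
  rw [centeredDistance_eq hαβ η hfX hfY hgX hgY, abs_neg, abs_mul, abs_of_nonneg (by positivity)]
  have h1 : ‖∫ ω in Set.Icc α β, (overlap fX fY ω - overlap gX gY ω)‖ ≤
      1 * volume.real (Set.Icc α β) := by
    refine norm_setIntegral_le_of_norm_le_const (by simp) fun ω hω => ?_
    have h1 := overlap_nonneg fX fY ω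
    have h2 := overlap_nonneg gX gY ω
    have h3 := overlap_le_one (hfX ω hω) (hfY ω hω)
    have h4 := overlap_le_one (hgX ω hω) (hgY ω hω)
    rw [Real.norm_eq_abs, abs_le]
    constructor <;> linarith
  rw [one_mul, Real.volume_real_Icc_of_le hαβ, Real.norm_eq_abs] at h1
  calc _ ≤ 2 * η ^ 2 * (β - α) := by gcongr
    _ = _ := by ring

variable {CX CY : ℤ → HSSpace H} {lamX lamY : ℝ → ι → ℝ} {φX φY : ℝ → ι → H} {γ : ℝ}

/-- The integral of the linear term is bounded by the linear functionals of the two paths. -/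
theorem abs_linear_term_le [SecondCountableTopology H] (hαβ : α ≤ β)
    (hX : EigenBand α β (specHS CX) e i lamX φX γ) (hY : EigenBand α β (specHS CY) e i lamY φY γ)
    (hCX : Summable fun h => ‖CX h‖) (hCY : Summable fun h => ‖CY h‖)
    (w : ℝ → ℝ) (b₁ b₂ : ℝ) (T₁ T₂ : ℕ) (vX vY : ℤ → H) (η : ℝ) (s₁ s₂ : ℝ) (hs₁ : 0 ≤ s₁)
    (hs₂ : 0 ≤ s₂) :
    |∫ ω in α..β,
        ((hsInner (partialSumProcess w b₂ T₂ vY (hsOp H (specHS CY ω)) η ω)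
            (weightOp (lamY ω) (φY ω) (φX ω) (e i))).re / s₂
          + (hsInner (partialSumProcess w b₁ T₁ vX (hsOp H (specHS CX ω)) η ω)
            (weightOp (lamX ω) (φX ω) (φY ω) (e i))).re / s₁)| ≤
      Real.sqrt b₂ / Real.sqrt T₂ * ‖∫ ω in Set.Icc α β,
        inner ℂ (hsTensor H (coefVec (φY ω) (weightCoef (lamY ω) (φY ω) (φX ω) (e i)))
          (φY ω (e i))) (lagForm w b₂ CY vY ⌊η * T₂⌋₊ ω)‖ / s₂ +
      Real.sqrt b₁ / Real.sqrt T₁ * ‖∫ ω in Set.Icc α β,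
        inner ℂ (hsTensor H (coefVec (φX ω) (weightCoef (lamX ω) (φX ω) (φY ω) (e i)))
          (φX ω (e i))) (lagForm w b₁ CX vX ⌊η * T₁⌋₊ ω)‖ / s₁ := by
  set gY : ℝ → ℂ := fun ω => inner ℂ (hsTensor H (coefVec (φY ω)
    (weightCoef (lamY ω) (φY ω) (φX ω) (e i))) (φY ω (e i)))
    (lagForm w b₂ CY vY ⌊η * T₂⌋₊ ω) with hgY
  set gX : ℝ → ℂ := fun ω => inner ℂ (hsTensor H (coefVec (φX ω)
    (weightCoef (lamX ω) (φX ω) (φY ω) (e i))) (φX ω (e i)))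
    (lagForm w b₁ CX vX ⌊η * T₁⌋₊ ω) with hgX
  have hiY : Integrable gY (volume.restrict (Set.Icc α β)) :=
    integrable_inner_lagForm hCY w b₂ vY _ ((hY.memLp_weight hX).integrable one_le_two)
  have hiX : Integrable gX (volume.restrict (Set.Icc α β)) :=
    integrable_inner_lagForm hCX w b₁ vX _ ((hX.memLp_weight hY).integrable one_le_two)
  have hre : ∀ {g : ℝ → ℂ}, Integrable g (volume.restrict (Set.Icc α β)) →
      |∫ ω in Set.Icc α β, (g ω).re| ≤ ‖∫ ω in Set.Icc α β, g ω‖ := by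
    intro g hg
    have : ∫ ω in Set.Icc α β, (g ω).re = (∫ ω in Set.Icc α β, g ω).re := integral_re hg
    rw [this]
    exact Complex.abs_re_le_norm _
  have e1 : (∫ ω in α..β,
        ((hsInner (partialSumProcess w b₂ T₂ vY (hsOp H (specHS CY ω)) η ω)
            (weightOp (lamY ω) (φY ω) (φX ω) (e i))).re / s₂
          + (hsInner (partialSumProcess w b₁ T₁ vX (hsOp H (specHS CX ω)) η ω)
            (weightOp (lamX ω) (φX ω) (φY ω) (e i))).re / s₁)) =
      Real.sqrt b₂ / Real.sqrt T₂ / s₂ * (∫ ω in Set.Icc α β, (gY ω).re) +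
      Real.sqrt b₁ / Real.sqrt T₁ / s₁ * (∫ ω in Set.Icc α β, (gX ω).re) := by
    have hreX : Integrable (fun ω => (gX ω).re) (volume.restrict (Set.Icc α β)) := hiX.re
    have hreY : Integrable (fun ω => (gY ω).re) (volume.restrict (Set.Icc α β)) := hiY.re
    rw [intervalIntegral.integral_of_le hαβ, ← integral_Icc_eq_integral_Ioc,
      ← integral_const_mul, ← integral_const_mul,
      ← integral_add (hreY.const_mul _) (hreX.const_mul _)]
    refine setIntegral_congr_fun measurableSet_Icc fun ω hω => ?_
    have hφX := (hX.eig ω hω).norm_eq_one (e i)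
    have hφY := (hY.eig ω hω).norm_eq_one (e i)
    simp only [hgX, hgY]
    rw [(hX.eig ω hω).weightOp_eq hX.gap_pos (hX.pos ω hω) (hX.gap ω hω) hφY,
      (hY.eig ω hω).weightOp_eq hY.gap_pos (hY.pos ω hω) (hY.gap ω hω) hφX,
      hsInner_tensorOp, hsInner_tensorOp, partialSumProcess_eq, partialSumProcess_eq,
      _root_.smul_apply, _root_.smul_apply, inner_smul_right, inner_smul_right,
      Complex.re_ofReal_mul, Complex.re_ofReal_mul, inner_hsTensor, inner_hsTensor]
    show _ = _ * (inner ℂ _ _ : ℂ).re + _ * (inner ℂ _ _ : ℂ).re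
    ring
  rw [e1]
  refine (abs_add_le _ _).trans (add_le_add ?_ ?_)
  · rw [abs_mul, abs_of_nonneg (by positivity)]
    calc _ ≤ Real.sqrt b₂ / Real.sqrt T₂ / s₂ * ‖∫ ω in Set.Icc α β, gY ω‖ := by
          gcongr; exact hre hiY
      _ = _ := by ring
  · rw [abs_mul, abs_of_nonneg (by positivity)]
    calc _ ≤ Real.sqrt b₁ / Real.sqrt T₁ / s₁ * ‖∫ ω in Set.Icc α β, gX ω‖ := by
          gcongr; exact hre hiX
      _ = _ := by ring

/-- Bound for the centered distance by squared errors and linear functionals of the paths. -/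
theorem abs_centeredDistance_le_of_pos [SecondCountableTopology H] (hαβ : α ≤ β)
    (hX : EigenBand α β (specHS CX) e i lamX φX γ) (hY : EigenBand α β (specHS CY) e i lamY φY γ)
    (hCX : Summable fun h => ‖CX h‖) (hCY : Summable fun h => ‖CY h‖)
    {w : ℝ → ℝ} {b₁ b₂ : ℝ} {T₁ T₂ : ℕ} {vX vY : ℤ → H} {η : ℝ}
    {lamX' lamY' : ℝ → ι → ℝ} {φX' φY' : ℝ → ι → H}
    (hX' : ∀ ω ∈ Set.Icc α β,
      IsEigensystem e (seqEstimator w b₁ T₁ vX η ω) (lamX' ω) (φX' ω))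
    (hY' : ∀ ω ∈ Set.Icc α β,
      IsEigensystem e (seqEstimator w b₂ T₂ vY η ω) (lamY' ω) (φY' ω))
    (hXm : AEStronglyMeasurable (fun ω => φX' ω (e i)) (volume.restrict (Set.Icc α β)))
    (hYm : AEStronglyMeasurable (fun ω => φY' ω (e i)) (volume.restrict (Set.Icc α β)))
    (h₁ : 1 ≤ ⌊η * T₁⌋₊) (h₂ : 1 ≤ ⌊η * T₂⌋₊) :
    |centeredDistance α β η (fun ω => φX' ω (e i)) (fun ω => φY' ω (e i))
      (fun ω => φX ω (e i)) (fun ω => φY ω (e i))| ≤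
      2 * η ^ 2 * (60 / γ ^ 2 *
        ((∫ ω in Set.Icc α β, ‖lagForm w b₁ CX vX ⌊η * T₁⌋₊ ω‖ ^ 2) / (⌊η * T₁⌋₊ : ℝ) ^ 2 +
          (∫ ω in Set.Icc α β, ‖lagForm w b₂ CY vY ⌊η * T₂⌋₊ ω‖ ^ 2) / (⌊η * T₂⌋₊ : ℝ) ^ 2) +
        2 * (‖∫ ω in Set.Icc α β, inner ℂ (hsTensor H (overlapVec (lamX ω) (φX ω) (φY ω) (e i))
          (φX ω (e i))) (lagForm w b₁ CX vX ⌊η * T₁⌋₊ ω)‖ / (⌊η * T₁⌋₊ : ℝ)) +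
        2 * (‖∫ ω in Set.Icc α β, inner ℂ (hsTensor H (overlapVec (lamY ω) (φY ω) (φX ω) (e i))
          (φY ω (e i))) (lagForm w b₂ CY vY ⌊η * T₂⌋₊ ω)‖ / (⌊η * T₂⌋₊ : ℝ))) := by
  set m₁ := ⌊η * T₁⌋₊ with hm₁
  set m₂ := ⌊η * T₂⌋₊ with hm₂
  set LX := lagForm w b₁ CX vX m₁ with hLX
  set LY := lagForm w b₂ CY vY m₂ with hLY
  set ν := volume.restrict (Set.Icc α β) with hν
  set gX : ℝ → ℂ := fun ω => inner ℂ (hsTensor H (overlapVec (lamX ω) (φX ω) (φY ω) (e i))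
    (φX ω (e i))) (LX ω) with hgX
  set gY : ℝ → ℂ := fun ω => inner ℂ (hsTensor H (overlapVec (lamY ω) (φY ω) (φX ω) (e i))
    (φY ω (e i))) (LY ω) with hgY
  set f : ℝ → ℝ := fun ω => overlap (fun ω => φX' ω (e i)) (fun ω => φY' ω (e i)) ω -
    overlap (fun ω => φX ω (e i)) (fun ω => φY ω (e i)) ω with hf
  have hγ := hX.gap_pos
  have hn₁ : (0 : ℝ) < m₁ := by exact_mod_cast h₁
  have hn₂ : (0 : ℝ) < m₂ := by exact_mod_cast h₂
  have uX : ∀ ω ∈ Set.Icc α β, ‖φX ω (e i)‖ = 1 := fun ω hω => (hX.eig ω hω).norm_eq_one _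
  have uY : ∀ ω ∈ Set.Icc α β, ‖φY ω (e i)‖ = 1 := fun ω hω => (hY.eig ω hω).norm_eq_one _
  have uX' : ∀ ω ∈ Set.Icc α β, ‖φX' ω (e i)‖ = 1 := fun ω hω => (hX' ω hω).norm_eq_one _
  have uY' : ∀ ω ∈ Set.Icc α β, ‖φY' ω (e i)‖ = 1 := fun ω hω => (hY' ω hω).norm_eq_one _
  have hiX : Integrable gX ν :=
    integrable_inner_lagForm hCX w b₁ vX _ ((hX.memLp_overlap hY).integrable one_le_two)
  have hiY : Integrable gY ν :=
    integrable_inner_lagForm hCY w b₂ vY _ ((hY.memLp_overlap hX).integrable one_le_two)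
  have hif : Integrable f ν := (integrable_overlap hXm hYm uX' uY').sub
    (integrable_overlap (hX.meas _) (hY.meas _) uX uY)
  have hsq : ∀ {b : ℝ} {C : ℤ → HSSpace H} (v : ℤ → H) (m : ℕ), (Summable fun h => ‖C h‖) →
      Integrable (fun ω => ‖lagForm w b C v m ω‖ ^ 2) ν := by
    intro b C v m hC
    obtain ⟨c, hc⟩ := exists_norm_lagForm_le w b hC v m
    refine Integrable.of_bound ((continuous_lagForm w b hC v m).norm.pow 2).aestronglyMeasurable
      (c ^ 2) (ae_of_all _ fun ω => ?_)
    rw [norm_pow, norm_norm]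
    exact pow_le_pow_left₀ (norm_nonneg _) (hc ω) 2
  have hsX := hsq (b := b₁) vX m₁ hCX
  have hsY := hsq (b := b₂) vY m₂ hCY
  have hpt : ∀ ω ∈ Set.Icc α β, ‖f ω + 2 * (m₁ : ℝ)⁻¹ * (gX ω).re + 2 * (m₂ : ℝ)⁻¹ * (gY ω).re‖ ≤
      60 / γ ^ 2 * (((m₁ : ℝ) ^ 2)⁻¹ * ‖LX ω‖ ^ 2 + ((m₂ : ℝ) ^ 2)⁻¹ * ‖LY ω‖ ^ 2) := by
    intro ω hω
    have h := abs_overlap_expansion_le (hX.eig ω hω) (hX' ω hω) (hY.eig ω hω) (hY' ω hω) i hγ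
      (hX.gap ω hω) (hY.gap ω hω)
    rw [seqEstimator_sub_eq w b₁ T₁ vX CX η ω h₁, seqEstimator_sub_eq w b₂ T₂ vY CY η ω h₂,
      ← hm₁, ← hm₂, ← hLX, ← hLY, _root_.smul_apply, _root_.smul_apply, inner_smul_right,
      inner_smul_right, norm_smul, norm_smul, norm_inv, norm_inv, Complex.norm_natCast,
      Complex.norm_natCast, mul_pow, mul_pow, inv_pow, inv_pow] at h
    have hl : ∀ (m : ℕ) (z u : ℂ), 2 * (z * ((m : ℂ)⁻¹ * u)).re = 2 * (m : ℝ)⁻¹ * (z * u).re := by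
      intro m z u
      rw [show z * ((m : ℂ)⁻¹ * u) = (((m : ℝ)⁻¹ : ℝ) : ℂ) * (z * u) by push_cast; ring,
        Complex.re_ofReal_mul]
      ring
    have hov : ∀ (φ ψ u x : H), inner ℂ φ ψ * inner ℂ u x =
        (inner ℂ ((inner ℂ ψ φ : ℂ) • u) x : ℂ) := by
      intro φ ψ u x
      rw [inner_smul_left, inner_conj_symm]
    rw [hl, hl, hov, hov] at h
    rw [Real.norm_eq_abs]
    simp only [hf, hgX, hgY, overlap, inner_hsTensor, overlapVec]
    refine h.trans ?_
    gcongr <;> exact norm_hsOp_le _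
  have hcomb : ‖∫ ω, (f ω + 2 * (m₁ : ℝ)⁻¹ * (gX ω).re + 2 * (m₂ : ℝ)⁻¹ * (gY ω).re) ∂ν‖ ≤
      60 / γ ^ 2 * (((m₁ : ℝ) ^ 2)⁻¹ * (∫ ω, ‖LX ω‖ ^ 2 ∂ν) +
        ((m₂ : ℝ) ^ 2)⁻¹ * (∫ ω, ‖LY ω‖ ^ 2 ∂ν)) := by
    rw [← integral_const_mul, ← integral_const_mul,
      ← integral_add (hsX.const_mul _) (hsY.const_mul _), ← integral_const_mul]
    exact norm_integral_le_of_norm_le (((hsX.const_mul _).add (hsY.const_mul _)).const_mul _)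
      ((ae_restrict_iff' measurableSet_Icc).2 (ae_of_all _ hpt))
  have hreX : Integrable (fun ω => (gX ω).re) ν := hiX.re
  have hreY : Integrable (fun ω => (gY ω).re) ν := hiY.re
  have hsplit : ∫ ω, (f ω + 2 * (m₁ : ℝ)⁻¹ * (gX ω).re + 2 * (m₂ : ℝ)⁻¹ * (gY ω).re) ∂ν =
      (∫ ω, f ω ∂ν) + 2 * (m₁ : ℝ)⁻¹ * (∫ ω, (gX ω).re ∂ν) +
        2 * (m₂ : ℝ)⁻¹ * (∫ ω, (gY ω).re ∂ν) := by
    have hi2 : Integrable (fun ω => f ω + 2 * (m₁ : ℝ)⁻¹ * (gX ω).re) ν :=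
      hif.add (hreX.const_mul _)
    rw [integral_add hi2 (hreY.const_mul _),
      integral_add hif (hreX.const_mul _), integral_const_mul, integral_const_mul]
  have hre : ∀ {g : ℝ → ℂ}, Integrable g ν → |∫ ω, (g ω).re ∂ν| ≤ ‖∫ ω, g ω ∂ν‖ := by
    intro g hg
    have : ∫ ω, (g ω).re ∂ν = (∫ ω, g ω ∂ν).re := integral_re hg
    rw [this]
    exact Complex.abs_re_le_norm _
  rw [centeredDistance_eq hαβ η uX' uY' uX uY, abs_neg, abs_mul, abs_of_nonneg (by positivity)]
  refine mul_le_mul_of_nonneg_left ?_ (by positivity)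
  show |∫ ω, f ω ∂ν| ≤ _
  rw [hsplit, Real.norm_eq_abs] at hcomb
  have e1 : (∫ ω, f ω ∂ν) = ((∫ ω, f ω ∂ν) + 2 * (m₁ : ℝ)⁻¹ * (∫ ω, (gX ω).re ∂ν) +
      2 * (m₂ : ℝ)⁻¹ * (∫ ω, (gY ω).re ∂ν)) - 2 * (m₁ : ℝ)⁻¹ * (∫ ω, (gX ω).re ∂ν) -
      2 * (m₂ : ℝ)⁻¹ * (∫ ω, (gY ω).re ∂ν) := by ring
  rw [e1]
  have hlX : |2 * (m₁ : ℝ)⁻¹ * ∫ ω, (gX ω).re ∂ν| ≤ 2 * (‖∫ ω, gX ω ∂ν‖ / m₁) := by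
    rw [abs_mul, abs_of_nonneg (by positivity), mul_assoc, div_eq_inv_mul]
    gcongr
    exact hre hiX
  have hlY : |2 * (m₂ : ℝ)⁻¹ * ∫ ω, (gY ω).re ∂ν| ≤ 2 * (‖∫ ω, gY ω ∂ν‖ / m₂) := by
    rw [abs_mul, abs_of_nonneg (by positivity), mul_assoc, div_eq_inv_mul]
    gcongr
    exact hre hiY
  refine (abs_sub _ _).trans (add_le_add ((abs_sub _ _).trans (add_le_add (hcomb.trans
    (le_of_eq ?_)) hlX)) hlY)
  ring

end Remainder

section RemainderRate

variable {H ι : Type*} [NormedAddCommGroup H] [InnerProductSpace ℂ H] [CompleteSpace H] {k₀ : ℕ}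
  {e : Fin k₀ ↪ ι} {α β : ℝ} {i : Fin k₀}
  {CX CY : ℤ → HSSpace H} {lamX lamY : ℝ → ι → ℝ} {φX φY : ℝ → ι → H} {γ : ℝ}
  {w : ℝ → ℝ} {b₁ b₂ : ℝ} {T₁ T₂ : ℕ} {vX vY : ℤ → H} {η r c y₁ y₂ : ℝ}
  {lamX' lamY' : ℝ → ι → ℝ} {φX' φY' : ℝ → ι → H}

/-- The direction of the linear term in the overlap expansion. -/
def overlapDir (lam : ℝ → ι → ℝ) (φ ψ : ℝ → ι → H) (k : ι) (ω : ℝ) : HSSpace H :=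
  hsTensor H (overlapVec (lam ω) (φ ω) (ψ ω) k) (φ ω k)

/-- The direction of the linear term given by the weight operator. -/
def weightDir (lam : ℝ → ι → ℝ) (φ ψ : ℝ → ι → H) (k : ι) (ω : ℝ) : HSSpace H :=
  hsTensor H (coefVec (φ ω) (weightCoef (lam ω) (φ ω) (ψ ω) k)) (φ ω k)

theorem mul_le_two_mul_floor {x : ℝ} (h : 1 ≤ ⌊x⌋₊) : x ≤ 2 * (⌊x⌋₊ : ℝ) := by
  have h1 : (1 : ℝ) ≤ (⌊x⌋₊ : ℝ) := by exact_mod_cast h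
  linarith [Nat.lt_floor_add_one x]

theorem floor_mul_le (hη1 : η ≤ 1) (T : ℕ) : ⌊η * T⌋₊ ≤ T :=
  Nat.floor_le_of_le (mul_le_of_le_one_left (Nat.cast_nonneg T) hη1)

/-- Deterministic bound for the remainder along two sample paths. -/
theorem rate_mul_abs_remainder_le [SecondCountableTopology H] (hαβ : α ≤ β)
    (hX : EigenBand α β (specHS CX) e i lamX φX γ) (hY : EigenBand α β (specHS CY) e i lamY φY γ)
    (hCX : Summable fun h => ‖CX h‖) (hCY : Summable fun h => ‖CY h‖)
    (hX' : ∀ ω ∈ Set.Icc α β,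
      IsEigensystem e (seqEstimator w b₁ T₁ vX η ω) (lamX' ω) (φX' ω))
    (hY' : ∀ ω ∈ Set.Icc α β,
      IsEigensystem e (seqEstimator w b₂ T₂ vY η ω) (lamY' ω) (φY' ω))
    (hXm : AEStronglyMeasurable (fun ω => φX' ω (e i)) (volume.restrict (Set.Icc α β)))
    (hYm : AEStronglyMeasurable (fun ω => φY' ω (e i)) (volume.restrict (Set.Icc α β)))
    (pX : PathBound w b₁ T₁ CX (overlapDir lamX φX φY (e i)) (weightDir lamX φX φY (e i))
      (volume.restrict (Set.Icc α β)) vX y₁)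
    (pY : PathBound w b₂ T₂ CY (overlapDir lamY φY φX (e i)) (weightDir lamY φY φX (e i))
      (volume.restrict (Set.Icc α β)) vY y₂)
    (hb₁ : 0 < b₁) (hb₂ : 0 < b₂) (hT₁ : 0 < T₁) (hT₂ : 0 < T₂) (hη : 0 ≤ η) (hη1 : η ≤ 1)
    (hr0 : 0 ≤ r) (hc : 0 ≤ c) (hr₁ : r ≤ c * Real.sqrt (b₁ * T₁))
    (hr₂ : r ≤ c * Real.sqrt (b₂ * T₂)) :
    r * |centeredDistance α β η (fun ω => φX' ω (e i)) (fun ω => φY' ω (e i))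
        (fun ω => φX ω (e i)) (fun ω => φY ω (e i)) -
      η * ∫ ω in α..β,
        ((hsInner (partialSumProcess w b₂ T₂ vY (hsOp H (specHS CY ω)) η ω)
            (weightOp (lamY ω) (φY ω) (φX ω) (e i))).re / Real.sqrt (b₂ * T₂)
          + (hsInner (partialSumProcess w b₁ T₁ vX (hsOp H (specHS CX ω)) η ω)
            (weightOp (lamX ω) (φX ω) (φY ω) (e i))).re / Real.sqrt (b₁ * T₁))| ≤
      (480 * c / γ ^ 2 + 9 * c + 2 * (β - α) * c) * (y₁ + y₂) := by
  have hγ := hX.gap_pos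
  have hy₁ : 0 ≤ y₁ := (Real.sqrt_nonneg _).trans pX.sqrt_le
  have hy₂ : 0 ≤ y₂ := (Real.sqrt_nonneg _).trans pY.sqrt_le
  have hba : 0 ≤ β - α := sub_nonneg.2 hαβ
  have hlin := abs_linear_term_le hαβ hX hY hCX hCY w b₁ b₂ T₁ T₂ vX vY η
    (Real.sqrt (b₁ * T₁)) (Real.sqrt (b₂ * T₂)) (Real.sqrt_nonneg _) (Real.sqrt_nonneg _)
  set L := ∫ ω in α..β,
        ((hsInner (partialSumProcess w b₂ T₂ vY (hsOp H (specHS CY ω)) η ω)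
            (weightOp (lamY ω) (φY ω) (φX ω) (e i))).re / Real.sqrt (b₂ * T₂)
          + (hsInner (partialSumProcess w b₁ T₁ vX (hsOp H (specHS CX ω)) η ω)
            (weightOp (lamX ω) (φX ω) (φY ω) (e i))).re / Real.sqrt (b₁ * T₁))
  set D := centeredDistance α β η (fun ω => φX' ω (e i)) (fun ω => φY' ω (e i))
        (fun ω => φX ω (e i)) (fun ω => φY ω (e i))
  have hL : r * |η * L| ≤ c * (y₁ + y₂) := by
    have h1 := rate_mul_lin_le' hb₁ hT₁ hη hη1 hc hr₁ (norm_nonneg _)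
      (pX.lin_le' _ (floor_mul_le hη1 T₁))
    have h2 := rate_mul_lin_le' hb₂ hT₂ hη hη1 hc hr₂ (norm_nonneg _)
      (pY.lin_le' _ (floor_mul_le hη1 T₂))
    rw [abs_mul, abs_of_nonneg hη]
    refine (mul_le_mul_of_nonneg_left (mul_le_mul_of_nonneg_left hlin hη) hr0).trans ?_
    rw [mul_add, mul_add]
    refine (add_le_add h2 h1).trans (le_of_eq ?_)
    ring
  have hD : r * |D| ≤ (480 * c / γ ^ 2 + 8 * c + 2 * (β - α) * c) * (y₁ + y₂) := by
    have hdeg : r * η ^ 2 ≤ c * (y₁ + y₂) →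
        r * |D| ≤ (480 * c / γ ^ 2 + 8 * c + 2 * (β - α) * c) * (y₁ + y₂) := by
      intro h
      have h1 := abs_centeredDistance_le hαβ (η := η)
        (fun ω hω => (hX' ω hω).norm_eq_one (e i)) (fun ω hω => (hY' ω hω).norm_eq_one (e i))
        (fun ω hω => (hX.eig ω hω).norm_eq_one (e i)) (fun ω hω => (hY.eig ω hω).norm_eq_one (e i))
      have h2 : 0 ≤ (480 * c / γ ^ 2 + 8 * c) * (y₁ + y₂) := by positivity
      calc r * |D| ≤ r * (2 * (β - α) * η ^ 2) := mul_le_mul_of_nonneg_left h1 hr0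
        _ = 2 * (β - α) * (r * η ^ 2) := by ring
        _ ≤ 2 * (β - α) * (c * (y₁ + y₂)) := by gcongr
        _ ≤ _ := by linarith
    rcases Nat.eq_zero_or_pos ⌊η * T₁⌋₊ with h₁ | h₁
    · refine hdeg ((rate_mul_sq_le_of_lt hb₁ hT₁ hη (Nat.floor_eq_zero.1 h₁).le hc hr₁
        pX.sqrt_le).trans ?_)
      gcongr; linarith
    rcases Nat.eq_zero_or_pos ⌊η * T₂⌋₊ with h₂ | h₂
    · refine hdeg ((rate_mul_sq_le_of_lt hb₂ hT₂ hη (Nat.floor_eq_zero.1 h₂).le hc hr₂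
        pY.sqrt_le).trans ?_)
      gcongr; linarith
    have h := abs_centeredDistance_le_of_pos hαβ hX hY hCX hCY hX' hY' hXm hYm h₁ h₂
    have q₁ := rate_mul_sq_le hb₁ hT₁ hη h₁ (mul_le_two_mul_floor h₁) hc hr₁
      (integral_nonneg fun ω => by positivity) (pX.sq_le _ (floor_mul_le hη1 T₁))
    have q₂ := rate_mul_sq_le hb₂ hT₂ hη h₂ (mul_le_two_mul_floor h₂) hc hr₂
      (integral_nonneg fun ω => by positivity) (pY.sq_le _ (floor_mul_le hη1 T₂))
    have l₁ := rate_mul_lin_le hb₁ hT₁ hη hη1 h₁ (mul_le_two_mul_floor h₁) hc hr₁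
      (norm_nonneg _) (pX.lin_le _ (floor_mul_le hη1 T₁))
    have l₂ := rate_mul_lin_le hb₂ hT₂ hη hη1 h₂ (mul_le_two_mul_floor h₂) hc hr₂
      (norm_nonneg _) (pY.lin_le _ (floor_mul_le hη1 T₂))
    simp only [overlapDir] at l₁ l₂
    generalize (∫ ω in Set.Icc α β, ‖lagForm w b₁ CX vX ⌊η * T₁⌋₊ ω‖ ^ 2) /
      (⌊η * T₁⌋₊ : ℝ) ^ 2 = I₁ at h q₁
    generalize (∫ ω in Set.Icc α β, ‖lagForm w b₂ CY vY ⌊η * T₂⌋₊ ω‖ ^ 2) /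
      (⌊η * T₂⌋₊ : ℝ) ^ 2 = I₂ at h q₂
    generalize ‖∫ ω in Set.Icc α β, inner ℂ (hsTensor H (overlapVec (lamX ω) (φX ω) (φY ω) (e i))
      (φX ω (e i))) (lagForm w b₁ CX vX ⌊η * T₁⌋₊ ω)‖ / (⌊η * T₁⌋₊ : ℝ) = J₁ at h l₁
    generalize ‖∫ ω in Set.Icc α β, inner ℂ (hsTensor H (overlapVec (lamY ω) (φY ω) (φX ω) (e i))
      (φY ω (e i))) (lagForm w b₂ CY vY ⌊η * T₂⌋₊ ω)‖ / (⌊η * T₂⌋₊ : ℝ) = J₂ at h l₂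
    have h0 : 0 ≤ 2 * (β - α) * c * (y₁ + y₂) := by positivity
    calc r * |D| ≤ r * _ := mul_le_mul_of_nonneg_left h hr0
      _ = 120 / γ ^ 2 * (r * (η ^ 2 * I₁) + r * (η ^ 2 * I₂)) +
          4 * (r * (η ^ 2 * J₁) + r * (η ^ 2 * J₂)) := by ring
      _ ≤ 120 / γ ^ 2 * (4 * c * y₁ + 4 * c * y₂) + 4 * (2 * c * y₁ + 2 * c * y₂) := by gcongr
      _ = (480 * c / γ ^ 2 + 8 * c) * (y₁ + y₂) := by ring
      _ ≤ _ := by linarith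
  calc r * |D - η * L| ≤ r * (|D| + |η * L|) := mul_le_mul_of_nonneg_left (abs_sub _ _) hr0
    _ = r * |D| + r * |η * L| := mul_add _ _ _
    _ ≤ _ := add_le_add hD hL
    _ = _ := by ring

end RemainderRate

section RateBalance

/-- In both regimes, the rate is comparable with the rates of the two samples. -/
theorem exists_sqrt_add_le {u v : ℕ → ℝ} (hu : ∀ᶠ n in atTop, 0 < u n) (hv : ∀ᶠ n in atTop, 0 < v n)
    {θ : ℝ} (hθ : θ ∈ Set.Ioo (0 : ℝ) 1) (h : Tendsto (fun n => u n / (u n + v n)) atTop (𝓝 θ)) :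
    ∃ c, 0 ≤ c ∧ ∀ᶠ n in atTop, Real.sqrt (u n + v n) ≤ c * Real.sqrt (u n) ∧
      Real.sqrt (u n + v n) ≤ c * Real.sqrt (v n) := by
  obtain ⟨h0, h1⟩ := hθ
  set κ := max (2 / θ) (2 / (1 - θ)) with hκ
  have hκ0 : 0 ≤ κ := le_max_of_le_left (by positivity)
  have h1' : 0 < 1 - θ := by linarith
  refine ⟨Real.sqrt κ, Real.sqrt_nonneg _, ?_⟩
  filter_upwards [hu, hv, h.eventually (lt_mem_nhds (show θ / 2 < θ by linarith)),
    h.eventually (gt_mem_nhds (show θ < (1 + θ) / 2 by linarith))] with n hu hv hl hr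
  have hs : 0 < u n + v n := by positivity
  rw [lt_div_iff₀ hs] at hl
  rw [div_lt_iff₀ hs] at hr
  rw [← Real.sqrt_mul hκ0, ← Real.sqrt_mul hκ0]
  constructor <;> refine Real.sqrt_le_sqrt ?_
  · calc u n + v n = 2 / θ * (θ / 2 * (u n + v n)) := by field_simp
      _ ≤ 2 / θ * u n := by gcongr
      _ ≤ _ := by gcongr; exact le_max_left _ _
  · calc u n + v n = 2 / (1 - θ) * ((1 - θ) / 2 * (u n + v n)) := by field_simp
      _ ≤ 2 / (1 - θ) * v n := by gcongr; linarith
      _ ≤ _ := by gcongr; exact le_max_right _ _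

theorem tendsto_mul_div_add_mul {b₁ b₂ : ℕ → ℝ} {T : ℕ → ℕ} (hT : Tendsto T atTop atTop)
    (h₂ : ∀ᶠ n in atTop, 0 < b₂ n ∧ 0 < n) (h : Tendsto (fun n => b₁ n / b₂ n) atTop (𝓝 1)) :
    Tendsto (fun n => b₁ (T n) * T n / (b₁ (T n) * T n + b₂ (T n) * T n)) atTop (𝓝 (1 / 2)) := by
  have h1 : Tendsto (fun n => b₁ n / b₂ n / (b₁ n / b₂ n + 1)) atTop (𝓝 (1 / (1 + 1))) :=
    h.div (h.add_const 1) (by norm_num)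
  rw [show (1 : ℝ) / 2 = 1 / (1 + 1) by norm_num]
  refine (h1.comp hT).congr' ?_
  filter_upwards [hT.eventually h₂] with n hn
  obtain ⟨hb, hn⟩ := hn
  have : (0 : ℝ) < T n := by exact_mod_cast hn
  simp only [Function.comp]
  rw [← add_mul, mul_div_mul_right _ _ this.ne', div_add_one hb.ne', div_div_div_cancel_right₀ hb.ne']

end RateBalance

section Probability

variable {Ω : Type*} [MeasurableSpace Ω] {μ : Measure Ω}

/-- A remainder dominated by variables of arbitrarily small mean is negligible. -/
theorem uniformLittleOP_of_dominated {R : ℕ → ℝ → Ω → ℝ} {r : ℕ → ℝ} {K : ℝ} (hK : 0 ≤ K)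
    (h : ∀ e : ℝ≥0∞, e ≠ 0 → ∀ᶠ n in atTop, ∃ Y : Ω → ℝ≥0∞, AEMeasurable Y μ ∧ ∫⁻ x, Y x ∂μ ≤ e ∧
      ∀ x, Y x ≠ ∞ → ∀ η ∈ Set.Icc (0 : ℝ) 1, r n * |R n η x| ≤ K * (Y x).toReal) :
    UniformLittleOP μ R r := by
  intro δ hδ
  rw [ENNReal.tendsto_nhds_zero]
  intro ε hε
  set a := ENNReal.ofReal (δ / (K + 1)) with ha
  have ha0 : a ≠ 0 := by
    rw [ha, Ne, ENNReal.ofReal_eq_zero, not_le]; positivity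
  have hat : a ≠ ∞ := ENNReal.ofReal_ne_top
  filter_upwards [h (a * ε) (mul_ne_zero ha0 hε.ne')] with n hn
  obtain ⟨Y, hY, hYe, hR⟩ := hn
  have hsub : {x | ∃ η ∈ Set.Icc (0 : ℝ) 1, δ < r n * |R n η x|} ⊆ {x | a ≤ Y x} := by
    rintro x ⟨η, hη, hx⟩
    by_cases hYx : Y x = ∞
    · show a ≤ Y x
      rw [hYx]; exact le_top
    · have h1 := hx.trans_le (hR x hYx η hη)
      show a ≤ Y x
      rw [ha, ENNReal.ofReal_le_iff_le_toReal hYx, div_le_iff₀ (by positivity)]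
      have := ENNReal.toReal_nonneg (a := Y x)
      nlinarith
  calc μ _ ≤ μ {x | a ≤ Y x} := measure_mono hsub
    _ ≤ (∫⁻ x, Y x ∂μ) / a := meas_ge_le_lintegral_div hY ha0 hat
    _ ≤ a * ε / a := by gcongr
    _ = ε := by rw [mul_comm, ENNReal.mul_div_cancel_right ha0 hat]

end Probability

end

theorem theorem3p5
    {Ω S S' H ι : Type*} [MeasurableSpace Ω] [MeasurableSpace S] [MeasurableSpace S']
    [NormedAddCommGroup H] [InnerProductSpace ℂ H] [CompleteSpace H]
    [SecondCountableTopology H] [MeasurableSpace H] [BorelSpace H]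
    (μ : Measure Ω) [IsProbabilityMeasure μ]
    -- the two time series, their innovations and the independent copies
    (X Y : ℤ → Ω → H) (εX : ℤ → Ω → S) (εX₀ : Ω → S) (εY : ℤ → Ω → S') (εY₀ : Ω → S')
    (δ : ℝ) (hδ : 0 < δ)
    (hXY : CenteredStationaryPair μ X Y (ENNReal.ofReal (4 + δ)))
    (hX : PhysicalDependence μ εX εX₀ X (ENNReal.ofReal (4 + δ)))
    (hY : PhysicalDependence μ εY εY₀ Y (ENNReal.ofReal (4 + δ)))
    -- window and bandwidths
    (w : ℝ → ℝ) (hw : LagWindow w)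
    (b₁ b₂ : ℕ → ℝ) (ℓ₁ ℓ₂ : ℝ)
    (hb₁ : BandwidthCondition μ εX εX₀ X w b₁ ℓ₁)
    (hb₂ : BandwidthCondition μ εY εY₀ Y w b₂ ℓ₂)
    -- sample sizes and balance of the rates
    (T₁ T₂ : ℕ → ℕ) (hT₁ : Tendsto T₁ atTop atTop) (hT₂ : Tendsto T₂ atTop atTop)
    (hindep : IndepFun (fun x t => X t x) (fun x t => Y t x) μ →
      ∃ θ ∈ Set.Ioo (0 : ℝ) 1, Tendsto
        (fun n => b₁ (T₁ n) * T₁ n / (b₁ (T₁ n) * T₁ n + b₂ (T₂ n) * T₂ n)) atTop (𝓝 θ))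
    (hdep : ¬ IndepFun (fun x t => X t x) (fun x t => Y t x) μ →
      T₁ = T₂ ∧ Tendsto (fun T => b₁ T / b₂ T) atTop (𝓝 1))
    -- frequency band
    (a b : ℝ) (ha : 0 ≤ a) (hab : a ≤ b) (hb : b ≤ Real.pi)
    -- population eigensystems and separation of the first `k₀` eigenvalues
    {k₀ : ℕ} (e : Fin k₀ ↪ ι)
    (lamX lamY : ℝ → ι → ℝ) (φX φY : ℝ → ι → H)
    (hφX : ∀ ω ∈ Set.Icc a b, IsEigensystem e (spectralDensity μ X ω) (lamX ω) (φX ω))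
    (hφY : ∀ ω ∈ Set.Icc a b, IsEigensystem e (spectralDensity μ Y ω) (lamY ω) (φY ω))
    (hφXm : ∀ j, AEStronglyMeasurable (fun ω => φX ω j) (volume.restrict (Set.Icc a b)))
    (hφYm : ∀ j, AEStronglyMeasurable (fun ω => φY ω j) (volume.restrict (Set.Icc a b)))
    (hsepX : ∀ ω ∈ Set.Icc a b,
      StrictAnti (fun i => lamX ω (e i)) ∧ ∀ i, 0 < lamX ω (e i))
    (hsepY : ∀ ω ∈ Set.Icc a b,
      StrictAnti (fun i => lamY ω (e i)) ∧ ∀ i, 0 < lamY ω (e i))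
    -- eigensystems of the sequential estimators
    (lamXhat lamYhat : ℕ → ℝ → Ω → ℝ → ι → ℝ) (φXhat φYhat : ℕ → ℝ → Ω → ℝ → ι → H)
    (hφXhat : ∀ n, ∀ η ∈ Set.Icc (0 : ℝ) 1, ∀ x, ∀ ω ∈ Set.Icc a b,
      IsEigensystem e (seqEstimator w (b₁ (T₁ n)) (T₁ n) (fun t => X t x) η ω)
        (lamXhat n η x ω) (φXhat n η x ω))
    (hφYhat : ∀ n, ∀ η ∈ Set.Icc (0 : ℝ) 1, ∀ x, ∀ ω ∈ Set.Icc a b,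
      IsEigensystem e (seqEstimator w (b₂ (T₂ n)) (T₂ n) (fun t => Y t x) η ω)
        (lamYhat n η x ω) (φYhat n η x ω))
    (hφXhatm : ∀ n, ∀ η ∈ Set.Icc (0 : ℝ) 1, ∀ x, ∀ j,
      AEStronglyMeasurable (fun ω => φXhat n η x ω j) (volume.restrict (Set.Icc a b)))
    (hφYhatm : ∀ n, ∀ η ∈ Set.Icc (0 : ℝ) 1, ∀ x, ∀ j,
      AEStronglyMeasurable (fun ω => φYhat n η x ω j) (volume.restrict (Set.Icc a b)))
    -- the position of the eigenprojector, one of the first `k₀ - 1`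
    (i : Fin k₀) (hi : (i : ℕ) + 1 < k₀) :
    UniformLittleOP μ
      (fun n η x =>
        centeredDistance a b η
          (fun ω => φXhat n η x ω (e i)) (fun ω => φYhat n η x ω (e i))
          (fun ω => φX ω (e i)) (fun ω => φY ω (e i))
        - η * ∫ ω in a..b,
            ((hsInner
                (partialSumProcess w (b₂ (T₂ n)) (T₂ n) (fun t => Y t x)
                  (spectralDensity μ Y ω) η ω)
                (weightOp (lamY ω) (φY ω) (φX ω) (e i))).re
                / Real.sqrt (b₂ (T₂ n) * T₂ n)
              + (hsInner
                (partialSumProcess w (b₁ (T₁ n)) (T₁ n) (fun t => X t x)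
                  (spectralDensity μ X ω) η ω)
                (weightOp (lamX ω) (φX ω) (φY ω) (e i))).re
                / Real.sqrt (b₁ (T₁ n) * T₁ n)))
      (fun n => Real.sqrt (b₁ (T₁ n) * T₁ n + b₂ (T₂ n) * T₂ n)) := by
  obtain ⟨hlX, hsX⟩ := hX.lagProcess hδ hXY.memLp_fst hXY.mean_fst hXY.cov_fst hb₁.one_le
    hb₁.summable
  obtain ⟨hlY, hsY⟩ := hY.lagProcess hδ hXY.memLp_snd hXY.mean_snd hXY.cov_snd hb₂.one_le
    hb₂.summable
  set CX : ℤ → HSSpace H := fun h => ∫ x, hsTensor H (X h x) (X 0 x) ∂μ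
  set CY : ℤ → HSSpace H := fun h => ∫ x, hsTensor H (Y h x) (Y 0 x) ∂μ
  have hCX := hlX.summable_norm (by linarith [hb₁.one_le])
  have hCY := hlY.summable_norm (by linarith [hb₂.one_le])
  have hrX := hb₁.lagRate hw
  have hrY := hb₂.lagRate hw
  obtain ⟨γX, hX₀⟩ := exists_eigenBand (F := specHS CX) (continuous_specHS hCX)
    (fun ω hω => hsX ω ▸ hφX ω hω) hφXm hsepX i hi
  obtain ⟨γY, hY₀⟩ := exists_eigenBand (F := specHS CY) (continuous_specHS hCY)
    (fun ω hω => hsY ω ▸ hφY ω hω) hφYm hsepY i hi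
  have hγ : 0 < min γX γY := lt_min hX₀.gap_pos hY₀.gap_pos
  have hXb := hX₀.mono hγ (min_le_left _ _)
  have hYb := hY₀.mono hγ (min_le_right _ _)
  have hp₁ := hT₁.eventually hrX.pos
  have hp₂ := hT₂.eventually hrY.pos
  have hu : ∀ᶠ n in atTop, 0 < b₁ (T₁ n) * T₁ n := by
    filter_upwards [hp₁] with n hn
    exact mul_pos hn.1 (by exact_mod_cast hn.2)
  have hv : ∀ᶠ n in atTop, 0 < b₂ (T₂ n) * T₂ n := by
    filter_upwards [hp₂] with n hn
    exact mul_pos hn.1 (by exact_mod_cast hn.2)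
  obtain ⟨θ, hθ, hbal⟩ : ∃ θ ∈ Set.Ioo (0 : ℝ) 1, Tendsto
      (fun n => b₁ (T₁ n) * T₁ n / (b₁ (T₁ n) * T₁ n + b₂ (T₂ n) * T₂ n)) atTop (𝓝 θ) := by
    by_cases hI : IndepFun (fun x t => X t x) (fun x t => Y t x) μ
    · exact hindep hI
    · obtain ⟨hT, hlim⟩ := hdep hI
      refine ⟨1 / 2, by norm_num, ?_⟩
      rw [← hT]
      exact tendsto_mul_div_add_mul hT₁ hrY.pos hlim
  obtain ⟨c, hc, hcr⟩ := exists_sqrt_add_le hu hv hθ hbal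
  have hba : 0 ≤ b - a := sub_nonneg.2 hab
  refine uniformLittleOP_of_dominated
    (K := 480 * c / min γX γY ^ 2 + 9 * c + 2 * (b - a) * c) (by positivity) fun ε hε => ?_
  have hε2 : ε / 2 ≠ 0 := ENNReal.div_ne_zero.2 ⟨hε, by finiteness⟩
  filter_upwards [hp₁, hp₂, hcr,
    hT₁.eventually (hlX.exists_pathBound (by linarith) hrX ha hb (hXb.memLp_overlap hYb)
      (hXb.memLp_weight hYb) hε2),
    hT₂.eventually (hlY.exists_pathBound (by linarith) hrY ha hb (hYb.memLp_overlap hXb)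
      (hYb.memLp_weight hXb) hε2)] with n hp₁ hp₂ hcr hX₁ hY₁
  obtain ⟨Y₁, hm₁, hi₁, hB₁⟩ := hX₁
  obtain ⟨Y₂, hm₂, hi₂, hB₂⟩ := hY₁
  refine ⟨fun x => Y₁ x + Y₂ x, hm₁.add hm₂, ?_, fun x hx η hη => ?_⟩
  · rw [lintegral_add_right' _ hm₂]
    exact (add_le_add hi₁ hi₂).trans (ENNReal.add_halves ε).le
  · obtain ⟨hx₁, hx₂⟩ := ENNReal.add_ne_top.1 hx
    rw [ENNReal.toReal_add hx₁ hx₂]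
    simp_rw [hsX, hsY]
    exact rate_mul_abs_remainder_le hab hXb hYb hCX hCY (hφXhat n η hη x) (hφYhat n η hη x)
      (hφXhatm n η hη x _) (hφYhatm n η hη x _) (hB₁ x hx₁) (hB₂ x hx₂) hp₁.1 hp₂.1 hp₁.2 hp₂.2
      hη.1 hη.2 (Real.sqrt_nonneg _) hc hcr.1 hcr.2
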